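/- Let $G(x)=-\tfrac12 e^{-|x|}$, let $\bar u\in C^1(\mathbb R)\cap L^1(\mathbb R)$, and let $u$ be the weak entropy solution of the Burgers--Poisson equation $u_t+(u^2/2)_x=[G*u]_x$, $u(0,\cdot)=\bar u$. That is: $u\in L^1_{loc}([0,\infty)\times\mathbb R)\cap L^\infty_{loc}((0,\infty),L^\infty(\mathbb R))$; $t\mapsto u(t,\cdot)$ is continuous on $[0,\infty)$ with values in $L^1(\mathbb R)$ and $u(0,\cdot)=\bar u$; and for all $k\in\mathbb R$ and all non-negative $\phi\in C^1_c((0,\infty)\times\mathbb R)$, $$\iint\Big[|u-k|\phi_t+\mathrm{sign}(u-k)\Big(\frac{u^2}2-\frac{k^2}2\Big)\phi_x+\mathrm{sign}(u-k)[G_x*u(t,\cdot)](x)\phi\Big]dx\,dt\ge 0 .$$ Let $\bar x\in\mathbb R$ and let $x(t)$ be the characteristic through $\bar x$, $x'(t)=u(t,x(t))$, $x(0)=\bar x$, followed as long as it exists in the classical sense: $x$ is a classical characteristic on $[0,T)$, $T>0$, if $u$ is (a.e. equal to) a $C^1$ function on a relatively open neighbourhood in $[0,\infty)\times\mathbb R$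 of $\{(t,x(t)):0\le t<T\}$ and $x$ solves this initial value problem on $[0,T)$. It is maximal if every classical characteristic through $\bar x$ is a restriction of it. Suppose that a classical characteristic through $\bar x$ exists on some $[0,T)$, $T>0$. For a curve $y$ on $[0,S)$ say that $u$ is *smooth around $y$ before $S$* if, for some $r>0$, $u$ is (a.e. equal to) a $C^1$ function in the tube $\{(t,\xi):\max(0,S-r)<t<S,\ |\xi-y(t)|<r\}$ (so no singularity from outside reaches the curve before $S$). Put $A=\sqrt{|\bar u(\bar x)|+2\|\bar u\|_{L^1}}$. (i) Let $$T_*=\ln\Big(1+\frac1A\Big(\frac\pi2+\arctan\frac{\bar u'(\bar x)}{A}\Big)\Big)\qquad(T_*=+\infty\text{ if }A=0).$$ For every classical characteristic $x$ on $[0,T)$ through $\bar x$, $u_x(t,x(t))$ is bounded on $[0,T)\cap[0,T_*)$. Moreover, if the maximal classical characteristic $x$ lives on $[0,S)$ with $S\le T_*$, $S<\infty$, then $u$ is not smooth around $x$ before $S$; that is, up to time $T_*$ the classical characteristic can only end because of a singularity coming from outside. (ii) If $\bar u'(\bar x)<-\tfrac12-\sqrt{A^2+\tfrac14}$, then the maximal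 classical characteristic $x$ lives on $[0,t^*)$ with $$t^*<T^*=\frac{2}{\big|2\bar u'(\bar x)+1+2\sqrt{A^2+\frac14}\big|},$$ and $u_x$ becomes unbounded at the characteristic as $t\uparrow t^*$: for every $r>0$ there is no $K$ such that $u(t,\cdot)$ is (essentially) $K$-Lipschitz on $(x(t)-r,x(t)+r)$ for all $t\in(t^*-r,t^*)$, $t>0$. If moreover $u$ is smooth around $x$ before $t^*$, then $u_x(t,x(t))\to-\infty$ as $t\uparrow t^*$. -/

import Mathlib

open MeasureTheory Set Filter Topology

noncomputable section

namespace BurgersPoisson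

/-- The kernel `G(x) = -(1/2) e^{-|x|}`, the fundamental solution of `φ'' - φ = u`. -/
def G (x : ℝ) : ℝ := -(1 / 2) * Real.exp (-|x|)

/-- The (a.e. and distributional) derivative `G_x(x) = (1/2) sign(x) e^{-|x|}` of `G`. -/
def Gx (x : ℝ) : ℝ := (1 / 2) * Real.sign x * Real.exp (-|x|)

theorem hasDerivAt_G {x : ℝ} (hx : x ≠ 0) : HasDerivAt G (Gx x) x := by
  have h := ((hasDerivAt_abs hx).neg.exp).const_mul (-(1 / 2) : ℝ)
  refine h.congr_deriv ?_
  rcases lt_or_gt_of_ne hx with h0 | h0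
  · simp [Gx, Real.sign_of_neg h0, h0]
  · simp [Gx, Real.sign_of_pos h0, h0]

/-- The nonlocal source `[G_x * w](x)`. -/
def source (w : ℝ → ℝ) (x : ℝ) : ℝ := ∫ y, Gx (x - y) * w y

/-- `u` (a representative, with `u t x` the value at time `t` and position `x`; only `t ≥ 0`
matters) is a weak entropy solution of `u_t + (u²/2)_x = [G * u]_x` with `u(0,·) = ubar`. -/
structure IsWeakEntropySolution (ubar : ℝ → ℝ) (u : ℝ → ℝ → ℝ) : Prop where
  /-- `u ∈ L¹_loc([0,∞) × ℝ)` -/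
  locallyIntegrable :
    LocallyIntegrableOn (fun p : ℝ × ℝ => u p.1 p.2) (Ici 0 ×ˢ univ) volume
  /-- `u ∈ L^∞_loc((0,∞), L^∞(ℝ))` -/
  locallyBounded : ∀ a b : ℝ, 0 < a → a < b → ∃ M : ℝ,
    ∀ᵐ p : ℝ × ℝ ∂(volume.restrict (Icc a b ×ˢ univ)), |u p.1 p.2| ≤ M
  /-- `u(t,·) ∈ L¹(ℝ)` for every `t ≥ 0` -/
  integrable : ∀ t : ℝ, 0 ≤ t → Integrable (u t)
  /-- `t ↦ u(t,·)` is continuous on `[0,∞)` with values in `L¹(ℝ)` -/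
  continuous : ∀ t : ℝ, 0 ≤ t →
    Tendsto (fun s => ∫ x, |u s x - u t x|) (𝓝[Ici 0] t) (𝓝 0)
  /-- the initial condition -/
  initial : u 0 =ᵐ[volume] ubar
  /-- the Kruzhkov entropy inequalities with the nonlocal source -/
  entropy : ∀ (k : ℝ) (φ : ℝ × ℝ → ℝ), ContDiff ℝ 1 φ → HasCompactSupport φ →
    tsupport φ ⊆ Ioi 0 ×ˢ univ → (∀ p, 0 ≤ φ p) →
    0 ≤ ∫ p in (Ioi (0 : ℝ) ×ˢ (univ : Set ℝ)),
      (|u p.1 p.2 - k| * fderiv ℝ φ p (1, 0)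
        + Real.sign (u p.1 p.2 - k) * ((u p.1 p.2) ^ 2 / 2 - k ^ 2 / 2) * fderiv ℝ φ p (0, 1)
        + Real.sign (u p.1 p.2 - k) * source (u p.1) p.2 * φ p)

/-- `x` is, on `[0,T)`, the characteristic through `xbar` in the classical sense: on a relatively
open neighbourhood in `[0,∞) × ℝ` of the curve `{(t, x(t)) : 0 ≤ t < T}` the solution `u`
agrees a.e. with the `C¹` function `v` (which is thereby determined near the curve), and
`x'(t) = v(t, x(t))`, `x(0) = xbar`. Thus `u_x(t, x(t))` is `∂ₓ v(t, x(t))`. -/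
structure IsClassicalCharacteristic (u : ℝ → ℝ → ℝ) (xbar T : ℝ) (x : ℝ → ℝ)
    (v : ℝ × ℝ → ℝ) : Prop where
  pos : 0 < T
  initial : x 0 = xbar
  classical : ∃ U : Set (ℝ × ℝ), IsOpen U ∧ (∀ t ∈ Ico 0 T, (t, x t) ∈ U) ∧
    ContDiffOn ℝ 1 v (U ∩ {p | 0 ≤ p.1}) ∧
    ∀ᵐ p : ℝ × ℝ ∂(volume.restrict (U ∩ {p | 0 ≤ p.1})), u p.1 p.2 = v p
  ode : ∀ t ∈ Ico 0 T, HasDerivWithinAt x (v (t, x t)) (Ico 0 T) t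

/-- The derivative `u_x(t, x(t))` of the solution along the curve `x`, computed from the `C¹`
version `v` of `u`. -/
def slope (v : ℝ × ℝ → ℝ) (x : ℝ → ℝ) (t : ℝ) : ℝ := deriv (fun ξ => v (t, ξ)) (x t)

/-- The classical characteristic `x` on `[0,S)` is the maximal one: every classical characteristic
through `xbar` is a restriction of it. -/
def IsMaximalCharacteristic (u : ℝ → ℝ → ℝ) (xbar S : ℝ) (x : ℝ → ℝ) (v : ℝ × ℝ → ℝ) : Prop :=
  IsClassicalCharacteristic u xbar S x v ∧
    ∀ (S' : ℝ) (x' : ℝ → ℝ) (v' : ℝ × ℝ → ℝ), IsClassicalCharacteristic u xbar S' x' v' →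
      S' ≤ S ∧ EqOn x' x (Ico 0 S')

/-- The tube of radius `r` around the curve `x`, during the last `r` time units before `S`. -/
def tube (x : ℝ → ℝ) (S r : ℝ) : Set (ℝ × ℝ) :=
  {p | 0 < p.1 ∧ S - r < p.1 ∧ p.1 < S ∧ |p.2 - x p.1| < r}

/-- Up to time `S` no singularity from outside reaches the curve `x`: `u` is (a.e. equal to) a
`C¹` function in some tube around it before time `S`. -/
def IsSmoothAroundBefore (u : ℝ → ℝ → ℝ) (x : ℝ → ℝ) (S : ℝ) : Prop :=
  ∃ r > 0, ∃ g : ℝ × ℝ → ℝ, ContDiffOn ℝ 1 g (tube x S r) ∧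
    ∀ᵐ p : ℝ × ℝ ∂(volume.restrict (tube x S r)), u p.1 p.2 = g p

/-- `u_x` is bounded by a constant in some tube around the curve `x` before time `S`, in the sense
that `u(t,·)` is (essentially) Lipschitz there, uniformly in `t`. -/
def HasBoundedSlopeAroundBefore (u : ℝ → ℝ → ℝ) (x : ℝ → ℝ) (S : ℝ) : Prop :=
  ∃ r > 0, ∃ K : ℝ, ∀ t : ℝ, 0 < t → S - r < t → t < S →
    ∀ᵐ a : ℝ, ∀ᵐ b : ℝ, (t, a) ∈ tube x S r → (t, b) ∈ tube x S r →
      |u t a - u t b| ≤ K * |a - b|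

/-- The quantity `|ubar(xbar)| + 2 ‖ubar‖_{L¹}`. -/
def size (ubar : ℝ → ℝ) (xbar : ℝ) : ℝ := |ubar xbar| + 2 * ∫ y, |ubar y|

/-- The time `T_*`; it is `+∞` for the zero initial datum, where the formula divides by zero. -/
def lowerTime (ubar : ℝ → ℝ) (xbar : ℝ) : EReal :=
  if size ubar xbar = 0 then ⊤ else
    ((Real.log (1 + 1 / √(size ubar xbar) *
      (Real.pi / 2 + Real.arctan (deriv ubar xbar / √(size ubar xbar)))) : ℝ) : EReal)

/-- The time `T^*`. -/
def upperTime (ubar : ℝ → ℝ) (xbar : ℝ) : ℝ :=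
  2 / |2 * deriv ubar xbar + 1 + 2 * √(size ubar xbar + 1 / 4)|

end BurgersPoisson

end

open MeasureTheory Set Filter Topology

noncomputable section

namespace BurgersPoisson

/-! Along a characteristic the velocity satisfies `d/dt u = G_x * u`. Since `G_xx = δ + G`, the
slope `q = u_x(t, x(t))` satisfies the Riccati equation `q' = a(t) - q²` with `a = u + G * u`.
Kruzhkov's inequality with `k = 0` and `‖G_x‖₁ ≤ 1` bounds the `L¹` norm of `u(t)` by `e^t ‖ubar‖₁`,
whence `|a(t)| ≤ (|ubar(xbar)| + ‖ubar‖₁) e^t` (`abs_riccatiCoeff_le`). Two scalar comparisons give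
the two times: `arctan (q/B) + B e^t` increases, which keeps `q` away from `-∞` up to `T_*`
(`bounded_of_riccati`), and `-e^{-t} q` satisfies a quadratic differential inequality that forces
blow-up before `T^*` (`blowup_of_riccati`).

The main work is to show that a classical characteristic ends only at a singularity. If `u(t, ·)` is
uniformly Lipschitz near the curve before time `S`, then the curve can be continued beyond `S`
(`exists_extension`). Regularity has to be extracted from the entropy inequalities. Shortly before
`S` the trajectories of `Z'' = [G_x * u](t, Z)` are solved with the initial velocities given by `u`;
the right-hand side is Lipschitz in space because `u` is bounded. A relative entropy inequality,
localised in a cone, permits comparison of `u` with the supersolutions `V + κ |x - Z|` and yields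
`|u - V| ≤ (K + 1) |x - Z|`. This wedge bound identifies `u` with `V` on the trajectories, and it
linearises the nonlocal term with a quadratic error, so that the flow is `C¹` in the starting point.
For a short time the stretching `∂Z/∂a` is at least `1/2`, and the inverse function theorem makes
`u` a `C¹` function on the swept region.

Conversely, if `u` is smooth in a tube around the curve, a bound `C` for the slope at one time close
to `S` already gives a uniform Lipschitz bound in a smaller tube up to `S`; how close depends on `C`
but not on that time (`hasBoundedSlope_of_smooth`). Hence, at the end of a maximal characteristic
with a smooth tube, `|q| → ∞`. Before `T_*` this contradicts the bound on `q`; in the steep case `q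
< 0` throughout, so `q → -∞`. -/

/-- The convolution `G * w`. -/
def potential (w : ℝ → ℝ) (x : ℝ) : ℝ := ∫ y, G (x - y) * w y

/-! ### The kernel, the nonlocal source and the identity `G_xx = δ + G`. -/

lemma continuous_G : Continuous G := by
  unfold G; fun_prop

lemma measurable_sign : Measurable Real.sign := by
  unfold Real.sign
  exact Measurable.ite measurableSet_Iio measurable_const
    (Measurable.ite measurableSet_Ioi measurable_const measurable_const)

lemma abs_sign_le (x : ℝ) : |Real.sign x| ≤ 1 := by
  rcases Real.sign_apply_eq x with h | h | h <;> simp [h]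

lemma measurable_Gx : Measurable Gx := by
  unfold Gx
  have := measurable_sign
  fun_prop

lemma abs_G_eq (x : ℝ) : |G x| = 1 / 2 * Real.exp (-|x|) := by
  rw [G, abs_mul, abs_of_pos (Real.exp_pos _), abs_neg, abs_of_pos (by norm_num)]

lemma abs_G_le (x : ℝ) : |G x| ≤ 1 / 2 := by
  rw [abs_G_eq]
  have : Real.exp (-|x|) ≤ 1 := Real.exp_le_one_iff.2 (by simp)
  linarith

lemma abs_Gx_le_exp (x : ℝ) : |Gx x| ≤ 1 / 2 * Real.exp (-|x|) := by
  rw [Gx, abs_mul, abs_mul, abs_of_pos (Real.exp_pos _)]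
  have := abs_sign_le x
  have h : |(1 / 2 : ℝ)| = 1 / 2 := abs_of_pos (by norm_num)
  rw [h]
  have := Real.exp_pos (-|x|)
  nlinarith

lemma abs_Gx_le (x : ℝ) : |Gx x| ≤ 1 / 2 := by
  refine (abs_Gx_le_exp x).trans ?_
  have : Real.exp (-|x|) ≤ 1 := Real.exp_le_one_iff.2 (by simp)
  linarith

lemma hasDerivAt_Gx {x : ℝ} (hx : x ≠ 0) : HasDerivAt Gx (G x) x := by
  rcases lt_or_gt_of_ne hx with h | h
  · have h1 : HasDerivAt (fun y : ℝ => -(1 / 2) * Real.exp y) (-(1 / 2) * Real.exp x) x :=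
      (Real.hasDerivAt_exp x).const_mul _
    have : Gx =ᶠ[𝓝 x] fun y : ℝ => -(1 / 2) * Real.exp y := by
      filter_upwards [eventually_lt_nhds h] with y hy
      simp [Gx, Real.sign_of_neg hy, abs_of_neg hy]
    have hG : G x = -(1 / 2) * Real.exp x := by rw [G, abs_of_neg h, neg_neg]
    rw [hG]
    exact h1.congr_of_eventuallyEq this
  · have h1 : HasDerivAt (fun y : ℝ => (1 / 2) * Real.exp (-y)) ((1 / 2) * (Real.exp (-x) * -1)) x :=
      ((hasDerivAt_neg x).exp).const_mul _
    have : Gx =ᶠ[𝓝 x] fun y : ℝ => (1 / 2) * Real.exp (-y) := by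
      filter_upwards [eventually_gt_nhds h] with y hy
      simp [Gx, Real.sign_of_pos hy, abs_of_pos hy]
    have hG : G x = 1 / 2 * (Real.exp (-x) * -1) := by rw [G, abs_of_pos h]; ring
    rw [hG]
    exact h1.congr_of_eventuallyEq this

/-- Removing the unit jump of `Gx` at the origin leaves a continuous primitive of `G`, to which the
fundamental theorem of calculus applies off a single point. -/
lemma continuous_Gx_sub_sign : Continuous fun x => Gx x - 1 / 2 * Real.sign x := by
  rw [continuous_iff_continuousAt]
  intro x
  rcases eq_or_ne x 0 with rfl | hx
  · have h : Tendsto (fun x : ℝ => 1 / 2 * (1 - Real.exp (-|x|))) (𝓝 0) (𝓝 0) := by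
      have : Continuous fun x : ℝ => 1 / 2 * (1 - Real.exp (-|x|)) := by fun_prop
      simpa using this.tendsto 0
    have h0 : Gx 0 - 1 / 2 * Real.sign 0 = 0 := by simp [Gx]
    rw [ContinuousAt, h0]
    refine squeeze_zero_norm (fun y => ?_) h
    have : Gx y - 1 / 2 * Real.sign y = -(1 / 2 * (1 - Real.exp (-|y|))) * Real.sign y := by
      rw [Gx]; ring
    rw [this, norm_mul, norm_neg]
    have h1 : Real.exp (-|y|) ≤ 1 := Real.exp_le_one_iff.2 (by simp)
    rw [Real.norm_of_nonneg (by linarith), Real.norm_eq_abs]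
    have := abs_sign_le y
    nlinarith
  · have h1 : ContinuousAt Real.sign x := by
      rcases lt_or_gt_of_ne hx with h | h
      · refine (continuousAt_const (y := (-1 : ℝ))).congr ?_
        filter_upwards [eventually_lt_nhds h] with y hy
        rw [Real.sign_of_neg hy]
      · refine (continuousAt_const (y := (1 : ℝ))).congr ?_
        filter_upwards [eventually_gt_nhds h] with y hy
        rw [Real.sign_of_pos hy]
    exact (hasDerivAt_Gx hx).continuousAt.sub (h1.const_mul _)

lemma hasDerivAt_Gx_sub_sign {x : ℝ} (hx : x ≠ 0) :
    HasDerivAt (fun x => Gx x - 1 / 2 * Real.sign x) (G x) x := by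
  have h1 : HasDerivAt Real.sign 0 x := by
    rcases lt_or_gt_of_ne hx with h | h
    · refine (hasDerivAt_const x (-1 : ℝ)).congr_of_eventuallyEq ?_
      filter_upwards [eventually_lt_nhds h] with y hy
      rw [Real.sign_of_neg hy]
    · refine (hasDerivAt_const x (1 : ℝ)).congr_of_eventuallyEq ?_
      filter_upwards [eventually_gt_nhds h] with y hy
      rw [Real.sign_of_pos hy]
  exact ((hasDerivAt_Gx hx).sub (h1.const_mul (1 / 2))).congr_deriv (by simp)

lemma integral_G_sub {a b : ℝ} (hab : a ≤ b) (y : ℝ) :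
    ∫ z in a..b, G (z - y) =
      (Gx (b - y) - 1 / 2 * Real.sign (b - y)) - (Gx (a - y) - 1 / 2 * Real.sign (a - y)) := by
  have h : ∀ z ∈ Ioo a b \ {y}, HasDerivAt (fun z => Gx (z - y) - 1 / 2 * Real.sign (z - y))
      (G (z - y)) z := fun z hz =>
    (hasDerivAt_Gx_sub_sign (sub_ne_zero.2 hz.2)).comp_sub_const z y
  have hc : Continuous fun z => Gx (z - y) - 1 / 2 * Real.sign (z - y) :=
    continuous_Gx_sub_sign.comp (continuous_id.sub continuous_const)
  exact integral_eq_of_hasDerivAt_off_countable_of_le _ _ hab (countable_singleton y)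
    hc.continuousOn h ((continuous_G.comp (continuous_id.sub continuous_const)).intervalIntegrable _ _)

lemma integrable_Gx_mul {w : ℝ → ℝ} (hw : Integrable w) (x : ℝ) :
    Integrable fun y => Gx (x - y) * w y :=
  hw.bdd_mul (c := 1 / 2) (measurable_Gx.comp (measurable_const.sub measurable_id)).aestronglyMeasurable
    (ae_of_all _ fun y => by simpa using abs_Gx_le (x - y))

lemma integrable_G_mul {w : ℝ → ℝ} (hw : Integrable w) (x : ℝ) :
    Integrable fun y => G (x - y) * w y :=
  hw.bdd_mul (c := 1 / 2) (continuous_G.measurable.comp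
    (measurable_const.sub measurable_id)).aestronglyMeasurable
    (ae_of_all _ fun y => by simpa using abs_G_le (x - y))

lemma abs_integral_mul_le {w k : ℝ → ℝ} {c : ℝ} (hw : Integrable w) (hk : ∀ y, |k y| ≤ c) :
    |∫ y, k y * w y| ≤ c * ∫ y, |w y| := by
  rw [← integral_const_mul]
  rw [← Real.norm_eq_abs]
  refine norm_integral_le_of_norm_le (hw.abs.const_mul c) (ae_of_all _ fun y => ?_)
  rw [Real.norm_eq_abs, abs_mul]
  exact mul_le_mul_of_nonneg_right (hk y) (abs_nonneg _)

lemma abs_source_le {w : ℝ → ℝ} (hw : Integrable w) (x : ℝ) :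
    |source w x| ≤ 1 / 2 * ∫ y, |w y| :=
  abs_integral_mul_le hw fun _ => abs_Gx_le _

lemma abs_potential_le {w : ℝ → ℝ} (hw : Integrable w) (x : ℝ) :
    |potential w x| ≤ 1 / 2 * ∫ y, |w y| :=
  abs_integral_mul_le hw fun _ => abs_G_le _

lemma abs_source_sub_le {w w' : ℝ → ℝ} (hw : Integrable w) (hw' : Integrable w') (x : ℝ) :
    |source w x - source w' x| ≤ 1 / 2 * ∫ y, |w y - w' y| := by
  have : source w x - source w' x = source (fun y => w y - w' y) x := by
    simp only [source]
    rw [← integral_sub (integrable_Gx_mul hw x) (integrable_Gx_mul hw' x)]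
    simp only [mul_sub]
  rw [this]
  exact abs_source_le (hw.sub hw') x

lemma abs_potential_sub_le {w w' : ℝ → ℝ} (hw : Integrable w) (hw' : Integrable w') (x : ℝ) :
    |potential w x - potential w' x| ≤ 1 / 2 * ∫ y, |w y - w' y| := by
  have : potential w x - potential w' x = potential (fun y => w y - w' y) x := by
    simp only [potential]
    rw [← integral_sub (integrable_G_mul hw x) (integrable_G_mul hw' x)]
    simp only [mul_sub]
  rw [this]
  exact abs_potential_le (hw.sub hw') x

lemma abs_G_sub_G_le (x y : ℝ) : |G x - G y| ≤ 1 / 2 * |x - y| := by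
  have key : ∀ a b : ℝ, 0 ≤ a → a ≤ b → Real.exp (-a) - Real.exp (-b) ≤ b - a := by
    intro a b ha hab
    have h1 : Real.exp (-b) = Real.exp (-a) * Real.exp (a - b) := by
      rw [← Real.exp_add]; ring_nf
    have h2 := Real.add_one_le_exp (a - b)
    have h3 : Real.exp (-a) ≤ 1 := Real.exp_le_one_iff.2 (by linarith)
    have h4 := Real.exp_pos (-a)
    rw [h1]
    nlinarith
  have h : |Real.exp (-|x|) - Real.exp (-|y|)| ≤ abs (|x| - |y|) := by
    rcases le_total |x| |y| with h | h
    · have h1 : Real.exp (-|y|) ≤ Real.exp (-|x|) := Real.exp_le_exp.2 (by linarith)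
      rw [abs_of_nonneg (sub_nonneg.2 h1), abs_of_nonpos (sub_nonpos.2 h)]
      linarith [key _ _ (abs_nonneg x) h]
    · have h1 : Real.exp (-|x|) ≤ Real.exp (-|y|) := Real.exp_le_exp.2 (by linarith)
      rw [abs_of_nonpos (sub_nonpos.2 h1), abs_of_nonneg (sub_nonneg.2 h)]
      linarith [key _ _ (abs_nonneg y) h]
  have h2 : G x - G y = -(1 / 2) * (Real.exp (-|x|) - Real.exp (-|y|)) := by
    simp only [G]; ring
  rw [h2, abs_mul, abs_neg, abs_of_pos (by norm_num : (0 : ℝ) < 1 / 2)]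
  have := abs_abs_sub_abs_le_abs_sub x y
  linarith

lemma abs_potential_sub_le_abs_sub {w : ℝ → ℝ} (hw : Integrable w) (x y : ℝ) :
    |potential w x - potential w y| ≤ 1 / 2 * (∫ y, |w y|) * |x - y| := by
  simp only [potential]
  rw [← integral_sub (integrable_G_mul hw x) (integrable_G_mul hw y)]
  simp only [← sub_mul]
  refine (abs_integral_mul_le (c := 1 / 2 * |x - y|) hw fun z => ?_).trans (by linarith)
  simpa using abs_G_sub_G_le (x - z) (y - z)

lemma continuous_potential {w : ℝ → ℝ} (hw : Integrable w) : Continuous (potential w) := by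
  have : LipschitzWith (Real.toNNReal (1 / 2 * ∫ y, |w y|)) (potential w) :=
    LipschitzWith.of_dist_le_mul fun x y => by
      rw [Real.coe_toNNReal _ (by positivity)]
      exact abs_potential_sub_le_abs_sub hw x y
  exact this.continuous

/-- This is `G_xx = δ + G` convolved with `w` and integrated, valid for `w` merely integrable. After
exchanging the integrals, the jump of `1/2 sign(z - y)` between `z = a` and `z = b` is the indicator
of `(a, b]` in `y`, and it produces the term `w`. All spatial regularity of the source comes from
this formula. -/
lemma source_sub_of_le {w : ℝ → ℝ} (hw : Integrable w) {a b : ℝ} (hab : a ≤ b) :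
    source w b - source w a = ∫ z in a..b, (w z + potential w z) := by
  rw [intervalIntegral.integral_add hw.intervalIntegrable
    ((continuous_potential hw).intervalIntegrable _ _)]
  have hswap : ∫ z in a..b, potential w z = ∫ y, ∫ z in a..b, G (z - y) * w y := by
    simp only [potential]
    apply intervalIntegral_integral_swap
    have : IsFiniteMeasure (volume.restrict (uIoc a b)) := ⟨by simp [uIoc]⟩
    have h1 : Integrable (fun p : ℝ × ℝ => w p.2) ((volume.restrict (uIoc a b)).prod volume) :=
      Integrable.comp_snd hw _
    refine h1.bdd_mul (c := 1 / 2) ?_ (ae_of_all _ fun p => by simpa using abs_G_le (p.1 - p.2))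
    exact (continuous_G.comp (continuous_fst.sub continuous_snd)).aestronglyMeasurable
  rw [hswap]
  have h1 : ∫ z in a..b, w z = ∫ y, (Ioc a b).indicator w y := by
    rw [intervalIntegral.integral_of_le hab, integral_indicator measurableSet_Ioc]
  have hi : Integrable fun y => ∫ z in a..b, G (z - y) * w y := by
    simp only [intervalIntegral.integral_mul_const]
    refine hw.bdd_mul (c := 1 / 2 * |b - a|) ?_ (ae_of_all _ fun y => ?_)
    · refine (continuous_iff_continuousAt.2 fun y => ?_).aestronglyMeasurable
      exact (intervalIntegral.continuous_parametric_intervalIntegral_of_continuous'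
        (f := fun y z => G (z - y)) (continuous_G.comp (continuous_snd.sub continuous_fst)) a b).continuousAt
    · exact intervalIntegral.norm_integral_le_of_norm_le_const fun z _ => by
        simpa using abs_G_le (z - y)
  rw [h1, ← integral_add (hw.indicator measurableSet_Ioc) hi, source, source,
    ← integral_sub (integrable_Gx_mul hw b) (integrable_Gx_mul hw a)]
  -- The pointwise identity can fail at `y = a` and `y = b`, because `sign 0 = 0` sees only half of
  -- the jump.
  refine integral_congr_ae ?_
  filter_upwards [compl_mem_ae_iff.2 (measure_singleton a),
    compl_mem_ae_iff.2 (measure_singleton b)] with y ha hb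
  simp only [intervalIntegral.integral_mul_const, integral_G_sub hab]
  have ha' : y ≠ a := ha
  have hb' : y ≠ b := hb
  rcases lt_or_gt_of_ne ha' with h | h
  · rw [indicator_of_notMem (fun hm => (not_le.2 h) hm.1.le),
      Real.sign_of_pos (sub_pos.2 (h.trans_le hab)), Real.sign_of_pos (sub_pos.2 h)]
    ring
  · rcases lt_or_gt_of_ne hb' with h' | h'
    · rw [indicator_of_mem (show y ∈ Ioc a b from ⟨h, h'.le⟩),
        Real.sign_of_pos (sub_pos.2 h'), Real.sign_of_neg (sub_neg.2 h)]
      ring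
    · rw [indicator_of_notMem (fun hm => (not_le.2 h') hm.2),
        Real.sign_of_neg (sub_neg.2 h), Real.sign_of_neg (sub_neg.2 h')]
      ring

lemma source_sub {w : ℝ → ℝ} (hw : Integrable w) (a b : ℝ) :
    source w b - source w a = ∫ z in a..b, (w z + potential w z) := by
  rcases le_total a b with h | h
  · exact source_sub_of_le hw h
  · rw [intervalIntegral.integral_symm, ← source_sub_of_le hw h]; ring

lemma intervalIntegrable_add_potential {w : ℝ → ℝ} (hw : Integrable w) (a b : ℝ) :
    IntervalIntegrable (fun z => w z + potential w z) volume a b :=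
  hw.intervalIntegrable.add ((continuous_potential hw).intervalIntegrable _ _)

lemma continuous_source {w : ℝ → ℝ} (hw : Integrable w) : Continuous (source w) := by
  have h : source w = fun b => source w 0 + ∫ z in (0 : ℝ)..b, (w z + potential w z) := by
    funext b; rw [← source_sub hw 0 b]; ring
  rw [h]
  exact continuous_const.add (intervalIntegral.continuous_primitive
    (fun a b => intervalIntegrable_add_potential hw a b) 0)

/-- For bounded `w` the source is Lipschitz, so that the second order equation of the
characteristics is uniquely solvable although `w` may have shocks. -/
lemma abs_source_sub_le_mul_abs_sub {w : ℝ → ℝ} {M : ℝ} (hw : Integrable w)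
    (hM : ∀ᵐ x, |w x| ≤ M) (x y : ℝ) :
    |source w x - source w y| ≤ (M + 1 / 2 * ∫ y, |w y|) * |x - y| := by
  rw [source_sub hw y x, ← Real.norm_eq_abs]
  refine intervalIntegral.norm_integral_le_of_norm_le_const_ae ?_
  filter_upwards [hM] with z hz _
  exact (norm_add_le _ _).trans (add_le_add hz (abs_potential_le hw z))

/-! ### Continuity in time: from almost every time slice to every time slice. -/

lemma exists_subseq_ae_tendsto {f : ℕ → ℝ → ℝ} {g : ℝ → ℝ} (hf : ∀ n, Integrable (f n))
    (hg : Integrable g) (h : Tendsto (fun n => ∫ x, |f n x - g x|) atTop (𝓝 0)) :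
    ∃ ns : ℕ → ℕ, StrictMono ns ∧ ∀ᵐ x, Tendsto (fun i => f (ns i) x) atTop (𝓝 (g x)) := by
  refine TendstoInMeasure.exists_seq_tendsto_ae (tendstoInMeasure_of_tendsto_eLpNorm (p := 1)
    one_ne_zero (fun n => (hf n).aestronglyMeasurable) hg.aestronglyMeasurable ?_)
  have h1 : ∀ n, eLpNorm (f n - g) 1 volume = ENNReal.ofReal (∫ x, |f n x - g x|) := fun n => by
    rw [eLpNorm_one_eq_lintegral_enorm]
    exact (ofReal_integral_norm_eq_lintegral_enorm ((hf n).sub hg)).symm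
  simp only [h1]
  simpa using ENNReal.tendsto_ofReal h

lemma exists_seq_gt_tendsto_of_ae {R : ℝ → Prop} (hR : ∀ᵐ s, R s) (t : ℝ) :
    ∃ τ : ℕ → ℝ, (∀ n, t < τ n ∧ R (τ n)) ∧ Tendsto τ atTop (𝓝 t) := by
  have hd : Dense {s | R s} := Measure.dense_of_ae hR
  have h : ∀ n : ℕ, ∃ s, R s ∧ t < s ∧ s < t + 1 / ((n : ℝ) + 1) := fun n => by
    obtain ⟨s, hs, hs'⟩ := hd.exists_between (show t < t + 1 / ((n : ℝ) + 1) from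
      lt_add_of_pos_right _ Nat.one_div_pos_of_nat)
    exact ⟨s, hs, hs'⟩
  choose τ hτ using h
  refine ⟨τ, fun n => ⟨(hτ n).2.1, (hτ n).1⟩, ?_⟩
  refine tendsto_of_tendsto_of_tendsto_of_le_of_le tendsto_const_nhds ?_
    (fun n => (hτ n).2.1.le) (fun n => (hτ n).2.2.le)
  simpa using tendsto_const_nhds.add (tendsto_one_div_add_atTop_nhds_zero_nat (𝕜 := ℝ))

lemma ae_ae_of_ae_restrict {O : Set (ℝ × ℝ)} (hO : MeasurableSet O) {Q : ℝ × ℝ → Prop}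
    (h : ∀ᵐ p ∂(volume.restrict O), Q p) : ∀ᵐ t : ℝ, ∀ᵐ x : ℝ, (t, x) ∈ O → Q (t, x) := by
  rw [ae_restrict_iff' hO, Measure.volume_eq_prod] at h
  exact Measure.ae_ae_of_ae_prod h

namespace IsWeakEntropySolution
variable {ubar : ℝ → ℝ} {u : ℝ → ℝ → ℝ}

lemma abs_norm_sub_le (hu : IsWeakEntropySolution ubar u) {s t : ℝ} (hs : 0 ≤ s) (ht : 0 ≤ t) :
    abs ((∫ y, |u s y|) - ∫ y, |u t y|) ≤ ∫ y, |u s y - u t y| := by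
  rw [← integral_sub (hu.integrable s hs).abs (hu.integrable t ht).abs, ← Real.norm_eq_abs]
  refine norm_integral_le_of_norm_le ((hu.integrable s hs).sub (hu.integrable t ht)).abs
    (ae_of_all _ fun y => ?_)
  exact abs_abs_sub_abs_le_abs_sub _ _

lemma continuousOn_norm (hu : IsWeakEntropySolution ubar u) :
    ContinuousOn (fun t => ∫ y, |u t y|) (Ici 0) := by
  intro t ht
  rw [ContinuousWithinAt, tendsto_iff_dist_tendsto_zero]
  refine squeeze_zero' (Eventually.of_forall fun _ => dist_nonneg) ?_ (hu.continuous t ht)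
  filter_upwards [self_mem_nhdsWithin] with s hs
  exact hu.abs_norm_sub_le hs ht

lemma tendsto_integral_fst (hu : IsWeakEntropySolution ubar u) {p : ℝ × ℝ} (hp : 0 ≤ p.1) :
    Tendsto (fun q : ℝ × ℝ => ∫ y, |u q.1 y - u p.1 y|) (𝓝[Ici 0 ×ˢ univ] p) (𝓝 0) := by
  refine (hu.continuous p.1 hp).comp (tendsto_nhdsWithin_iff.2 ⟨?_, ?_⟩)
  · exact (continuous_fst.tendsto p).mono_left nhdsWithin_le_nhds
  · filter_upwards [self_mem_nhdsWithin] with q hq using hq.1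

lemma continuousOn_source (hu : IsWeakEntropySolution ubar u) :
    ContinuousOn (fun p : ℝ × ℝ => source (u p.1) p.2) (Ici 0 ×ˢ univ) := by
  intro p hp
  rw [ContinuousWithinAt, tendsto_iff_dist_tendsto_zero]
  have h1 := hu.tendsto_integral_fst (p := p) hp.1
  have h2 : Tendsto (fun q : ℝ × ℝ => dist (source (u p.1) q.2) (source (u p.1) p.2))
      (𝓝[Ici 0 ×ˢ univ] p) (𝓝 0) := by
    rw [← tendsto_iff_dist_tendsto_zero]
    exact (((continuous_source (hu.integrable p.1 hp.1)).comp continuous_snd).tendsto p).mono_left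
      nhdsWithin_le_nhds
  refine squeeze_zero' (Eventually.of_forall fun _ => dist_nonneg) ?_
    (by simpa using (h1.const_mul (1 / 2)).add h2)
  filter_upwards [self_mem_nhdsWithin] with q hq
  refine (dist_triangle _ (source (u p.1) q.2) _).trans (add_le_add ?_ le_rfl)
  simpa [Real.dist_eq] using abs_source_sub_le (hu.integrable q.1 hq.1) (hu.integrable p.1 hp.1) q.2

lemma continuousOn_potential (hu : IsWeakEntropySolution ubar u) :
    ContinuousOn (fun p : ℝ × ℝ => potential (u p.1) p.2) (Ici 0 ×ˢ univ) := by
  intro p hp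
  rw [ContinuousWithinAt, tendsto_iff_dist_tendsto_zero]
  have h1 := hu.tendsto_integral_fst (p := p) hp.1
  have h2 : Tendsto (fun q : ℝ × ℝ => dist (potential (u p.1) q.2) (potential (u p.1) p.2))
      (𝓝[Ici 0 ×ˢ univ] p) (𝓝 0) := by
    rw [← tendsto_iff_dist_tendsto_zero]
    exact (((continuous_potential (hu.integrable p.1 hp.1)).comp
      continuous_snd).tendsto p).mono_left nhdsWithin_le_nhds
  refine squeeze_zero' (Eventually.of_forall fun _ => dist_nonneg) ?_
    (by simpa using (h1.const_mul (1 / 2)).add h2)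
  filter_upwards [self_mem_nhdsWithin] with q hq
  refine (dist_triangle _ (potential (u p.1) q.2) _).trans (add_le_add ?_ le_rfl)
  simpa [Real.dist_eq] using
    abs_potential_sub_le (hu.integrable q.1 hq.1) (hu.integrable p.1 hp.1) q.2

/-- Continuity in `L¹` carries properties of almost every slice to every slice. The approximating
times lie to the right of `t`, so that `t = 0` is admitted. -/
lemma exists_seq_ae_tendsto (hu : IsWeakEntropySolution ubar u) {R : ℝ → Prop}
    (hR : ∀ᵐ s, R s) {t : ℝ} (ht : 0 ≤ t) :
    ∃ τ : ℕ → ℝ, (∀ n, t < τ n ∧ R (τ n)) ∧ Tendsto τ atTop (𝓝 t) ∧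
      ∀ᵐ x, Tendsto (fun n => u (τ n) x) atTop (𝓝 (u t x)) := by
  obtain ⟨τ, hτ, hτt⟩ := exists_seq_gt_tendsto_of_ae hR t
  have hτ0 : ∀ n, 0 ≤ τ n := fun n => ht.trans (hτ n).1.le
  obtain ⟨ns, hns, h⟩ := exists_subseq_ae_tendsto (fun n => hu.integrable (τ n) (hτ0 n))
    (hu.integrable t ht) ((hu.continuous t ht).comp
      (tendsto_nhdsWithin_iff.2 ⟨hτt, Eventually.of_forall hτ0⟩))
  exact ⟨τ ∘ ns, fun n => hτ _, hτt.comp hns.tendsto_atTop, h⟩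

/-- A continuous representative of the solution on a relatively open set represents every time
slice. -/
lemma ae_slice_eq (hu : IsWeakEntropySolution ubar u) {O : Set (ℝ × ℝ)} (hO : IsOpen O)
    {g : ℝ × ℝ → ℝ} (hg : ContinuousOn g (O ∩ {p | 0 ≤ p.1}))
    (h : ∀ᵐ p : ℝ × ℝ ∂(volume.restrict (O ∩ {p | 0 ≤ p.1})), u p.1 p.2 = g p)
    {t : ℝ} (ht : 0 ≤ t) : ∀ᵐ x, (t, x) ∈ O → u t x = g (t, x) := by
  have hm : MeasurableSet (O ∩ {p : ℝ × ℝ | 0 ≤ p.1}) :=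
    hO.measurableSet.inter (measurableSet_le measurable_const measurable_fst)
  obtain ⟨τ, hτ, hτt, hlim⟩ := hu.exists_seq_ae_tendsto (ae_ae_of_ae_restrict hm h) ht
  filter_upwards [hlim, ae_all_iff.2 fun n => (hτ n).2] with x hx hx' hxO
  refine tendsto_nhds_unique hx ?_
  have h1 : Tendsto (fun n => (τ n, x)) atTop (𝓝 (t, x)) :=
    hτt.prodMk_nhds tendsto_const_nhds
  have h2 : ∀ᶠ n in atTop, (τ n, x) ∈ O ∩ {p : ℝ × ℝ | 0 ≤ p.1} := by
    filter_upwards [h1.eventually (hO.mem_nhds hxO)] with n hn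
    exact ⟨hn, ht.trans (hτ n).1.le⟩
  refine ((hg (t, x) ⟨hxO, ht⟩).tendsto.comp (tendsto_nhdsWithin_iff.2 ⟨h1, h2⟩)).congr' ?_
  filter_upwards [h2] with n hn
  exact (hx' n hn).symm

lemma exists_bounds (hu : IsWeakEntropySolution ubar u) {a b : ℝ} (ha : 0 < a) (hab : a < b) :
    ∃ M : ℝ, 0 < M ∧ ∀ t ∈ Icc a b, (∀ᵐ x, |u t x| ≤ M) ∧ (∀ x, |source (u t) x| ≤ M) ∧
      ∫ x, |u t x| ≤ M ∧ ∀ x y, |source (u t) x - source (u t) y| ≤ M * |x - y| := by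
  -- The bound is taken beyond `b` because the slice at `b` is approached from later times.
  obtain ⟨M, hM⟩ := hu.locallyBounded a (b + 1) ha (by linarith)
  obtain ⟨N, hN⟩ := (isCompact_Icc (a := a) (b := b)).exists_bound_of_continuousOn
    (hu.continuousOn_norm.mono fun t ht => ha.le.trans ht.1)
  have hN' : ∀ t ∈ Icc a b, ∫ x, |u t x| ≤ N := fun t ht => (le_abs_self _).trans (hN t ht)
  have hN0 : 0 ≤ N := (integral_nonneg fun _ => abs_nonneg _).trans (hN' a ⟨le_rfl, hab.le⟩)
  have hMt : ∀ t ∈ Icc a b, ∀ᵐ x, |u t x| ≤ M := fun t ht => by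
    obtain ⟨τ, hτ, hτt, hlim⟩ := hu.exists_seq_ae_tendsto
      (ae_ae_of_ae_restrict (measurableSet_Icc.prod MeasurableSet.univ) hM) (ha.le.trans ht.1)
    filter_upwards [hlim, ae_all_iff.2 fun n => (hτ n).2] with x hx hx'
    refine le_of_tendsto hx.abs ?_
    filter_upwards [hτt.eventually (gt_mem_nhds (show t < b + 1 by linarith [ht.2]))] with n hn
    exact hx' n ⟨⟨ht.1.trans (hτ n).1.le, hn.le⟩, mem_univ _⟩
  have hM0 : 0 ≤ M := by
    obtain ⟨x, hx⟩ := (hMt a ⟨le_rfl, hab.le⟩).exists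
    exact (abs_nonneg _).trans hx
  refine ⟨M + N + 1, by linarith, fun t ht => ⟨?_, fun x => ?_, ?_, fun x y => ?_⟩⟩
  · filter_upwards [hMt t ht] with x hx
    linarith
  · have := abs_source_le (hu.integrable t (ha.le.trans ht.1)) x
    linarith [hN' t ht]
  · linarith [hN' t ht]
  · refine (abs_source_sub_le_mul_abs_sub (hu.integrable t (ha.le.trans ht.1))
      (hMt t ht) x y).trans ?_
    refine mul_le_mul_of_nonneg_right ?_ (abs_nonneg _)
    linarith [hN' t ht]

lemma aestronglyMeasurable (hu : IsWeakEntropySolution ubar u) {S : Set (ℝ × ℝ)}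
    (hS : S ⊆ Ici 0 ×ˢ univ) :
    AEStronglyMeasurable (fun p : ℝ × ℝ => u p.1 p.2) (volume.restrict S) :=
  hu.locallyIntegrable.aestronglyMeasurable.mono_measure (Measure.restrict_mono hS le_rfl)

end IsWeakEntropySolution

/-! ### One-dimensional monotonicity from a weak inequality -/

lemma le_of_integral_mul_deriv_nonneg {F : ℝ → ℝ} {t₀ t₁ : ℝ} (hF : ContinuousOn F (Ioo t₀ t₁))
    (h : ∀ θ : ℝ → ℝ, ContDiff ℝ 1 θ → HasCompactSupport θ → tsupport θ ⊆ Ioo t₀ t₁ →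
      (∀ t, 0 ≤ θ t) → 0 ≤ ∫ t, F t * deriv θ t) {a b : ℝ} (ha : t₀ < a) (hab : a < b)
    (hb : b < t₁) : F b ≤ F a := by
  by_contra! hlt
  obtain ⟨m₁, hm₁, hm₁'⟩ := exists_between hlt
  obtain ⟨m₂, hm₂, hm₂'⟩ := exists_between hm₁'
  have hFa : ∀ᶠ t in 𝓝 a, F t < m₁ :=
    (hF.continuousAt (Ioo_mem_nhds ha (hab.trans hb))).eventually (gt_mem_nhds hm₁)
  have hFb : ∀ᶠ t in 𝓝 b, m₂ < F t :=
    (hF.continuousAt (Ioo_mem_nhds (ha.trans hab) hb)).eventually (lt_mem_nhds hm₂')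
  obtain ⟨δ₁, hδ₁, h₁⟩ := Metric.eventually_nhds_iff.1 hFa
  obtain ⟨δ₂, hδ₂, h₂⟩ := Metric.eventually_nhds_iff.1 hFb
  obtain ⟨δ, hδ, hδlt⟩ := exists_between
    (show (0 : ℝ) < min (min δ₁ δ₂) (min (a - t₀) (t₁ - b)) by
      simp only [lt_min_iff]; exact ⟨⟨hδ₁, hδ₂⟩, sub_pos.2 ha, sub_pos.2 hb⟩)
  simp only [lt_min_iff] at hδlt
  obtain ⟨⟨hδ1, hδ2⟩, hδa, hδb⟩ := hδlt
  let ρ : ContDiffBump (0 : ℝ) := ⟨δ / 2, δ, by positivity, by linarith⟩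
  have hρc : Continuous ρ := ρ.continuous
  have hρ0 : ∀ t, 0 ≤ ρ t := fun t => ρ.nonneg
  have hρz : ∀ t, δ ≤ |t| → ρ t = 0 := fun t ht => by
    have : t ∉ Function.support ρ := by
      rw [ρ.support_eq, Metric.mem_ball, dist_zero_right, Real.norm_eq_abs]
      exact not_lt.2 ht
    simpa using this
  let Φ : ℝ → ℝ := fun t => ∫ s in (-δ)..t, ρ s
  have hΦd : ∀ t, HasDerivAt Φ (ρ t) t := fun t =>
    intervalIntegral.integral_hasDerivAt_right (hρc.intervalIntegrable _ _)
      (hρc.stronglyMeasurableAtFilter _ _) hρc.continuousAt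
  have hΦm : Monotone Φ := monotone_of_deriv_nonneg (fun t => (hΦd t).differentiableAt)
    fun t => by rw [(hΦd t).deriv]; exact hρ0 t
  have hΦlo : ∀ t ≤ -δ, Φ t = 0 := fun t ht => by
    have : ∀ s ∈ uIcc (-δ) t, ρ s = 0 := fun s hs => by
      rw [uIcc_of_ge ht] at hs
      exact hρz s (le_abs.2 (Or.inr (by linarith [hs.2])))
    simp only [Φ]
    rw [intervalIntegral.integral_congr this]; simp
  have hΦhi : ∀ t, δ ≤ t → Φ t = Φ δ := fun t ht => by
    have : ∀ s ∈ uIcc δ t, ρ s = 0 := fun s hs => by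
      rw [uIcc_of_le ht] at hs
      exact hρz s (le_abs.2 (Or.inl hs.1))
    have h2 : Φ δ + ∫ s in δ..t, ρ s = Φ t :=
      intervalIntegral.integral_add_adjacent_intervals (hρc.intervalIntegrable _ _)
        (hρc.intervalIntegrable _ _)
    rw [← h2, intervalIntegral.integral_congr this]; simp
  have hΦeq : ∫ s, ρ s = Φ δ := by
    simp only [Φ]
    rw [intervalIntegral.integral_of_le (by linarith), setIntegral_eq_integral_of_forall_compl_eq_zero]
    intro s hs
    rcases eq_or_ne s (-δ) with rfl | hne
    · exact hρz _ (by rw [abs_neg]; exact le_abs_self _)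
    · refine hρz s ?_
      by_contra! hlt
      rw [abs_lt] at hlt
      exact hs ⟨hlt.1, hlt.2.le⟩
  have hc : 0 < Φ δ := by rw [← hΦeq]; exact ρ.integral_pos
  -- A smoothed indicator of `[a, b]`. Its derivative is a bump near `a`, where `F < m₁`, minus a
  -- bump of the same mass near `b`, where `F > m₂ > m₁`; so `∫ F θ' ≤ (m₁ - m₂) Φ(δ) < 0`.
  let θ : ℝ → ℝ := fun t => Φ (t - a) - Φ (t - b)
  have hθd : ∀ t, HasDerivAt θ (ρ (t - a) - ρ (t - b)) t := fun t =>
    ((hΦd _).comp_sub_const t a).sub ((hΦd _).comp_sub_const t b)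
  have hθd' : deriv θ = fun t => ρ (t - a) - ρ (t - b) := funext fun t => (hθd t).deriv
  have hθz : ∀ t, t ∉ Icc (a - δ) (b + δ) → θ t = 0 := fun t ht => by
    simp only [θ]
    rcases lt_or_ge t (a - δ) with h1 | h1
    · rw [hΦlo _ (by linarith), hΦlo _ (by linarith), sub_zero]
    · have h2 : b + δ < t := by
        by_contra! h2
        exact ht ⟨h1, h2⟩
      rw [hΦhi _ (by linarith), hΦhi (t - b) (by linarith), sub_self]
  have hts : tsupport θ ⊆ Icc (a - δ) (b + δ) :=
    closure_minimal (fun t ht => by by_contra hn; exact ht (hθz t hn)) isClosed_Icc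
  have hsub : Icc (a - δ) (b + δ) ⊆ Ioo t₀ t₁ := fun t ht =>
    ⟨by linarith [ht.1], by linarith [ht.2]⟩
  have hθ := h θ
    (contDiff_one_iff_deriv.2 ⟨fun t => (hθd t).differentiableAt, by rw [hθd']; fun_prop⟩)
    (HasCompactSupport.of_support_subset_isCompact isCompact_Icc (subset_closure.trans hts))
    (hts.trans hsub) (fun t => sub_nonneg.2 (hΦm (by linarith)))
  rw [hθd'] at hθ
  have hint : Integrable fun t => F t * (ρ (t - a) - ρ (t - b)) := by
    refine (integrableOn_iff_integrable_of_support_subset (s := Icc (a - δ) (b + δ)) ?_).1 ?_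
    · intro t ht
      by_contra hn
      refine ht ?_
      have h1 : ρ (t - a) - ρ (t - b) = 0 := by
        rcases lt_or_ge t (a - δ) with h1 | h1
        · rw [hρz _ (le_abs.2 (Or.inr (by linarith))), hρz _ (le_abs.2 (Or.inr (by linarith))),
            sub_zero]
        · have h2 : b + δ < t := by
            by_contra! h2
            exact hn ⟨h1, h2⟩
          rw [hρz _ (le_abs.2 (Or.inl (by linarith))), hρz _ (le_abs.2 (Or.inl (by linarith))),
            sub_zero]
      simp only [h1, mul_zero]
    · exact ((hF.mono hsub).mul (Continuous.continuousOn (by fun_prop))).integrableOn_compact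
        isCompact_Icc
  have hρi : Integrable ρ := ρ.integrable
  have hle : ∫ t, F t * (ρ (t - a) - ρ (t - b)) ≤ ∫ t, (m₁ * ρ (t - a) - m₂ * ρ (t - b)) := by
    refine integral_mono hint (((hρi.comp_sub_right a).const_mul m₁).sub
      ((hρi.comp_sub_right b).const_mul m₂)) fun t => ?_
    have e1 : F t * ρ (t - a) ≤ m₁ * ρ (t - a) := by
      rcases lt_or_ge |t - a| δ with hlt | hge
      · exact mul_le_mul_of_nonneg_right (h₁ (by rw [Real.dist_eq]; linarith)).le (hρ0 _)
      · simp [hρz _ hge]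
    have e2 : m₂ * ρ (t - b) ≤ F t * ρ (t - b) := by
      rcases lt_or_ge |t - b| δ with hlt | hge
      · exact mul_le_mul_of_nonneg_right (h₂ (by rw [Real.dist_eq]; linarith)).le (hρ0 _)
      · simp [hρz _ hge]
    simp only [mul_sub]
    linarith
  rw [integral_sub ((hρi.comp_sub_right a).const_mul m₁) ((hρi.comp_sub_right b).const_mul m₂),
    integral_const_mul, integral_const_mul, integral_sub_right_eq_self (fun t => ρ t),
    integral_sub_right_eq_self (fun t => ρ t), hΦeq] at hle
  nlinarith

/-- The test functions vanish near `t₀`; continuity of `F` is what brings in the initial time. -/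
lemma antitoneOn_of_integral_mul_deriv_nonneg {F : ℝ → ℝ} {t₀ t₁ : ℝ}
    (hF : ContinuousOn F (Ico t₀ t₁))
    (h : ∀ θ : ℝ → ℝ, ContDiff ℝ 1 θ → HasCompactSupport θ → tsupport θ ⊆ Ioo t₀ t₁ →
      (∀ t, 0 ≤ θ t) → 0 ≤ ∫ t, F t * deriv θ t) : AntitoneOn F (Ico t₀ t₁) := by
  intro a ha b hb hab
  rcases hab.eq_or_lt with rfl | hab
  · exact le_rfl
  have key : ∀ s ∈ Ioo a b, F b ≤ F s := fun s hs =>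
    le_of_integral_mul_deriv_nonneg (hF.mono Ioo_subset_Ico_self) h (ha.1.trans_lt hs.1) hs.2 hb.2
  have h1 : Tendsto F (𝓝[>] a) (𝓝 (F a)) :=
    (hF a ha).mono_left (nhdsWithin_le_of_mem (mem_of_superset (Ioo_mem_nhdsGT hab)
      fun s hs => ⟨ha.1.trans hs.1.le, hs.2.trans hb.2⟩))
  exact ge_of_tendsto h1 (mem_of_superset (Ioo_mem_nhdsGT hab) key)

/-! ### Derivatives along the coordinate directions -/

lemma fderiv_one_zero {φ : ℝ × ℝ → ℝ} {p : ℝ × ℝ} (h : DifferentiableAt ℝ φ p) {d : ℝ}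
    (hd : HasDerivAt (fun t => φ (t, p.2)) d p.1) : fderiv ℝ φ p (1, 0) = d := by
  have h1 : HasDerivAt (fun t : ℝ => (t, p.2)) (1, 0) p.1 :=
    (hasDerivAt_id p.1).prodMk (hasDerivAt_const _ _)
  exact (h.hasFDerivAt.comp_hasDerivAt p.1 h1).unique hd

lemma fderiv_zero_one {φ : ℝ × ℝ → ℝ} {p : ℝ × ℝ} (h : DifferentiableAt ℝ φ p) {d : ℝ}
    (hd : HasDerivAt (fun x => φ (p.1, x)) d p.2) : fderiv ℝ φ p (0, 1) = d := by
  have h1 : HasDerivAt (fun x : ℝ => (p.1, x)) (0, 1) p.2 :=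
    (hasDerivAt_const _ _).prodMk (hasDerivAt_id p.2)
  exact (h.hasFDerivAt.comp_hasDerivAt p.2 h1).unique hd

lemma fderiv_fst_mul_snd_one_zero {a b : ℝ → ℝ} (ha : ContDiff ℝ 1 a) (hb : ContDiff ℝ 1 b)
    (p : ℝ × ℝ) : fderiv ℝ (fun p : ℝ × ℝ => a p.1 * b p.2) p (1, 0) = deriv a p.1 * b p.2 := by
  have ha' := ha.differentiable one_ne_zero
  have hb' := hb.differentiable one_ne_zero
  exact fderiv_one_zero (φ := fun p : ℝ × ℝ => a p.1 * b p.2) (by fun_prop)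
    ((ha' p.1).hasDerivAt.mul_const (b p.2))

lemma fderiv_fst_mul_snd_zero_one {a b : ℝ → ℝ} (ha : ContDiff ℝ 1 a) (hb : ContDiff ℝ 1 b)
    (p : ℝ × ℝ) : fderiv ℝ (fun p : ℝ × ℝ => a p.1 * b p.2) p (0, 1) = a p.1 * deriv b p.2 := by
  have ha' := ha.differentiable one_ne_zero
  have hb' := hb.differentiable one_ne_zero
  exact fderiv_zero_one (φ := fun p : ℝ × ℝ => a p.1 * b p.2) (by fun_prop)
    ((hb' p.2).hasDerivAt.const_mul (a p.1))

lemma tsupport_fst_mul_snd_subset (a b : ℝ → ℝ) :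
    tsupport (fun p : ℝ × ℝ => a p.1 * b p.2) ⊆ tsupport a ×ˢ tsupport b :=
  closure_minimal (fun _ hp => ⟨subset_closure (left_ne_zero_of_mul hp),
    subset_closure (right_ne_zero_of_mul hp)⟩) ((isClosed_tsupport a).prod (isClosed_tsupport b))

/-! ### Growth of the `L¹` norm -/

lemma integrable_exp_neg_abs : Integrable fun x : ℝ => Real.exp (-|x|) := by
  refine Integrable.of_integral_ne_zero ?_
  rw [integral_comp_abs (f := fun x => Real.exp (-x)), integral_exp_neg_Ioi_zero]
  norm_num

lemma integrable_Gx : Integrable Gx :=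
  (integrable_exp_neg_abs.const_mul (1 / 2)).mono' measurable_Gx.aestronglyMeasurable
    (ae_of_all _ abs_Gx_le_exp)

lemma integral_abs_Gx_le : ∫ x, |Gx x| ≤ 1 := by
  refine (integral_mono integrable_Gx.abs (integrable_exp_neg_abs.const_mul (1 / 2))
    abs_Gx_le_exp).trans ?_
  rw [integral_const_mul, integral_comp_abs (f := fun x => Real.exp (-x)),
    integral_exp_neg_Ioi_zero]
  norm_num

lemma integrable_source_integrand {w : ℝ → ℝ} (hw : Integrable w) :
    Integrable (fun p : ℝ × ℝ => Gx (p.1 - p.2) * w p.2) := by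
  have := hw.convolution_integrand (ContinuousLinearMap.mul ℝ ℝ) integrable_Gx
  simp only [ContinuousLinearMap.mul_apply'] at this
  exact this.congr (ae_of_all _ fun p => mul_comm _ _)

lemma integrable_source {w : ℝ → ℝ} (hw : Integrable w) : Integrable (source w) :=
  (integrable_source_integrand hw).integral_prod_left

lemma integral_abs_source_le {w : ℝ → ℝ} (hw : Integrable w) :
    ∫ x, |source w x| ≤ ∫ y, |w y| := by
  have h := (integrable_source_integrand hw).abs
  have h1 : ∫ x, |source w x| ≤ ∫ x, ∫ y, |Gx (x - y) * w y| :=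
    integral_mono (integrable_source hw).abs h.integral_prod_left
      fun x => abs_integral_le_integral_abs
  refine h1.trans ?_
  rw [integral_integral_swap h]
  have h2 : ∀ y, ∫ x, |Gx (x - y) * w y| = (∫ x, |Gx x|) * |w y| := fun y => by
    simp only [abs_mul]
    rw [integral_mul_const, integral_sub_right_eq_self (fun x => |Gx x|)]
  simp only [h2]
  rw [integral_const_mul]
  exact mul_le_of_le_one_left (integral_nonneg fun _ => abs_nonneg _) integral_abs_Gx_le

namespace IsWeakEntropySolution
variable {ubar : ℝ → ℝ} {u : ℝ → ℝ → ℝ}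

lemma integrableOn_slab (hu : IsWeakEntropySolution ubar u) {a b : ℝ} (ha : 0 ≤ a) :
    IntegrableOn (fun p : ℝ × ℝ => u p.1 p.2) (Icc a b ×ˢ univ) := by
  have hm := hu.aestronglyMeasurable (S := Icc a b ×ˢ univ)
    (prod_mono (fun t ht => ha.trans ht.1) le_rfl)
  rw [IntegrableOn]
  rw [Measure.volume_eq_prod, ← Measure.prod_restrict, Measure.restrict_univ] at hm ⊢
  rw [integrable_prod_iff hm]
  refine ⟨?_, ?_⟩
  · filter_upwards [ae_restrict_mem measurableSet_Icc] with t ht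
    exact hu.integrable t (ha.trans ht.1)
  · exact (hu.continuousOn_norm.mono fun t ht => ha.trans ht.1).integrableOn_compact isCompact_Icc

lemma integrableOn_source_slab (hu : IsWeakEntropySolution ubar u) {a b : ℝ} (ha : 0 ≤ a) :
    IntegrableOn (fun p : ℝ × ℝ => source (u p.1) p.2) (Icc a b ×ˢ univ) := by
  have hm : AEStronglyMeasurable (fun p : ℝ × ℝ => source (u p.1) p.2)
      (volume.restrict (Icc a b ×ˢ univ)) :=
    (hu.continuousOn_source.mono (prod_mono (fun t ht => ha.trans ht.1)
      le_rfl)).aestronglyMeasurable (measurableSet_Icc.prod MeasurableSet.univ)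
  rw [IntegrableOn]
  rw [Measure.volume_eq_prod, ← Measure.prod_restrict, Measure.restrict_univ] at hm ⊢
  rw [integrable_prod_iff hm]
  refine ⟨?_, ?_⟩
  · filter_upwards [ae_restrict_mem measurableSet_Icc] with t ht
    exact integrable_source (hu.integrable t (ha.trans ht.1))
  · have h1 : IntegrableOn (fun t => ∫ y, |u t y|) (Icc a b) :=
      (hu.continuousOn_norm.mono fun t ht => ha.trans ht.1).integrableOn_compact isCompact_Icc
    refine Integrable.mono' h1 hm.norm.integral_prod_right' ?_
    filter_upwards [ae_restrict_mem measurableSet_Icc] with t ht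
    rw [Real.norm_of_nonneg (integral_nonneg fun _ => norm_nonneg _)]
    exact integral_abs_source_le (hu.integrable t (ha.trans ht.1))

end IsWeakEntropySolution

lemma exists_Icc_of_isCompact_subset_Ioo {K : Set ℝ} (hK : IsCompact K) {t₀ t₁ : ℝ}
    (h01 : t₀ < t₁) (h : K ⊆ Ioo t₀ t₁) :
    ∃ a b, t₀ < a ∧ a < b ∧ b < t₁ ∧ K ⊆ Icc a b := by
  rcases K.eq_empty_or_nonempty with rfl | hne
  · obtain ⟨a, ha, ha'⟩ := exists_between h01
    obtain ⟨b, hb, hb'⟩ := exists_between ha'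
    exact ⟨a, b, ha, hb, hb', empty_subset _⟩
  · obtain ⟨m, hmK, hm⟩ := hK.exists_isLeast hne
    obtain ⟨m', hmK', hm'⟩ := hK.exists_isGreatest hne
    obtain ⟨a, ha, ha'⟩ := exists_between (h hmK).1
    obtain ⟨b, hb, hb'⟩ := exists_between (h hmK').2
    exact ⟨a, b, ha, ha'.trans_le ((hm hmK').trans hb.le), hb',
      fun x hx => ⟨ha'.le.trans (hm hx), (hm' hx).trans hb.le⟩⟩

namespace IsWeakEntropySolution
variable {ubar : ℝ → ℝ} {u : ℝ → ℝ → ℝ}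

/-- Kruzhkov's inequality with `k = 0` is tested with `e^{-t} θ(t) β(x/(n+1))`, and `n → ∞`. The
flux term carries the factor `1/(n+1)` and disappears, since `u² ≤ M |u|` is integrable on the slab.
The source costs at most one `L¹` norm of `u`, which is exactly what the derivative of `e^{-t}`
gains. -/
lemma integral_exp_mul_norm_mul_deriv_nonneg (hu : IsWeakEntropySolution ubar u) {T : ℝ}
    (hT : 0 < T) {θ : ℝ → ℝ} (hθ : ContDiff ℝ 1 θ) (hθc : HasCompactSupport θ)
    (hθs : tsupport θ ⊆ Ioo 0 T) (hθ0 : ∀ t, 0 ≤ θ t) :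
    0 ≤ ∫ t, (Real.exp (-t) * ∫ y, |u t y|) * deriv θ t := by
  obtain ⟨a, b, ha, hab, hb, hK⟩ := exists_Icc_of_isCompact_subset_Ioo hθc hT hθs
  obtain ⟨M, hM, hbd⟩ := hu.exists_bounds ha hab
  have hθd := hθ.differentiable one_ne_zero
  have hθ'c : Continuous (deriv θ) := hθ.continuous_deriv le_rfl
  have hθz : ∀ t, t ∉ Icc a b → θ t = 0 := fun t ht => image_eq_zero_of_notMem_tsupport
    fun h => ht (hK h)
  have hθz' : ∀ t, t ∉ Icc a b → deriv θ t = 0 := fun t ht => by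
    by_contra hn
    exact ht (hK (support_deriv_subset hn))
  let α : ℝ → ℝ := fun t => Real.exp (-t) * θ t
  have hα : ContDiff ℝ 1 α := by fun_prop
  have hαd : ∀ t, HasDerivAt α (Real.exp (-t) * (deriv θ t - θ t)) t := fun t => by
    refine ((hasDerivAt_neg t).exp.mul (hθd t).hasDerivAt).congr_deriv ?_
    ring
  have hα' : deriv α = fun t => Real.exp (-t) * (deriv θ t - θ t) :=
    funext fun t => (hαd t).deriv
  have hαc : Continuous α := hα.continuous
  have hα'c : Continuous (deriv α) := hα.continuous_deriv le_rfl
  have hα0 : ∀ t, 0 ≤ α t := fun t => mul_nonneg (Real.exp_pos _).le (hθ0 t)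
  have hαz : ∀ t, t ∉ Icc a b → α t = 0 := fun t ht => by simp [α, hθz t ht]
  have hαz' : ∀ t, t ∉ Icc a b → deriv α t = 0 := fun t ht => by
    rw [hα']; simp [hθz t ht, hθz' t ht]
  have hαts : tsupport α ⊆ Icc a b :=
    closure_minimal (fun t ht => by by_contra hn; exact ht (hαz t hn)) isClosed_Icc
  obtain ⟨A₀, hA₀⟩ := (isCompact_Icc (a := a) (b := b)).exists_bound_of_continuousOn
    hαc.continuousOn
  obtain ⟨A₁, hA₁⟩ := (isCompact_Icc (a := a) (b := b)).exists_bound_of_continuousOn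
    hα'c.continuousOn
  have hA₀0 : 0 ≤ A₀ := (norm_nonneg _).trans (hA₀ a ⟨le_rfl, hab.le⟩)
  have hA₁0 : 0 ≤ A₁ := (norm_nonneg _).trans (hA₁ a ⟨le_rfl, hab.le⟩)
  let β : ContDiffBump (0 : ℝ) := ⟨1, 2, one_pos, one_lt_two⟩
  have hβ : ContDiff ℝ 1 β := β.contDiff
  have hβ'c : Continuous (deriv β) := hβ.continuous_deriv le_rfl
  have hβd := hβ.differentiable one_ne_zero
  obtain ⟨B, hB⟩ := β.hasCompactSupport.deriv.exists_bound_of_continuous hβ'c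
  have hB0 : 0 ≤ B := (norm_nonneg _).trans (hB 0)
  let c : ℕ → ℝ := fun n => 1 / ((n : ℝ) + 1)
  have hc0 : ∀ n, 0 < c n := fun n => Nat.one_div_pos_of_nat
  have hc1 : ∀ n, c n ≤ 1 := fun n => by
    simp only [c]
    rw [div_le_one (by positivity)]
    have : (0 : ℝ) ≤ n := Nat.cast_nonneg n
    linarith
  have hclim : Tendsto c atTop (𝓝 0) := tendsto_one_div_add_atTop_nhds_zero_nat
  have hβn : ∀ n, ContDiff ℝ 1 (fun x => β (c n * x)) := fun n => hβ.comp (by fun_prop)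
  have hβnd : ∀ n x, deriv (fun x => β (c n * x)) x = c n * deriv β (c n * x) := fun n x => by
    have h1 : HasDerivAt (fun x : ℝ => c n * x) (c n) x := by
      simpa using (hasDerivAt_id x).const_mul (c n)
    have := (hβd (c n * x)).hasDerivAt.comp x h1
    rw [mul_comm]
    exact this.deriv
  set μ : Measure (ℝ × ℝ) := volume.restrict (Ioi (0 : ℝ) ×ˢ univ) with hμ
  set S : Set (ℝ × ℝ) := Icc a b ×ˢ univ with hS
  have hSm : MeasurableSet S := measurableSet_Icc.prod MeasurableSet.univ
  have hSsub : S ⊆ Ioi (0 : ℝ) ×ˢ univ := prod_mono (fun t ht => ha.trans_le ht.1) le_rfl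
  have hUm : AEMeasurable (fun p : ℝ × ℝ => u p.1 p.2) μ :=
    (hu.aestronglyMeasurable (prod_mono Ioi_subset_Ici_self le_rfl)).aemeasurable
  have hsm : AEMeasurable (fun p : ℝ × ℝ => source (u p.1) p.2) μ :=
    ((hu.continuousOn_source.mono (prod_mono Ioi_subset_Ici_self le_rfl)).aestronglyMeasurable
      (measurableSet_Ioi.prod MeasurableSet.univ)).aemeasurable
  have hsgn : AEMeasurable (fun p : ℝ × ℝ => Real.sign (u p.1 p.2)) μ :=
    measurable_sign.comp_aemeasurable hUm
  have hUi : Integrable (fun p : ℝ × ℝ => |u p.1 p.2|) (volume.restrict S) :=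
    (hu.integrableOn_slab ha.le).abs
  have hsi : Integrable (fun p : ℝ × ℝ => |source (u p.1) p.2|) (volume.restrict S) :=
    (hu.integrableOn_source_slab ha.le).abs
  have hrestr : μ.restrict S = volume.restrict S := by
    rw [hμ, Measure.restrict_restrict hSm, inter_eq_left.2 hSsub]
  obtain ⟨M', hM'⟩ := hu.locallyBounded a (b + 1) ha (by linarith)
  have hMS : ∀ᵐ p ∂μ, p ∈ S → |u p.1 p.2| ≤ |M'| := by
    rw [← ae_restrict_iff' hSm, hrestr]
    refine ae_mono (Measure.restrict_mono (Set.prod_mono (Icc_subset_Icc_right (by linarith)) le_rfl)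
      le_rfl) (hM'.mono fun p hp => hp.trans (le_abs_self _))
  let I : ℕ → ℝ × ℝ → ℝ := fun n p =>
    |u p.1 p.2| * (deriv α p.1 * β (c n * p.2))
      + Real.sign (u p.1 p.2) * ((u p.1 p.2) ^ 2 / 2) * (α p.1 * (c n * deriv β (c n * p.2)))
      + Real.sign (u p.1 p.2) * source (u p.1) p.2 * (α p.1 * β (c n * p.2))
  let L : ℝ × ℝ → ℝ := fun p =>
    |u p.1 p.2| * deriv α p.1 + Real.sign (u p.1 p.2) * source (u p.1) p.2 * α p.1
  have hI : ∀ n, 0 ≤ ∫ p, I n p ∂μ := fun n => by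
    have hcs : HasCompactSupport (fun x => β (c n * x)) :=
      β.hasCompactSupport.comp_homeomorph (Homeomorph.mulLeft₀ (c n) (hc0 n).ne')
    have hts := tsupport_fst_mul_snd_subset α (fun x => β (c n * x))
    have h := hu.entropy 0 (fun p => α p.1 * β (c n * p.2))
      ((hα.comp contDiff_fst).mul ((hβn n).comp contDiff_snd))
      (HasCompactSupport.of_support_subset_isCompact (isCompact_Icc.prod hcs)
        ((subset_closure.trans hts).trans (prod_mono hαts le_rfl)))
      (hts.trans (prod_mono (hαts.trans fun t ht => ha.trans_le ht.1) (subset_univ _)))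
      (fun p => mul_nonneg (hα0 _) β.nonneg)
    refine h.trans_eq (integral_congr_ae (ae_of_all _ fun p => ?_))
    simp only [fderiv_fst_mul_snd_one_zero hα (hβn n), fderiv_fst_mul_snd_zero_one hα (hβn n),
      hβnd, I, sub_zero]
    ring
  let bound : ℝ × ℝ → ℝ := S.indicator fun p =>
    (A₁ + |M'| * A₀ * B) * |u p.1 p.2| + A₀ * |source (u p.1) p.2|
  have hbi : Integrable bound μ := by
    rw [integrable_indicator_iff hSm, IntegrableOn, hrestr]
    exact (hUi.const_mul _).add (hsi.const_mul _)
  have hlim : Tendsto (fun n => ∫ p, I n p ∂μ) atTop (𝓝 (∫ p, L p ∂μ)) := by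
    refine tendsto_integral_of_dominated_convergence bound (fun n => ?_) hbi (fun n => ?_) ?_
    · have h1 : Measurable fun p : ℝ × ℝ => β (c n * p.2) := by
        have := β.continuous.measurable
        fun_prop
      have h2 : Measurable fun p : ℝ × ℝ => deriv β (c n * p.2) := by
        have := hβ'c.measurable
        fun_prop
      have h3 : Measurable fun p : ℝ × ℝ => α p.1 := hαc.measurable.comp measurable_fst
      have h4 : Measurable fun p : ℝ × ℝ => deriv α p.1 := hα'c.measurable.comp measurable_fst
      refine AEMeasurable.aestronglyMeasurable ?_
      exact ((hUm.abs.mul (h4.mul h1).aemeasurable).add ((hsgn.mul ((hUm.pow_const 2).div_const 2)).mul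
        (h3.mul (h2.const_mul _)).aemeasurable)).add ((hsgn.mul hsm).mul (h3.mul h1).aemeasurable)
    · filter_upwards [hMS] with p hp
      by_cases hpS : p ∈ S
      · have hp1 : p.1 ∈ Icc a b := hpS.1
        simp only [bound, indicator_of_mem hpS, I]
        have e0 := abs_sign_le (u p.1 p.2)
        have e1 : |β (c n * p.2)| ≤ 1 := by rw [abs_of_nonneg β.nonneg]; exact β.le_one
        have e2 : |c n * deriv β (c n * p.2)| ≤ B := by
          rw [abs_mul, abs_of_pos (hc0 n)]
          have := hB (c n * p.2)
          rw [Real.norm_eq_abs] at this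
          calc c n * |deriv β (c n * p.2)| ≤ 1 * B :=
                mul_le_mul (hc1 n) this (abs_nonneg _) zero_le_one
            _ = B := one_mul B
        have e3 : |deriv α p.1| ≤ A₁ := hA₁ _ hp1
        have e4 : |α p.1| ≤ A₀ := hA₀ _ hp1
        have t1 : |(|u p.1 p.2| * (deriv α p.1 * β (c n * p.2)))| ≤ A₁ * |u p.1 p.2| := by
          rw [abs_mul, abs_mul, abs_abs, mul_comm]
          exact mul_le_mul_of_nonneg_right ((mul_le_mul e3 e1 (abs_nonneg _) hA₁0).trans_eq
            (mul_one _)) (abs_nonneg _)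
        have t2 : |Real.sign (u p.1 p.2) * ((u p.1 p.2) ^ 2 / 2) *
            (α p.1 * (c n * deriv β (c n * p.2)))| ≤ |M'| * A₀ * B * |u p.1 p.2| := by
          rw [abs_mul, abs_mul, abs_mul (α p.1)]
          have h1 : |(u p.1 p.2) ^ 2 / 2| ≤ |M'| * |u p.1 p.2| := by
            rw [abs_of_nonneg (by positivity), ← sq_abs]
            nlinarith [hp hpS, abs_nonneg (u p.1 p.2)]
          have h2 : |Real.sign (u p.1 p.2)| * |(u p.1 p.2) ^ 2 / 2| ≤ 1 * (|M'| * |u p.1 p.2|) :=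
            mul_le_mul e0 h1 (abs_nonneg _) zero_le_one
          have h3 := mul_le_mul e4 e2 (abs_nonneg _) hA₀0
          exact (mul_le_mul h2 h3 (by positivity) (by positivity)).trans_eq (by ring)
        have t3 : |Real.sign (u p.1 p.2) * source (u p.1) p.2 * (α p.1 * β (c n * p.2))| ≤
            A₀ * |source (u p.1) p.2| := by
          rw [abs_mul, abs_mul, abs_mul (α p.1)]
          have h2 : |Real.sign (u p.1 p.2)| * |source (u p.1) p.2| ≤ 1 * |source (u p.1) p.2| :=
            mul_le_mul_of_nonneg_right e0 (abs_nonneg _)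
          have h3 := mul_le_mul e4 e1 (abs_nonneg _) hA₀0
          exact (mul_le_mul h2 h3 (by positivity) (by positivity)).trans_eq (by ring)
        refine (norm_add₃_le).trans ?_
        simp only [Real.norm_eq_abs]
        linarith
      · have hp1 : p.1 ∉ Icc a b := fun h => hpS ⟨h, mem_univ _⟩
        simp [bound, indicator_of_notMem hpS, I, hαz _ hp1, hαz' _ hp1]
    · refine ae_of_all _ fun p => ?_
      have h0 : Tendsto (fun n => c n * p.2) atTop (𝓝 0) := by simpa using hclim.mul_const p.2
      have h1 : Tendsto (fun n => β (c n * p.2)) atTop (𝓝 1) := by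
        have := (β.continuous.tendsto 0).comp h0
        rwa [β.one_of_mem_closedBall (by simp [β])] at this
      have h2 : Tendsto (fun n => c n * deriv β (c n * p.2)) atTop (𝓝 0) := by
        simpa using hclim.mul ((hβ'c.tendsto 0).comp h0)
      have h3 := ((h1.const_mul (deriv α p.1)).const_mul |u p.1 p.2|).add
        (((h2.const_mul (α p.1)).const_mul
          (Real.sign (u p.1 p.2) * ((u p.1 p.2) ^ 2 / 2))))
      have h4 := h3.add ((h1.const_mul (α p.1)).const_mul
        (Real.sign (u p.1 p.2) * source (u p.1) p.2))
      simpa [I, L] using h4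
  have hL : 0 ≤ ∫ p, L p ∂μ := ge_of_tendsto' hlim hI
  have hLS : ∫ p, L p ∂μ = ∫ p in S, L p := by
    rw [hμ]
    refine setIntegral_eq_of_subset_of_forall_sdiff_eq_zero
      (measurableSet_Ioi.prod MeasurableSet.univ) hSsub fun p hp => ?_
    have hp1 : p.1 ∉ Icc a b := fun h => hp.2 ⟨h, mem_univ _⟩
    simp [L, hαz _ hp1, hαz' _ hp1]
  let L' : ℝ × ℝ → ℝ := fun p => |u p.1 p.2| * deriv α p.1 + |source (u p.1) p.2| * α p.1
  have hαb : ∀ᵐ p ∂(volume.restrict S), ‖α p.1‖ ≤ A₀ := by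
    filter_upwards [ae_restrict_mem hSm] with p hp using hA₀ _ hp.1
  have hαb' : ∀ᵐ p ∂(volume.restrict S), ‖deriv α p.1‖ ≤ A₁ := by
    filter_upwards [ae_restrict_mem hSm] with p hp using hA₁ _ hp.1
  have hα1m : AEStronglyMeasurable (fun p : ℝ × ℝ => α p.1) (volume.restrict S) :=
    (hαc.comp continuous_fst).aestronglyMeasurable
  have hα2m : AEStronglyMeasurable (fun p : ℝ × ℝ => deriv α p.1) (volume.restrict S) :=
    (hα'c.comp continuous_fst).aestronglyMeasurable
  have hL'i : Integrable L' (volume.restrict S) :=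
    (hUi.mul_bdd hα2m hαb').add (hsi.mul_bdd hα1m hαb)
  have hLL' : ∫ p in S, L p ≤ ∫ p in S, L' p := by
    have hsgnS : AEStronglyMeasurable (fun p : ℝ × ℝ => Real.sign (u p.1 p.2))
        (volume.restrict S) := by
      rw [← hrestr]; exact (hsgn.mono_measure Measure.restrict_le_self).aestronglyMeasurable
    have hss : Integrable (fun p : ℝ × ℝ => Real.sign (u p.1 p.2) * source (u p.1) p.2)
        (volume.restrict S) :=
      (hu.integrableOn_source_slab ha.le).bdd_mul hsgnS (ae_of_all _ fun p => abs_sign_le _)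
    refine integral_mono ((hUi.mul_bdd hα2m hαb').add (hss.mul_bdd hα1m hαb)) hL'i fun p => ?_
    refine add_le_add le_rfl (mul_le_mul_of_nonneg_right ?_ (hα0 _))
    refine (le_abs_self _).trans ?_
    rw [abs_mul]
    exact mul_le_of_le_one_left (abs_nonneg _) (abs_sign_le _)
  have hnc : ContinuousOn (fun t => ∫ y, |u t y|) (Icc a b) :=
    hu.continuousOn_norm.mono fun t ht => ha.le.trans ht.1
  have hprod : ∫ p in S, L' p = ∫ t in Icc a b, ∫ y, L' (t, y) := by
    rw [Measure.volume_eq_prod] at hL'i ⊢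
    rw [setIntegral_prod _ hL'i, Measure.restrict_univ]
  have hfin : ∫ t in Icc a b, ∫ y, L' (t, y) ≤
      ∫ t in Icc a b, (Real.exp (-t) * ∫ y, |u t y|) * deriv θ t := by
    have hi1 : IntegrableOn (fun t => ∫ y, L' (t, y)) (Icc a b) := by
      rw [Measure.volume_eq_prod, hS, ← Measure.prod_restrict, Measure.restrict_univ] at hL'i
      exact hL'i.integral_prod_left
    refine setIntegral_mono_on hi1 ?_ measurableSet_Icc fun t ht => ?_
    · exact (((Continuous.continuousOn (by fun_prop)).mul hnc).mul
        hθ'c.continuousOn).integrableOn_compact isCompact_Icc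
    · have ht0 : 0 ≤ t := ha.le.trans ht.1
      simp only [L']
      rw [integral_add ((hu.integrable t ht0).abs.mul_const _)
        ((integrable_source (hu.integrable t ht0)).abs.mul_const _), integral_mul_const,
        integral_mul_const, hα']
      have := mul_le_mul_of_nonneg_right (integral_abs_source_le (hu.integrable t ht0)) (hα0 t)
      refine (add_le_add le_rfl this).trans_eq ?_
      simp only [α]
      ring
  have hext : ∫ t in Icc a b, (Real.exp (-t) * ∫ y, |u t y|) * deriv θ t =
      ∫ t, (Real.exp (-t) * ∫ y, |u t y|) * deriv θ t :=
    setIntegral_eq_integral_of_forall_compl_eq_zero fun t ht => by simp [hθz' t ht]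
  rw [← hext]
  exact ((hL.trans_eq hLS).trans hLL').trans (hprod.trans_le hfin)

lemma norm_le_exp_mul (hu : IsWeakEntropySolution ubar u) {t : ℝ} (ht : 0 ≤ t) :
    ∫ y, |u t y| ≤ Real.exp t * ∫ y, |ubar y| := by
  have hc : ContinuousOn (fun t => Real.exp (-t) * ∫ y, |u t y|) (Ico 0 (t + 1)) :=
    (Continuous.continuousOn (by fun_prop)).mul
      (hu.continuousOn_norm.mono Ico_subset_Ici_self)
  have h := antitoneOn_of_integral_mul_deriv_nonneg hc
    (fun θ h1 h2 h3 h4 => hu.integral_exp_mul_norm_mul_deriv_nonneg (by linarith) h1 h2 h3 h4)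
    (show (0 : ℝ) ∈ Ico 0 (t + 1) from ⟨le_rfl, by linarith⟩)
    (show t ∈ Ico 0 (t + 1) from ⟨ht, by linarith⟩) ht
  have h0 : ∫ y, |u 0 y| = ∫ y, |ubar y| :=
    integral_congr_ae (hu.initial.mono fun y hy => by simp only [hy])
  simp only [neg_zero, Real.exp_zero, one_mul, h0] at h
  calc ∫ y, |u t y| = Real.exp t * (Real.exp (-t) * ∫ y, |u t y|) := by
        rw [← mul_assoc, ← Real.exp_add, add_neg_cancel, Real.exp_zero, one_mul]
    _ ≤ _ := mul_le_mul_of_nonneg_left h (Real.exp_pos _).le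

end IsWeakEntropySolution

/-! ### The classical equation in regions of smoothness. -/

lemma integral_fderiv_eq_zero {φ : ℝ × ℝ → ℝ} (hφ : ContDiff ℝ 1 φ) (hc : HasCompactSupport φ)
    (e : ℝ × ℝ) : ∫ p, fderiv ℝ φ p e = 0 := by
  have h1 : Integrable fun p => fderiv ℝ φ p e :=
    ((hφ.continuous_fderiv one_ne_zero).clm_apply continuous_const).integrable_of_hasCompactSupport
      (hc.fderiv_apply ℝ e)
  have := integral_mul_fderiv_eq_neg_fderiv_mul_of_integrable (μ := (volume : Measure (ℝ × ℝ)))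
    (f := fun _ => (1 : ℝ)) (g := φ) (v := e) (by simp) (by simpa using h1)
    (by simpa using hφ.continuous.integrable_of_hasCompactSupport hc) (by simp)
    (fun x _ => (hφ.differentiable one_ne_zero) x)
  simpa using this

lemma ContinuousOn.continuous_mul_of_tsupport_subset {O : Set (ℝ × ℝ)} (hO : IsOpen O)
    {f ψ : ℝ × ℝ → ℝ} (hf : ContinuousOn f O) (hψ : Continuous ψ) (h : tsupport ψ ⊆ O) :
    Continuous fun p => f p * ψ p :=
  (hf.mul hψ.continuousOn).continuous_of_tsupport_subset hO
    ((tsupport_mul_subset_right (f := f) (g := ψ)).trans h)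

lemma tsupport_fderiv_apply_subset' (φ : ℝ × ℝ → ℝ) (e : ℝ × ℝ) :
    tsupport (fun p => fderiv ℝ φ p e) ⊆ tsupport φ := by
  exact tsupport_fderiv_apply_subset ℝ e

lemma fderiv_apply_eq_zero_of_notMem {φ : ℝ × ℝ → ℝ} {p : ℝ × ℝ} (h : p ∉ tsupport φ)
    (e : ℝ × ℝ) : fderiv ℝ φ p e = 0 := by
  rw [image_eq_zero_of_notMem_tsupport fun h' => h (tsupport_fderiv_subset ℝ h')]
  rfl

lemma integral_mul_fderiv_eq_neg {O : Set (ℝ × ℝ)} (hO : IsOpen O) {f φ : ℝ × ℝ → ℝ}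
    (hf : ContDiffOn ℝ 1 f O) (hφ : ContDiff ℝ 1 φ) (hc : HasCompactSupport φ)
    (hs : tsupport φ ⊆ O) (e : ℝ × ℝ) :
    ∫ p, f p * fderiv ℝ φ p e = -∫ p, fderiv ℝ f p e * φ p := by
  have hf' : ContinuousOn (fun p => fderiv ℝ f p e) O :=
    (hf.continuousOn_fderiv_of_isOpen hO le_rfl).clm_apply continuousOn_const
  have hφ' : Continuous fun p => fderiv ℝ φ p e :=
    (hφ.continuous_fderiv one_ne_zero).clm_apply continuous_const
  refine integral_mul_fderiv_eq_neg_fderiv_mul_of_integrable ?_ ?_ ?_ ?_ ?_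
  · exact (ContinuousOn.continuous_mul_of_tsupport_subset hO hf' hφ.continuous
      hs).integrable_of_hasCompactSupport hc.mul_left
  · exact (ContinuousOn.continuous_mul_of_tsupport_subset hO hf.continuousOn hφ'
      ((tsupport_fderiv_apply_subset' φ e).trans hs)).integrable_of_hasCompactSupport
      (hc.fderiv_apply ℝ e).mul_left
  · exact (ContinuousOn.continuous_mul_of_tsupport_subset hO hf.continuousOn hφ.continuous
      hs).integrable_of_hasCompactSupport hc.mul_left
  · exact fun p hp => (hf.differentiableOn one_ne_zero).differentiableAt (hO.mem_nhds (hs hp))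
  · exact fun p _ => (hφ.differentiable one_ne_zero) p

namespace IsWeakEntropySolution
variable {ubar : ℝ → ℝ} {u : ℝ → ℝ → ℝ}

lemma entropy_univ (hu : IsWeakEntropySolution ubar u) (k : ℝ) {φ : ℝ × ℝ → ℝ}
    (hφ : ContDiff ℝ 1 φ) (hc : HasCompactSupport φ) (hs : tsupport φ ⊆ Ioi 0 ×ˢ univ)
    (h0 : ∀ p, 0 ≤ φ p) :
    0 ≤ ∫ p : ℝ × ℝ, (|u p.1 p.2 - k| * fderiv ℝ φ p (1, 0)
        + Real.sign (u p.1 p.2 - k) * ((u p.1 p.2) ^ 2 / 2 - k ^ 2 / 2) * fderiv ℝ φ p (0, 1)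
        + Real.sign (u p.1 p.2 - k) * source (u p.1) p.2 * φ p) := by
  refine (hu.entropy k φ hφ hc hs h0).trans_eq
    (setIntegral_eq_integral_of_forall_compl_eq_zero fun p hp => ?_)
  have h1 : p ∉ tsupport φ := fun h => hp (hs h)
  simp [fderiv_apply_eq_zero_of_notMem h1, image_eq_zero_of_notMem_tsupport h1]

/-- With `k` outside the range of `g` on the support of `φ`, the entropy inequality is affine in
`u`. The choices `k = -(N + 1)` and `k = N + 1` give opposite inequalities; the constants drop out
because derivatives of `φ` have integral zero. -/
lemma integral_weak_eq_zero (hu : IsWeakEntropySolution ubar u) {O : Set (ℝ × ℝ)}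
    (hO : IsOpen O) (hO0 : O ⊆ Ioi 0 ×ˢ univ) {g : ℝ × ℝ → ℝ} (hg : ContinuousOn g O)
    (h : ∀ᵐ p : ℝ × ℝ ∂(volume.restrict O), u p.1 p.2 = g p) {φ : ℝ × ℝ → ℝ}
    (hφ : ContDiff ℝ 1 φ) (hc : HasCompactSupport φ) (hs : tsupport φ ⊆ O) (h0 : ∀ p, 0 ≤ φ p) :
    ∫ p, (g p * fderiv ℝ φ p (1, 0) + g p ^ 2 / 2 * fderiv ℝ φ p (0, 1) +
      source (u p.1) p.2 * φ p) = 0 := by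
  obtain ⟨N, hN⟩ := hc.isCompact.exists_bound_of_continuousOn (hg.mono hs)
  have hφt : Continuous fun p => fderiv ℝ φ p (1, 0) :=
    (hφ.continuous_fderiv one_ne_zero).clm_apply continuous_const
  have hφx : Continuous fun p => fderiv ℝ φ p (0, 1) :=
    (hφ.continuous_fderiv one_ne_zero).clm_apply continuous_const
  have hst := (tsupport_fderiv_apply_subset' φ (1, 0)).trans hs
  have hsx := (tsupport_fderiv_apply_subset' φ (0, 1)).trans hs
  have hsc : ContinuousOn (fun p : ℝ × ℝ => source (u p.1) p.2) O :=
    hu.continuousOn_source.mono (hO0.trans (Set.prod_mono Ioi_subset_Ici_self le_rfl))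
  have i1 : Integrable fun p => g p * fderiv ℝ φ p (1, 0) :=
    (ContinuousOn.continuous_mul_of_tsupport_subset hO hg hφt hst).integrable_of_hasCompactSupport
      (hc.fderiv_apply ℝ _).mul_left
  have i2 : Integrable fun p => g p ^ 2 / 2 * fderiv ℝ φ p (0, 1) :=
    (ContinuousOn.continuous_mul_of_tsupport_subset hO ((hg.pow 2).div_const 2) hφx
      hsx).integrable_of_hasCompactSupport (hc.fderiv_apply ℝ _).mul_left
  have i3 : Integrable fun p : ℝ × ℝ => source (u p.1) p.2 * φ p :=
    (ContinuousOn.continuous_mul_of_tsupport_subset hO hsc hφ.continuous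
      hs).integrable_of_hasCompactSupport hc.mul_left
  have j1 : Integrable fun p => fderiv ℝ φ p (1, 0) :=
    hφt.integrable_of_hasCompactSupport (hc.fderiv_apply ℝ _)
  have j2 : Integrable fun p => fderiv ℝ φ p (0, 1) :=
    hφx.integrable_of_hasCompactSupport (hc.fderiv_apply ℝ _)
  have key : ∀ σ : ℝ, σ = 1 ∨ σ = -1 → 0 ≤ σ * ∫ p, (g p * fderiv ℝ φ p (1, 0) +
      g p ^ 2 / 2 * fderiv ℝ φ p (0, 1) + source (u p.1) p.2 * φ p) := by
    intro σ hσ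
    have hσ2 : σ ^ 2 = 1 := by rcases hσ with rfl | rfl <;> norm_num
    have h1 := hu.entropy_univ (-σ * (N + 1)) hφ hc (hs.trans hO0) h0
    have h2 : ∫ p : ℝ × ℝ, (|u p.1 p.2 - -σ * (N + 1)| * fderiv ℝ φ p (1, 0)
        + Real.sign (u p.1 p.2 - -σ * (N + 1)) *
          ((u p.1 p.2) ^ 2 / 2 - (-σ * (N + 1)) ^ 2 / 2) * fderiv ℝ φ p (0, 1)
        + Real.sign (u p.1 p.2 - -σ * (N + 1)) * source (u p.1) p.2 * φ p) =
        ∫ p, (σ * (g p * fderiv ℝ φ p (1, 0) + g p ^ 2 / 2 * fderiv ℝ φ p (0, 1) +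
          source (u p.1) p.2 * φ p) + ((N + 1) * fderiv ℝ φ p (1, 0)
          - σ * (N + 1) ^ 2 / 2 * fderiv ℝ φ p (0, 1))) := by
      refine integral_congr_ae ?_
      rw [ae_restrict_iff' hO.measurableSet] at h
      filter_upwards [h] with p hp
      by_cases hpt : p ∈ tsupport φ
      · rw [hp (hs hpt)]
        have hb := hN p hpt
        rw [Real.norm_eq_abs, abs_le] at hb
        rcases hσ with rfl | rfl
        · rw [abs_of_pos (by linarith), Real.sign_of_pos (by linarith)]
          ring
        · rw [abs_of_neg (by linarith), Real.sign_of_neg (by linarith)]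
          ring
      · simp [fderiv_apply_eq_zero_of_notMem hpt, image_eq_zero_of_notMem_tsupport hpt]
    have i4 : Integrable fun p => σ * (g p * fderiv ℝ φ p (1, 0) +
        g p ^ 2 / 2 * fderiv ℝ φ p (0, 1) + source (u p.1) p.2 * φ p) :=
      ((i1.add i2).add i3).const_mul σ
    have i5 : Integrable fun p => (N + 1) * fderiv ℝ φ p (1, 0) -
        σ * (N + 1) ^ 2 / 2 * fderiv ℝ φ p (0, 1) := (j1.const_mul _).sub (j2.const_mul _)
    rw [h2, integral_add i4 i5, integral_const_mul,
      integral_sub (j1.const_mul _) (j2.const_mul _), integral_const_mul, integral_const_mul,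
      integral_fderiv_eq_zero hφ hc, integral_fderiv_eq_zero hφ hc] at h1
    simpa using h1
  have h1 := key 1 (Or.inl rfl)
  have h2 := key (-1) (Or.inr rfl)
  linarith

/-- Where an entropy solution is `C¹`, it solves the equation classically. -/
lemma pde (hu : IsWeakEntropySolution ubar u) {O : Set (ℝ × ℝ)}
    (hO : IsOpen O) (hO0 : O ⊆ Ioi 0 ×ˢ univ) {g : ℝ × ℝ → ℝ} (hg : ContDiffOn ℝ 1 g O)
    (h : ∀ᵐ p : ℝ × ℝ ∂(volume.restrict O), u p.1 p.2 = g p) {p : ℝ × ℝ} (hp : p ∈ O) :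
    fderiv ℝ g p (1, 0) + g p * fderiv ℝ g p (0, 1) = source (u p.1) p.2 := by
  have hfd : ∀ e, ContinuousOn (fun p => fderiv ℝ g p e) O := fun e =>
    (hg.continuousOn_fderiv_of_isOpen hO le_rfl).clm_apply continuousOn_const
  have hsc : ContinuousOn (fun p : ℝ × ℝ => source (u p.1) p.2) O :=
    hu.continuousOn_source.mono (hO0.trans (Set.prod_mono Ioi_subset_Ici_self le_rfl))
  let D : ℝ × ℝ → ℝ := fun p =>
    source (u p.1) p.2 - fderiv ℝ g p (1, 0) - g p * fderiv ℝ g p (0, 1)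
  have hD : ContinuousOn D O := (hsc.sub (hfd _)).sub (hg.continuousOn.mul (hfd _))
  have hz : ∀ φ : ℝ × ℝ → ℝ, ContDiff ℝ 1 φ → HasCompactSupport φ → tsupport φ ⊆ O →
      (∀ p, 0 ≤ φ p) → ∫ p, D p * φ p = 0 := by
    intro φ hφ hc hs h0
    have hw := hu.integral_weak_eq_zero hO hO0 hg.continuousOn h hφ hc hs h0
    have hφt : Continuous fun p => fderiv ℝ φ p (1, 0) :=
      (hφ.continuous_fderiv one_ne_zero).clm_apply continuous_const
    have hφx : Continuous fun p => fderiv ℝ φ p (0, 1) :=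
      (hφ.continuous_fderiv one_ne_zero).clm_apply continuous_const
    have hst := (tsupport_fderiv_apply_subset' φ (1, 0)).trans hs
    have hsx := (tsupport_fderiv_apply_subset' φ (0, 1)).trans hs
    have i1 : Integrable fun p => g p * fderiv ℝ φ p (1, 0) :=
      (ContinuousOn.continuous_mul_of_tsupport_subset hO hg.continuousOn hφt
        hst).integrable_of_hasCompactSupport (hc.fderiv_apply ℝ _).mul_left
    have i2 : Integrable fun p => g p ^ 2 / 2 * fderiv ℝ φ p (0, 1) :=
      (ContinuousOn.continuous_mul_of_tsupport_subset hO ((hg.continuousOn.pow 2).div_const 2) hφx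
        hsx).integrable_of_hasCompactSupport (hc.fderiv_apply ℝ _).mul_left
    have hmul : ∀ {f : ℝ × ℝ → ℝ}, ContinuousOn f O → Integrable fun p => f p * φ p := fun hf =>
      (ContinuousOn.continuous_mul_of_tsupport_subset hO hf hφ.continuous
        hs).integrable_of_hasCompactSupport hc.mul_left
    have hsq : ContDiffOn ℝ 1 (fun p => g p ^ 2 / 2) O := (hg.pow 2).div_const 2
    have hsqd : ∀ p ∈ O, fderiv ℝ (fun p => g p ^ 2 / 2) p (0, 1) = g p * fderiv ℝ g p (0, 1) := by
      intro p hp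
      have hd := ((hg.differentiableOn one_ne_zero).differentiableAt (hO.mem_nhds hp)).hasFDerivAt
      have h2 : HasFDerivAt (fun p => g p ^ 2 / 2) (g p • fderiv ℝ g p) p := by
        have := (hd.pow 2).mul_const (1 / 2 : ℝ)
        refine (this.congr_fderiv ?_).congr_of_eventuallyEq (Eventually.of_forall fun q => ?_)
        · ext <;> simp <;> ring
        · simp [div_eq_mul_inv]
      rw [h2.fderiv]; simp
    have i12 : Integrable fun p => g p * fderiv ℝ φ p (1, 0) +
        g p ^ 2 / 2 * fderiv ℝ φ p (0, 1) := i1.add i2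
    rw [integral_add i12 (hmul hsc), integral_add i1 i2,
      integral_mul_fderiv_eq_neg hO hg hφ hc hs, integral_mul_fderiv_eq_neg hO hsq hφ hc hs] at hw
    have hx : ∫ p, fderiv ℝ (fun p => g p ^ 2 / 2) p (0, 1) * φ p =
        ∫ p, g p * fderiv ℝ g p (0, 1) * φ p := by
      refine integral_congr_ae (ae_of_all _ fun p => ?_)
      by_cases hpt : p ∈ tsupport φ
      · simp only [hsqd p (hs hpt)]
      · simp [image_eq_zero_of_notMem_tsupport hpt]
    have hgx : ContinuousOn (fun p => g p * fderiv ℝ g p (0, 1)) O :=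
      hg.continuousOn.mul (hfd _)
    simp only [D, sub_mul]
    have i6 : Integrable fun p : ℝ × ℝ => source (u p.1) p.2 * φ p -
        fderiv ℝ g p (1, 0) * φ p := (hmul hsc).sub (hmul (hfd _))
    rw [integral_sub i6 (hmul hgx), integral_sub (hmul hsc)
      (hmul (hfd _)), ← hx]
    linarith
  -- The residual `D` is continuous and annihilates every non-negative test function; a bump
  -- supported where `σ D > 0` would contradict this.
  have key : ∀ σ : ℝ, ¬ 0 < σ * D p := by
    intro σ hσ
    have hσD : ContinuousOn (fun p => σ * D p) O := hD.const_smul σ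
    have hnh : O ∩ (fun p => σ * D p) ⁻¹' Ioi 0 ∈ 𝓝 p :=
      (hσD.isOpen_inter_preimage hO isOpen_Ioi).mem_nhds ⟨hp, hσ⟩
    obtain ⟨φ, hφs, hφc, hφ, hφr, hφp⟩ := exists_contDiff_tsupport_subset (n := 1) hnh
    have hφO : tsupport φ ⊆ O := hφs.trans inter_subset_left
    have hφ0 : ∀ q, 0 ≤ φ q := fun q => (hφr (mem_range_self q)).1
    have h1 := hz φ hφ hφc hφO hφ0
    have h2 : 0 < ∫ q, σ * D q * φ q := by
      refine Continuous.integral_pos_of_hasCompactSupport_nonneg_nonzero (x := p)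
        (ContinuousOn.continuous_mul_of_tsupport_subset hO hσD hφ.continuous hφO) hφc.mul_left
        (fun q => ?_) ?_
      · by_cases hq : q ∈ tsupport φ
        · exact mul_nonneg (hφs hq).2.le (hφ0 q)
        · simp [image_eq_zero_of_notMem_tsupport hq]
      · simp only [hφp, mul_one]; exact hσ.ne'
    simp only [mul_assoc] at h2
    rw [integral_const_mul, h1, mul_zero] at h2
    exact lt_irrefl _ h2
  have h1 := key 1
  have h2 := key (-1)
  simp only [D] at h1 h2
  linarith

end IsWeakEntropySolution

/-! ### Relative entropy of an entropy solution with respect to a `C¹` function. -/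

lemma hasDerivAt_max_zero_sq (r : ℝ) :
    HasDerivAt (fun r : ℝ => (max r 0) ^ 2) (2 * max r 0) r := by
  rcases lt_trichotomy r 0 with h | rfl | h
  · rw [max_eq_right h.le, mul_zero]
    refine (hasDerivAt_const r (0 : ℝ)).congr_of_eventuallyEq ?_
    filter_upwards [eventually_lt_nhds h] with y hy
    simp [max_eq_right hy.le]
  · rw [max_self, mul_zero, hasDerivAt_iff_isLittleO]
    have h1 : (fun x : ℝ => (max x 0) ^ 2) =O[𝓝 0] fun x : ℝ => x ^ 2 := by
      refine Asymptotics.isBigO_of_le _ fun x => ?_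
      rw [norm_pow, norm_pow]
      refine pow_le_pow_left₀ (norm_nonneg _) ?_ 2
      rcases le_total x 0 with h | h
      · simp [max_eq_right h]
      · simp [max_eq_left h]
    have h2 : (fun x : ℝ => x ^ 2) =o[𝓝 0] fun x : ℝ => x := by
      simpa using Asymptotics.isLittleO_pow_id (𝕜 := ℝ) one_lt_two
    simpa using h1.trans_isLittleO h2
  · rw [max_eq_left h.le]
    have h1 : HasDerivAt (fun r : ℝ => r ^ 2) (2 * r) r := by simpa using hasDerivAt_pow 2 r
    refine h1.congr_of_eventuallyEq ?_
    filter_upwards [eventually_gt_nhds h] with y hy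
    simp [max_eq_left hy.le]

lemma contDiff_max_zero_sq : ContDiff ℝ 1 fun r : ℝ => (max r 0) ^ 2 :=
  contDiff_one_iff_deriv.2 ⟨fun r => (hasDerivAt_max_zero_sq r).differentiableAt, by
    rw [funext fun r => (hasDerivAt_max_zero_sq r).deriv]; fun_prop⟩

/-- The letters `a, b, c, d, e` stand for `φ_t`, `φ v_t`, `φ_x`, `φ v_x`, `s φ` at a fixed point.
Only `k` between `v` and `u` contributes, and there the integrand is a polynomial in `k - v`. The
weight `(k - v)_+²` against `(u - k)_+` produces the entropy `(u - v)_+⁴ / 12`. -/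
lemma integral_kruzhkov_weight {u v N : ℝ} (hv : -N ≤ v) (hu : u ≤ N) (a b c d e : ℝ) :
    ∫ k in Icc (-N) N, (2 * max (u - k) 0 * (a * (max (k - v) 0) ^ 2 - b * (2 * max (k - v) 0))
      + (Real.sign (u - k) + 1) * ((u ^ 2 - k ^ 2) / 2) *
          (c * (max (k - v) 0) ^ 2 - d * (2 * max (k - v) 0))
      + (Real.sign (u - k) + 1) * (e * (max (k - v) 0) ^ 2)) =
    2 * ((max (u - v) 0) ^ 4 / 12 * a - (max (u - v) 0) ^ 3 / 3 * b
      + (v * (max (u - v) 0) ^ 4 / 12 + (max (u - v) 0) ^ 5 / 15) * c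
      - (v * (max (u - v) 0) ^ 3 / 3 + (max (u - v) 0) ^ 4 / 4) * d
      + (max (u - v) 0) ^ 3 / 3 * e) := by
  rcases le_or_gt u v with huv | huv
  · rw [max_eq_right (sub_nonpos.2 huv)]
    have : ∀ k, 2 * max (u - k) 0 * (a * (max (k - v) 0) ^ 2 - b * (2 * max (k - v) 0))
      + (Real.sign (u - k) + 1) * ((u ^ 2 - k ^ 2) / 2) *
          (c * (max (k - v) 0) ^ 2 - d * (2 * max (k - v) 0))
      + (Real.sign (u - k) + 1) * (e * (max (k - v) 0) ^ 2) = 0 := fun k => by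
      rcases le_or_gt k v with h | h
      · simp [max_eq_right (sub_nonpos.2 h)]
      · rw [max_eq_right (by linarith), Real.sign_of_neg (by linarith)]; ring
    simp [this]
  · set w := u - v with hw
    have hw0 : 0 < w := sub_pos.2 huv
    rw [max_eq_left hw0.le]
    -- The coefficients are arranged so that `g` is visibly the derivative of the polynomial in
    -- `hQ`. The value `k = u` is excluded below because `sign 0 + 1` is neither `0` nor `2`.
    let g : ℝ → ℝ := fun k => 2 * (-2 * b * w - 2 * d * (v * w + w ^ 2 / 2)) * (k - v)
      + 3 * (2 * a * w / 3 + 4 * b / 3 + c * (2 * v * w / 3 + w ^ 2 / 3) + 4 * d * v / 3 + 2 * e / 3)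
        * (k - v) ^ 2
      + 4 * (-a / 2 - c * v / 2 + d / 2) * (k - v) ^ 3 + 5 * (-c / 5) * (k - v) ^ 4
    have hae : ∀ᵐ k ∂(volume.restrict (Icc (-N) N)),
        2 * max (u - k) 0 * (a * (max (k - v) 0) ^ 2 - b * (2 * max (k - v) 0))
      + (Real.sign (u - k) + 1) * ((u ^ 2 - k ^ 2) / 2) *
          (c * (max (k - v) 0) ^ 2 - d * (2 * max (k - v) 0))
      + (Real.sign (u - k) + 1) * (e * (max (k - v) 0) ^ 2) = (Ioc v u).indicator g k := by
      refine ae_restrict_of_ae ?_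
      filter_upwards [compl_mem_ae_iff.2 (measure_singleton u)] with k hk
      have hk' : k ≠ u := hk
      rcases le_or_gt k v with h1 | h1
      · rw [indicator_of_notMem (fun hm => not_lt.2 h1 hm.1), max_eq_right (sub_nonpos.2 h1)]
        ring
      · rcases lt_or_gt_of_ne hk' with h2 | h2
        · rw [indicator_of_mem (show k ∈ Ioc v u from ⟨h1, h2.le⟩), max_eq_left (by linarith),
            max_eq_left (by linarith), Real.sign_of_pos (by linarith)]
          simp only [g]
          have hu' : u = w + v := by rw [hw]; ring
          rw [hu']
          ring
        · rw [indicator_of_notMem (fun hm => not_le.2 h2 hm.2), max_eq_right (by linarith),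
            Real.sign_of_neg (by linarith)]
          ring
    rw [integral_congr_ae hae, setIntegral_indicator measurableSet_Ioc]
    have hsub : Icc (-N) N ∩ Ioc v u = Ioc v u :=
      inter_eq_right.2 fun k hk => ⟨hv.trans hk.1.le, hk.2.trans hu⟩
    rw [hsub, ← intervalIntegral.integral_of_le huv.le]
    have hpow : ∀ (n : ℕ) (k : ℝ), HasDerivAt (fun k : ℝ => (k - v) ^ (n + 1))
        ((n + 1 : ℕ) * (k - v) ^ n) k := fun n k => by
      have h1 : HasDerivAt (fun k : ℝ => k - v) 1 k := (hasDerivAt_id k).sub_const v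
      exact (h1.pow (n + 1)).congr_deriv (by simp)
    have hQ : ∀ k ∈ uIcc v u, HasDerivAt (fun k =>
        (-2 * b * w - 2 * d * (v * w + w ^ 2 / 2)) * (k - v) ^ 2
        + (2 * a * w / 3 + 4 * b / 3 + c * (2 * v * w / 3 + w ^ 2 / 3) + 4 * d * v / 3 + 2 * e / 3)
          * (k - v) ^ 3
        + (-a / 2 - c * v / 2 + d / 2) * (k - v) ^ 4 + (-c / 5) * (k - v) ^ 5) (g k) k := by
      intro k _
      refine (((((hpow 1 k).const_mul _).add ((hpow 2 k).const_mul _)).add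
        ((hpow 3 k).const_mul _)).add ((hpow 4 k).const_mul _)).congr_deriv ?_
      simp only [g]
      push_cast
      ring
    rw [intervalIntegral.integral_eq_sub_of_hasDerivAt hQ
      (Continuous.intervalIntegrable (by fun_prop) _ _), ← hw]
    ring

lemma fderiv_mul_comp_max_sq {v φ : ℝ × ℝ → ℝ} (hv : ContDiff ℝ 1 v) (hφ : ContDiff ℝ 1 φ)
    (k : ℝ) (p e : ℝ × ℝ) : fderiv ℝ (fun p => φ p * (max (k - v p) 0) ^ 2) p e =
      fderiv ℝ φ p e * (max (k - v p) 0) ^ 2 -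
        φ p * fderiv ℝ v p e * (2 * max (k - v p) 0) := by
  have h1 : HasFDerivAt (fun p => k - v p) (-fderiv ℝ v p) p :=
    ((hv.differentiable one_ne_zero) p).hasFDerivAt.const_sub k
  have h2 := (hasDerivAt_max_zero_sq (k - v p)).comp_hasFDerivAt p h1
  have h3 := ((hφ.differentiable one_ne_zero) p).hasFDerivAt.mul h2
  have h4 : HasFDerivAt (fun p => φ p * (max (k - v p) 0) ^ 2) _ p := h3
  rw [h4.fderiv]
  simp
  ring

lemma Integrable.mul_of_continuous_compactSupport {f ψ : ℝ × ℝ → ℝ} (hf : Measurable f) {C : ℝ}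
    (hC : ∀ p, |f p| ≤ C) (hψ : Continuous ψ) (hc : HasCompactSupport ψ) :
    Integrable fun p => f p * ψ p :=
  (hψ.integrable_of_hasCompactSupport hc).bdd_mul hf.aestronglyMeasurable (ae_of_all _ hC)

/-- The integrand of the Kruzhkov entropy inequality. -/
def kruzhkov (U s : ℝ × ℝ → ℝ) (k : ℝ) (φ : ℝ × ℝ → ℝ) (p : ℝ × ℝ) : ℝ :=
  |U p - k| * fderiv ℝ φ p (1, 0)
    + Real.sign (U p - k) * ((U p) ^ 2 / 2 - k ^ 2 / 2) * fderiv ℝ φ p (0, 1)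
    + Real.sign (U p - k) * s p * φ p

lemma integrable_kruzhkov {U s : ℝ × ℝ → ℝ} {M : ℝ} (hU : Measurable U) (hM : ∀ p, |U p| ≤ M)
    (hs : Continuous s) (k : ℝ) {φ : ℝ × ℝ → ℝ} (hφ : ContDiff ℝ 1 φ)
    (hc : HasCompactSupport φ) : Integrable (kruzhkov U s k φ) := by
  have hsg : Measurable fun p => Real.sign (U p - k) := measurable_sign.comp (hU.sub_const k)
  refine ((Integrable.mul_of_continuous_compactSupport (C := M + |k|) (by fun_prop) (fun p => ?_)
    ((hφ.continuous_fderiv one_ne_zero).clm_apply continuous_const) (hc.fderiv_apply ℝ _)).add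
    (Integrable.mul_of_continuous_compactSupport (C := M ^ 2 / 2 + k ^ 2 / 2) (by fun_prop)
      (fun p => ?_) ((hφ.continuous_fderiv one_ne_zero).clm_apply continuous_const)
      (hc.fderiv_apply ℝ _))).add ?_
  · rw [abs_abs]
    exact (abs_sub _ _).trans (add_le_add (hM p) le_rfl)
  · rw [abs_mul]
    have h1 : |U p ^ 2 / 2 - k ^ 2 / 2| ≤ M ^ 2 / 2 + k ^ 2 / 2 := by
      have h2 : U p ^ 2 ≤ M ^ 2 := sq_le_sq' (by linarith [(abs_le.1 (hM p)).1]) (abs_le.1 (hM p)).2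
      rw [abs_le]
      constructor <;> nlinarith [sq_nonneg (U p), sq_nonneg k]
    exact (mul_le_of_le_one_left (abs_nonneg _) (abs_sign_le _)).trans h1
  · have := Integrable.mul_of_continuous_compactSupport (C := 1) hsg (fun p => abs_sign_le _)
      (hs.mul hφ.continuous) hc.mul_left
    exact this.congr (ae_of_all _ fun p => by simp only [Pi.mul_apply, mul_assoc])

/-- The constant `-(M + 1)` lies below `U`, so its inequality is affine in `U`. Adding it to the one
for `k` turns `|U - k|` into `2 (U - k)_+` and the sign into `sign + 1`, up to constants that
integrate to zero against derivatives of `φ`. -/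
lemma integral_semi_kruzhkov_nonneg {U s : ℝ × ℝ → ℝ} {M : ℝ} {O : Set (ℝ × ℝ)}
    (hU : Measurable U) (hM : ∀ p, |U p| ≤ M) (hs : Continuous s)
    (hent : ∀ (k : ℝ) (φ : ℝ × ℝ → ℝ), ContDiff ℝ 1 φ → HasCompactSupport φ → tsupport φ ⊆ O →
      (∀ p, 0 ≤ φ p) → 0 ≤ ∫ p, kruzhkov U s k φ p)
    (k : ℝ) {φ : ℝ × ℝ → ℝ} (hφ : ContDiff ℝ 1 φ)
    (hc : HasCompactSupport φ) (hO : tsupport φ ⊆ O) (h0 : ∀ p, 0 ≤ φ p) :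
    0 ≤ ∫ p, (2 * max (U p - k) 0 * fderiv ℝ φ p (1, 0)
      + (Real.sign (U p - k) + 1) * (((U p) ^ 2 - k ^ 2) / 2) * fderiv ℝ φ p (0, 1)
      + (Real.sign (U p - k) + 1) * (s p * φ p)) := by
  have h1 := hent k φ hφ hc hO h0
  have h2 := hent (-(M + 1)) φ hφ hc hO h0
  have hj : ∀ e, Integrable fun p => fderiv ℝ φ p e := fun e =>
    ((hφ.continuous_fderiv one_ne_zero).clm_apply continuous_const).integrable_of_hasCompactSupport
      (hc.fderiv_apply ℝ _)
  have i1 := integrable_kruzhkov hU hM hs k hφ hc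
  have i2 := integrable_kruzhkov hU hM hs (-(M + 1)) hφ hc
  have h3 := integral_add i1 i2
  have i12 : Integrable fun p => kruzhkov U s k φ p + kruzhkov U s (-(M + 1)) φ p := i1.add i2
  have i3 : Integrable fun p => (k + (M + 1)) * fderiv ℝ φ p (1, 0) +
    (k ^ 2 - (M + 1) ^ 2) / 2 * fderiv ℝ φ p (0, 1) := ((hj _).const_mul _).add ((hj _).const_mul _)
  have h4 := integral_sub i12 i3
  rw [integral_add ((hj _).const_mul _) ((hj _).const_mul _), integral_const_mul,
    integral_const_mul, integral_fderiv_eq_zero hφ hc, integral_fderiv_eq_zero hφ hc] at h4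
  have h5 : 0 ≤ ∫ p, (kruzhkov U s k φ p + kruzhkov U s (-(M + 1)) φ p -
      ((k + (M + 1)) * fderiv ℝ φ p (1, 0) +
        (k ^ 2 - (M + 1) ^ 2) / 2 * fderiv ℝ φ p (0, 1))) := by
    rw [h4, h3]; linarith
  refine h5.trans_eq (integral_congr_ae (ae_of_all _ fun p => ?_))
  have hb := abs_le.1 (hM p)
  simp only [kruzhkov]
  rw [abs_of_pos (show 0 < U p - -(M + 1) by linarith),
    Real.sign_of_pos (show 0 < U p - -(M + 1) by linarith)]
  rcases le_total (U p) k with h | h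
  · rw [abs_of_nonpos (by linarith), max_eq_right (by linarith)]; ring
  · rw [abs_of_nonneg (by linarith), max_eq_left (by linarith)]; ring

/-- The relative entropy inequality for the one-sided entropies `((u - v)^+)^4` of an entropy
solution `U` of `U_t + (U²/2)_x = s` with respect to a `C¹` function `v`. -/
lemma relative_entropy_nonneg {U s : ℝ × ℝ → ℝ} {M : ℝ} {O : Set (ℝ × ℝ)}
    (hU : Measurable U) (hM : ∀ p, |U p| ≤ M) (hs : Continuous s)
    (hent : ∀ (k : ℝ) (φ : ℝ × ℝ → ℝ), ContDiff ℝ 1 φ → HasCompactSupport φ → tsupport φ ⊆ O →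
      (∀ p, 0 ≤ φ p) → 0 ≤ ∫ p, kruzhkov U s k φ p)
    {v φ : ℝ × ℝ → ℝ} (hv : ContDiff ℝ 1 v) (hφ : ContDiff ℝ 1 φ)
    (hc : HasCompactSupport φ) (hO : tsupport φ ⊆ O) (h0 : ∀ p, 0 ≤ φ p) :
    0 ≤ ∫ p, ((max (U p - v p) 0) ^ 4 / 12 * fderiv ℝ φ p (1, 0)
      + (v p * (max (U p - v p) 0) ^ 4 / 12 + (max (U p - v p) 0) ^ 5 / 15) * fderiv ℝ φ p (0, 1)
      - φ p * ((max (U p - v p) 0) ^ 3 / 3 *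
          (fderiv ℝ v p (1, 0) + v p * fderiv ℝ v p (0, 1) - s p)
        + fderiv ℝ v p (0, 1) * ((max (U p - v p) 0) ^ 4 / 4))) := by
  obtain ⟨N₁, hN₁⟩ := hc.isCompact.exists_bound_of_continuousOn hv.continuous.continuousOn
  set N := max M N₁ with hN
  have hdv : ∀ e, Continuous fun p => fderiv ℝ v p e := fun e =>
    (hv.continuous_fderiv one_ne_zero).clm_apply continuous_const
  have hdφ : ∀ e, Continuous fun p => fderiv ℝ φ p e := fun e =>
    (hφ.continuous_fderiv one_ne_zero).clm_apply continuous_const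
  -- The function `v` is put into the test function: for each constant `k` the one-sided inequality
  -- is tested with `φ (k - v)_+²`, which is `C¹` thanks to the square. Integration over `k` then
  -- replaces a doubling of variables.
  let H : ℝ → ℝ × ℝ → ℝ := fun k p =>
    2 * max (U p - k) 0 * (fderiv ℝ φ p (1, 0) * (max (k - v p) 0) ^ 2 -
        φ p * fderiv ℝ v p (1, 0) * (2 * max (k - v p) 0))
      + (Real.sign (U p - k) + 1) * (((U p) ^ 2 - k ^ 2) / 2) *
        (fderiv ℝ φ p (0, 1) * (max (k - v p) 0) ^ 2 -
          φ p * fderiv ℝ v p (0, 1) * (2 * max (k - v p) 0))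
      + (Real.sign (U p - k) + 1) * (s p * φ p * (max (k - v p) 0) ^ 2)
  have hφk : ∀ k, ContDiff ℝ 1 fun p => φ p * (max (k - v p) 0) ^ 2 := fun k =>
    hφ.mul (contDiff_max_zero_sq.comp (contDiff_const.sub hv))
  have hH0 : ∀ k, 0 ≤ ∫ p, H k p := fun k => by
    have hts : tsupport (fun p => φ p * (max (k - v p) 0) ^ 2) ⊆ tsupport φ :=
      tsupport_mul_subset_left (f := φ) (g := fun p => (max (k - v p) 0) ^ 2)
    have := integral_semi_kruzhkov_nonneg hU hM hs hent k (hφk k) hc.mul_right (hts.trans hO)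
      (fun p => mul_nonneg (h0 p) (sq_nonneg _))
    simp only [fderiv_mul_comp_max_sq hv hφ] at this
    refine this.trans_eq (integral_congr_ae (ae_of_all _ fun p => ?_))
    simp only [H]
    ring
  have hHz : ∀ k p, p ∉ tsupport φ → H k p = 0 := fun k p hp => by
    simp [H, fderiv_apply_eq_zero_of_notMem hp, image_eq_zero_of_notMem_tsupport hp]
  have hHi : Integrable (Function.uncurry H)
      ((volume.restrict (Icc (-N) N)).prod (volume : Measure (ℝ × ℝ))) := by
    have hres : (volume.restrict (Icc (-N) N)).prod (volume : Measure (ℝ × ℝ)) =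
        (volume : Measure (ℝ × (ℝ × ℝ))).restrict (Icc (-N) N ×ˢ univ) := by
      rw [Measure.volume_eq_prod ℝ (ℝ × ℝ), ← Measure.prod_restrict, Measure.restrict_univ]
    rw [hres]
    change IntegrableOn _ _ _
    have hKc : IsCompact (Icc (-N) N ×ˢ tsupport φ) := isCompact_Icc.prod hc.isCompact
    have hUm : Measurable fun q : ℝ × (ℝ × ℝ) => U q.2 := hU.comp measurable_snd
    have hsg : Measurable fun q : ℝ × (ℝ × ℝ) => Real.sign (U q.2 - q.1) :=
      measurable_sign.comp (hUm.sub measurable_fst)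
    have c1 : Continuous fun q : ℝ × (ℝ × ℝ) => v q.2 := hv.continuous.comp continuous_snd
    have c2 : Continuous fun q : ℝ × (ℝ × ℝ) => φ q.2 := hφ.continuous.comp continuous_snd
    have c3 : ∀ e, Continuous fun q : ℝ × (ℝ × ℝ) => fderiv ℝ v q.2 e := fun e =>
      (hdv e).comp continuous_snd
    have c4 : ∀ e, Continuous fun q : ℝ × (ℝ × ℝ) => fderiv ℝ φ q.2 e := fun e =>
      (hdφ e).comp continuous_snd
    have c5 : Continuous fun q : ℝ × (ℝ × ℝ) => s q.2 := hs.comp continuous_snd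
    have cA : Continuous fun q : ℝ × (ℝ × ℝ) =>
        fderiv ℝ φ q.2 (1, 0) * (max (q.1 - v q.2) 0) ^ 2 -
        φ q.2 * fderiv ℝ v q.2 (1, 0) * (2 * max (q.1 - v q.2) 0) := by fun_prop
    have cB : Continuous fun q : ℝ × (ℝ × ℝ) =>
        fderiv ℝ φ q.2 (0, 1) * (max (q.1 - v q.2) 0) ^ 2 -
        φ q.2 * fderiv ℝ v q.2 (0, 1) * (2 * max (q.1 - v q.2) 0) := by fun_prop
    have cC : Continuous fun q : ℝ × (ℝ × ℝ) =>
        s q.2 * φ q.2 * (max (q.1 - v q.2) 0) ^ 2 := by fun_prop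
    have m1 : Measurable fun q : ℝ × (ℝ × ℝ) => 2 * max (U q.2 - q.1) 0 := by fun_prop
    have m2 : Measurable fun q : ℝ × (ℝ × ℝ) =>
        (Real.sign (U q.2 - q.1) + 1) * (((U q.2) ^ 2 - q.1 ^ 2) / 2) := by fun_prop
    have m3 : Measurable fun q : ℝ × (ℝ × ℝ) => Real.sign (U q.2 - q.1) + 1 := by fun_prop
    have hmain : IntegrableOn (Function.uncurry H) (Icc (-N) N ×ˢ tsupport φ) := by
      have hb : ∀ {f ψ : ℝ × (ℝ × ℝ) → ℝ} {C : ℝ}, Measurable f → Continuous ψ →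
          (∀ q ∈ Icc (-N) N ×ˢ tsupport φ, |f q| ≤ C) →
          IntegrableOn (fun q => f q * ψ q) (Icc (-N) N ×ˢ tsupport φ) := by
        intro f ψ C hf hψ hC
        refine (hψ.continuousOn.integrableOn_compact hKc).bdd_mul (c := C)
          hf.aestronglyMeasurable ?_
        filter_upwards [ae_restrict_mem hKc.measurableSet] with q hq using hC q hq
      have hs2 : ∀ x, |Real.sign x + 1| ≤ 2 := fun x => by
        have := abs_le.1 (abs_sign_le x)
        rw [abs_le]; constructor <;> linarith
      have hkN : ∀ q ∈ Icc (-N) N ×ˢ tsupport φ, |q.1| ≤ N := fun q hq => abs_le.2 hq.1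
      refine ((hb (C := 2 * (M + N)) m1 cA fun q hq => ?_).add
        (hb (C := 2 * (M ^ 2 / 2 + N ^ 2 / 2)) m2 cB fun q hq => ?_)).add
        (hb (C := 2) m3 cC fun q hq => hs2 _)
      · have h1 := abs_le.1 (hM q.2)
        have h2 := abs_le.1 (hkN q hq)
        rw [abs_of_nonneg (by positivity)]
        have : max (U q.2 - q.1) 0 ≤ M + N := max_le (by linarith) (by linarith)
        linarith
      · rw [abs_mul]
        refine mul_le_mul (hs2 _) ?_ (abs_nonneg _) (by norm_num)
        have h1 := abs_le.1 (hM q.2)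
        have h2 := abs_le.1 (hkN q hq)
        have h3 : U q.2 ^ 2 ≤ M ^ 2 := sq_le_sq' (by linarith) h1.2
        have h4 : q.1 ^ 2 ≤ N ^ 2 := sq_le_sq' (by linarith) h2.2
        rw [abs_le]
        constructor <;> nlinarith [sq_nonneg (U q.2), sq_nonneg q.1]
    refine hmain.of_forall_sdiff_eq_zero (measurableSet_Icc.prod MeasurableSet.univ) fun q hq => ?_
    exact hHz q.1 q.2 fun h => hq.2 ⟨hq.1.1, h⟩
  have hswap := integral_integral_swap hHi
  have hpos : 0 ≤ ∫ p, ∫ k in Icc (-N) N, H k p := by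
    rw [← hswap]
    exact integral_nonneg fun k => hH0 k
  have heq : ∀ p, ∫ k in Icc (-N) N, H k p =
      2 * ((max (U p - v p) 0) ^ 4 / 12 * fderiv ℝ φ p (1, 0)
      + (v p * (max (U p - v p) 0) ^ 4 / 12 + (max (U p - v p) 0) ^ 5 / 15) * fderiv ℝ φ p (0, 1)
      - φ p * ((max (U p - v p) 0) ^ 3 / 3 *
          (fderiv ℝ v p (1, 0) + v p * fderiv ℝ v p (0, 1) - s p)
        + fderiv ℝ v p (0, 1) * ((max (U p - v p) 0) ^ 4 / 4))) := fun p => by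
    by_cases hp : p ∈ tsupport φ
    · have h1 := abs_le.1 (hN₁ p hp)
      have h2 := abs_le.1 (hM p)
      have h3 : N₁ ≤ N := le_max_right _ _
      have h4 : M ≤ N := le_max_left _ _
      simp only [H]
      rw [integral_kruzhkov_weight (by linarith) (by linarith)]
      ring
    · simp [hHz _ p hp, fderiv_apply_eq_zero_of_notMem hp, image_eq_zero_of_notMem_tsupport hp]
  simp only [heq] at hpos
  rw [integral_const_mul] at hpos
  linarith

/-! ### Entropy solutions on a time slab and comparison with supersolutions. -/

/-- Passing from null slices to a null set in the plane requires a measurable set, hence the detour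
through a measurable version of `f`. -/
lemma ae_restrict_of_ae_slice {O : Set (ℝ × ℝ)} (hO : MeasurableSet O) {f : ℝ × ℝ → ℝ}
    (hf : AEMeasurable f (volume.restrict O)) {Q : ℝ × ℝ → ℝ → Prop}
    (hQ : MeasurableSet {q : (ℝ × ℝ) × ℝ | q.1 ∈ O → Q q.1 q.2})
    (h : ∀ᵐ t : ℝ, ∀ᵐ x : ℝ, (t, x) ∈ O → Q (t, x) (f (t, x))) :
    ∀ᵐ p ∂(volume.restrict O), Q p (f p) := by
  obtain ⟨g, hg, hfg⟩ := hf
  have h1 := ae_ae_of_ae_restrict hO hfg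
  have hm : MeasurableSet {p : ℝ × ℝ | p ∈ O → Q p (g p)} :=
    (measurable_id.prodMk hg) hQ
  have h2 : ∀ᵐ p : ℝ × ℝ, p ∈ O → Q p (g p) := by
    rw [Measure.volume_eq_prod, Measure.ae_prod_iff_ae_ae hm]
    filter_upwards [h, h1] with t ht ht'
    filter_upwards [ht, ht'] with x hx hx' hxO
    rw [← hx' hxO]
    exact hx hxO
  rw [← ae_restrict_iff' hO] at h2
  filter_upwards [h2, hfg] with p hp hp'
  rwa [hp']

/-- A bounded entropy solution `u` of `u_t + (u²/2)_x = s` on the time interval `[t₀, t₁]`, for a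
given continuous source `s`. -/
structure EntropySlab (u : ℝ → ℝ → ℝ) (s : ℝ × ℝ → ℝ) (t₀ t₁ M : ℝ) : Prop where
  integrable : ∀ t ∈ Icc t₀ t₁, Integrable (u t)
  bound : ∀ t ∈ Icc t₀ t₁, ∀ᵐ x, |u t x| ≤ M
  tendsto : ∀ t ∈ Icc t₀ t₁,
    Tendsto (fun s => ∫ x, |u s x - u t x|) (𝓝[Icc t₀ t₁] t) (𝓝 0)
  continuous_source : Continuous s
  exists_rep : ∃ U : ℝ × ℝ → ℝ, Measurable U ∧ (∀ p, |U p| ≤ M) ∧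
    (∀ᵐ p : ℝ × ℝ ∂(volume.restrict (Ioo t₀ t₁ ×ˢ univ)), u p.1 p.2 = U p) ∧
    ∀ (k : ℝ) (φ : ℝ × ℝ → ℝ), ContDiff ℝ 1 φ → HasCompactSupport φ →
      tsupport φ ⊆ Ioo t₀ t₁ ×ˢ univ → (∀ p, 0 ≤ φ p) → 0 ≤ ∫ p, kruzhkov U s k φ p

lemma sign_neg' (x : ℝ) : Real.sign (-x) = -Real.sign x := by
  rcases lt_trichotomy x 0 with h | rfl | h
  · rw [Real.sign_of_neg h, Real.sign_of_pos (by linarith)]; ring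
  · simp
  · rw [Real.sign_of_pos h, Real.sign_of_neg (by linarith)]

lemma measurePreserving_reflect :
    MeasurePreserving (fun p : ℝ × ℝ => (p.1, -p.2)) volume volume :=
  (MeasurePreserving.id volume).prod (Measure.measurePreserving_neg volume)

lemma integral_comp_reflect (f : ℝ × ℝ → ℝ) : ∫ p : ℝ × ℝ, f (p.1, -p.2) = ∫ p, f p :=
  measurePreserving_reflect.integral_comp
    (((MeasurableEquiv.refl ℝ).prodCongr (MeasurableEquiv.neg ℝ)).measurableEmbedding) f

/-- The map `(t, x, u) ↦ (t, -x, -u)` is a symmetry of the equation, with `k` replaced by `-k`. It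
converts upper bounds into lower ones, so only supersolutions need to be treated. -/
lemma EntropySlab.reflect {u : ℝ → ℝ → ℝ} {s : ℝ × ℝ → ℝ} {t₀ t₁ M : ℝ}
    (h : EntropySlab u s t₀ t₁ M) :
    EntropySlab (fun t x => -u t (-x)) (fun p => -s (p.1, -p.2)) t₀ t₁ M where
  integrable t ht := (h.integrable t ht).comp_neg.neg
  bound t ht := by
    have := (Measure.measurePreserving_neg (volume : Measure ℝ)).quasiMeasurePreserving.ae
      (h.bound t ht)
    simpa using this
  tendsto t ht := by
    refine (h.tendsto t ht).congr fun s => ?_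
    rw [← integral_neg_eq_self]
    refine integral_congr_ae (ae_of_all _ fun x => ?_)
    simp only [sub_neg_eq_add]
    rw [← abs_neg]
    ring_nf
  continuous_source := by
    have := h.continuous_source
    fun_prop
  exists_rep := by
    obtain ⟨U, hU, hUM, hUu, hent⟩ := h.exists_rep
    refine ⟨fun p => -U (p.1, -p.2), by fun_prop, fun p => by rw [abs_neg]; exact hUM _, ?_, ?_⟩
    · have hm : MeasurableSet (Ioo t₀ t₁ ×ˢ (univ : Set ℝ)) :=
        measurableSet_Ioo.prod MeasurableSet.univ
      rw [ae_restrict_iff' hm] at hUu ⊢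
      filter_upwards [measurePreserving_reflect.quasiMeasurePreserving.ae hUu] with p hp hpm
      rw [hp ⟨hpm.1, mem_univ _⟩]
    · intro k φ hφ hc hs h0
      have hR : ContDiff ℝ 1 fun p : ℝ × ℝ => (p.1, -p.2) := by fun_prop
      let R : ℝ × ℝ ≃ₜ ℝ × ℝ := (Homeomorph.refl ℝ).prodCongr (Homeomorph.neg ℝ)
      have hφ' : ContDiff ℝ 1 (fun p : ℝ × ℝ => φ (p.1, -p.2)) := hφ.comp hR
      have h1 := hent (-k) (fun p : ℝ × ℝ => φ (p.1, -p.2)) hφ' (hc.comp_homeomorph R) ?_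
        (fun p => h0 _)
      · rw [← integral_comp_reflect] at h1
        refine h1.trans_eq (integral_congr_ae (ae_of_all _ fun p => ?_))
        have hd := (hφ.differentiable one_ne_zero p).hasFDerivAt
        have e1 : fderiv ℝ (fun p : ℝ × ℝ => φ (p.1, -p.2)) (p.1, -p.2) (1, 0) =
            fderiv ℝ φ p (1, 0) := by
          refine fderiv_one_zero (hφ'.differentiable one_ne_zero _) ?_
          simp only [neg_neg]
          exact hd.comp_hasDerivAt p.1 ((hasDerivAt_id p.1).prodMk (hasDerivAt_const p.1 p.2))
        have e2 : fderiv ℝ (fun p : ℝ × ℝ => φ (p.1, -p.2)) (p.1, -p.2) (0, 1) =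
            -fderiv ℝ φ p (0, 1) := by
          refine fderiv_zero_one (hφ'.differentiable one_ne_zero _) ?_
          have h2 : HasDerivAt (fun x : ℝ => (p.1, -x)) (0, -1) (-p.2) :=
            (hasDerivAt_const _ _).prodMk (hasDerivAt_neg _)
          have hd' : HasFDerivAt φ (fderiv ℝ φ p) (p.1, - -p.2) := by rw [neg_neg]; exact hd
          refine (hd'.comp_hasDerivAt (-p.2) h2).congr_deriv ?_
          have : ((0 : ℝ), (-1 : ℝ)) = -((0 : ℝ), (1 : ℝ)) := by simp
          rw [this, map_neg]
        simp only [kruzhkov, e1, e2, neg_neg]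
        have e3 : -U (p.1, -p.2) - k = -(U (p.1, -p.2) - -k) := by ring
        rw [e3, abs_neg, sign_neg']
        ring
      · intro p hp
        have hcl : tsupport (fun p : ℝ × ℝ => φ (p.1, -p.2)) ⊆ R ⁻¹' tsupport φ :=
          closure_minimal (fun q hq => subset_closure hq)
            ((isClosed_tsupport φ).preimage R.continuous)
        exact ⟨(hs (hcl hp)).1, mem_univ _⟩

lemma integrable_comp_of_bounded {U : ℝ × ℝ → ℝ} {M : ℝ} (hU : Measurable U)
    (hM : ∀ p, |U p| ≤ M) {F : ℝ × (ℝ × ℝ) → ℝ} (hF : Continuous F) {K : Set (ℝ × ℝ)}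
    (hK : IsCompact K) (hz : ∀ ω, ∀ p, p ∉ K → F (ω, p) = 0) :
    Integrable fun p => F (U p, p) := by
  obtain ⟨C, hC⟩ := ((isCompact_Icc (a := -M) (b := M)).prod hK).exists_bound_of_continuousOn
    hF.continuousOn
  have h1 : IntegrableOn (fun p => F (U p, p)) K :=
    Measure.integrableOn_of_bounded hK.measure_lt_top.ne
      (hF.measurable.comp (hU.prodMk measurable_id)).aestronglyMeasurable (M := C)
      (by filter_upwards [ae_restrict_mem hK.measurableSet] with p hp using
        hC (U p, p) ⟨abs_le.1 (hM p), hp⟩)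
  refine (integrableOn_iff_integrable_of_support_subset fun p hp => ?_).1 h1
  by_contra hn
  exact hp (hz _ _ hn)

namespace EntropySlab
variable {u : ℝ → ℝ → ℝ} {s : ℝ × ℝ → ℝ} {t₀ t₁ M : ℝ}

/-- Convergence in `L¹` gives pointwise convergence only along subsequences; with the uniform bound
`M` and the bounded support this suffices for dominated convergence. -/
lemma continuousOn_integral (h : EntropySlab u s t₀ t₁ M) {Φ : ℝ × (ℝ × ℝ) → ℝ}
    (hΦ : Continuous Φ) {a b : ℝ}
    (hz : ∀ ω, ∀ t ∈ Icc t₀ t₁, ∀ x, x ∉ Icc a b → Φ (ω, t, x) = 0) :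
    ContinuousOn (fun t => ∫ x, Φ (u t x, t, x)) (Icc t₀ t₁) := by
  obtain ⟨C, hC⟩ := ((isCompact_Icc (a := -M) (b := M)).prod ((isCompact_Icc (a := t₀)
    (b := t₁)).prod (isCompact_Icc (a := a) (b := b)))).exists_bound_of_continuousOn
    hΦ.continuousOn
  intro t ht
  refine tendsto_of_seq_tendsto fun τ hτ => tendsto_of_subseq_tendsto fun ns hns => ?_
  have hτ' := tendsto_nhdsWithin_iff.1 (hτ.comp hns)
  obtain ⟨N, hN⟩ := eventually_atTop.1 hτ'.2
  have hmem : ∀ n, τ (ns (n + N)) ∈ Icc t₀ t₁ := fun n => hN _ (Nat.le_add_left _ _)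
  have hlim : Tendsto (fun n => τ (ns (n + N))) atTop (𝓝 t) :=
    (tendsto_add_atTop_iff_nat (f := τ ∘ ns) N).2 hτ'.1
  obtain ⟨ms, hms, hae⟩ := exists_subseq_ae_tendsto (fun n => h.integrable _ (hmem n))
    (h.integrable t ht) ((h.tendsto t ht).comp
      (tendsto_nhdsWithin_iff.2 ⟨hlim, Eventually.of_forall hmem⟩))
  refine ⟨fun n => ms n + N, ?_⟩
  refine tendsto_integral_of_dominated_convergence ((Icc a b).indicator fun _ => C) (fun n => ?_)
    ((integrable_indicator_iff measurableSet_Icc).2 (integrableOn_const (by simp)))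
    (fun n => ?_) ?_
  · exact (hΦ.measurable.comp_aemeasurable ((h.integrable _ (hmem _)).aemeasurable.prodMk
      (aemeasurable_const.prodMk aemeasurable_id))).aestronglyMeasurable
  · filter_upwards [h.bound _ (hmem (ms n))] with x hx
    by_cases hxm : x ∈ Icc a b
    · rw [indicator_of_mem hxm]
      exact hC _ ⟨abs_le.1 hx, hmem _, hxm⟩
    · rw [indicator_of_notMem hxm, hz _ _ (hmem _) x hxm, norm_zero]
  · filter_upwards [hae] with x hx
    exact (hΦ.tendsto _).comp (hx.prodMk_nhds
      ((hlim.comp hms.tendsto_atTop).prodMk_nhds tendsto_const_nhds))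

lemma integrable_comp (h : EntropySlab u s t₀ t₁ M) {Φ : ℝ × ℝ → ℝ}
    (hΦ : Continuous Φ) {a b : ℝ} (hz : ∀ ω, ∀ x, x ∉ Icc a b → Φ (ω, x) = 0) {t : ℝ}
    (ht : t ∈ Icc t₀ t₁) : Integrable fun x => Φ (u t x, x) := by
  obtain ⟨C, hC⟩ := ((isCompact_Icc (a := -M) (b := M)).prod
    (isCompact_Icc (a := a) (b := b))).exists_bound_of_continuousOn hΦ.continuousOn
  refine Integrable.mono' ((integrable_indicator_iff measurableSet_Icc).2
    (integrableOn_const (by simp)) : Integrable ((Icc a b).indicator fun _ => C))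
    (hΦ.measurable.comp_aemeasurable
      ((h.integrable _ ht).aemeasurable.prodMk aemeasurable_id)).aestronglyMeasurable ?_
  filter_upwards [h.bound t ht] with x hx
  by_cases hxm : x ∈ Icc a b
  · rw [indicator_of_mem hxm]
    exact hC _ ⟨abs_le.1 hx, hxm⟩
  · rw [indicator_of_notMem hxm, hz _ x hxm, norm_zero]

/-- Comparison with a `C¹` supersolution in a truncated cone. -/
lemma le_of_supersolution (h : EntropySlab u s t₀ t₁ M) {v : ℝ × ℝ → ℝ} (hv : ContDiff ℝ 1 v)
    {c r L B : ℝ} (hr : 0 < r) (hML : M ≤ L)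
    (hsup : ∀ p : ℝ × ℝ, p.1 ∈ Ioo t₀ t₁ →
      s p ≤ fderiv ℝ v p (1, 0) + v p * fderiv ℝ v p (0, 1))
    (hlow : ∀ p : ℝ × ℝ, p.1 ∈ Ioo t₀ t₁ → |p.2 - c| < r → -L ≤ v p)
    (hB : ∀ p : ℝ × ℝ, p.1 ∈ Ioo t₀ t₁ → |fderiv ℝ v p (0, 1)| ≤ B)
    (hinit : ∀ᵐ x, |x - c| < r → u t₀ x ≤ v (t₀, x)) {t : ℝ} (ht : t ∈ Ico t₀ t₁) :
    ∀ᵐ x, (x - c) ^ 2 < r ^ 2 - 2 * r * L * (t - t₀) → u t x ≤ v (t, x) := by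
  obtain ⟨U, hU, hUM, hUu, hent⟩ := h.exists_rep
  have hL0 : 0 ≤ L := (abs_nonneg _).trans ((hUM (0, 0)).trans hML)
  have ht01 : t₀ < t₁ := ht.1.trans_lt ht.2
  -- The set `ψ > 0` lies in `|x - c| < r` and shrinks with time. There `ψ_t = -2rL` dominates the
  -- flux contribution `2 |speed| |x - c|` for speeds up to `L`.
  let ψ : ℝ × ℝ → ℝ := fun p => r ^ 2 - (p.2 - c) ^ 2 - 2 * r * L * (p.1 - t₀)
  have hψ : ContDiff ℝ 1 ψ := by fun_prop
  have hψc : Continuous ψ := hψ.continuous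
  -- The rate `3B` absorbs the term `v_x w⁴/4 = 3 v_x · w⁴/12` of the relative entropy inequality.
  let η : ℝ × ℝ → ℝ := fun p => Real.exp (-(3 * B) * p.1) * (max (ψ p) 0) ^ 2
  have hη : ContDiff ℝ 1 η :=
    ContDiff.mul (by fun_prop) (contDiff_max_zero_sq.comp hψ)
  have hηc : Continuous η := hη.continuous
  have hψr : ∀ p : ℝ × ℝ, t₀ ≤ p.1 → 0 < ψ p → |p.2 - c| < r := fun p hp hpos => by
    have : 0 ≤ 2 * r * L * (p.1 - t₀) := mul_nonneg (by positivity) (sub_nonneg.2 hp)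
    refine abs_lt_of_sq_lt_sq ?_ hr.le
    simp only [ψ] at hpos
    linarith
  have hηz' : ∀ p : ℝ × ℝ, t₀ ≤ p.1 → ¬ |p.2 - c| < r → η p = 0 := fun p hp hpn => by
    have : ψ p ≤ 0 := by
      by_contra! hpos
      exact hpn (hψr p hp hpos)
    simp [η, max_eq_right this]
  have hηz : ∀ p : ℝ × ℝ, t₀ ≤ p.1 → p.2 ∉ Icc (c - r) (c + r) → η p = 0 := fun p hp hpn =>
    hηz' p hp fun hlt => hpn ⟨by linarith [(abs_lt.1 hlt).1], by linarith [(abs_lt.1 hlt).2]⟩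
  have hvc := hv.continuous
  have hvx : Continuous fun p => fderiv ℝ v p (0, 1) :=
    (hv.continuous_fderiv one_ne_zero).clm_apply continuous_const
  have hvt : Continuous fun p => fderiv ℝ v p (1, 0) :=
    (hv.continuous_fderiv one_ne_zero).clm_apply continuous_const
  -- The localised relative entropy: it is non-negative, vanishes at `t₀` and turns out to be
  -- non-increasing, so it is zero.
  let F : ℝ → ℝ := fun t => ∫ x, (max (u t x - v (t, x)) 0) ^ 4 / 12 * η (t, x)
  have hFc : ContinuousOn F (Icc t₀ t₁) := by
    refine h.continuousOn_integral
      (Φ := fun q => (max (q.1 - v q.2) 0) ^ 4 / 12 * η q.2) (by fun_prop)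
      (a := c - r) (b := c + r) fun ω t ht x hx => ?_
    simp [hηz (t, x) ht.1 hx]
  have hF0 : ∀ t, 0 ≤ F t := fun t => integral_nonneg fun x => by positivity
  have hFinit : F t₀ = 0 := by
    refine integral_eq_zero_of_ae ?_
    filter_upwards [hinit] with x hx
    by_cases hxr : |x - c| < r
    · simp [max_eq_right (sub_nonpos.2 (hx hxr))]
    · simp [hηz' (t₀, x) le_rfl hxr]
  have hFanti : AntitoneOn F (Ico t₀ t₁) := by
    refine antitoneOn_of_integral_mul_deriv_nonneg (hFc.mono Ico_subset_Icc_self)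
      fun θ hθ hθc hθs hθ0 => ?_
    let φ : ℝ × ℝ → ℝ := fun p => θ p.1 * η p
    have hφ : ContDiff ℝ 1 φ := (hθ.comp contDiff_fst).mul hη
    have hθK : IsCompact (tsupport θ) := hθc
    set K : Set (ℝ × ℝ) := tsupport θ ×ˢ Icc (c - r) (c + r) with hK
    have hKc : IsCompact K := hθK.prod isCompact_Icc
    have hφz : ∀ p, p ∉ K → φ p = 0 := fun p hp => by
      by_cases h1 : p.1 ∈ tsupport θ
      · simp only [φ]
        rw [hηz p (hθs h1).1.le fun h2 => hp ⟨h1, h2⟩, mul_zero]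
      · simp [φ, image_eq_zero_of_notMem_tsupport h1]
    have hφs : tsupport φ ⊆ K :=
      closure_minimal (fun p hp => by by_contra hn; exact hp (hφz p hn)) hKc.isClosed
    have hφc : HasCompactSupport φ :=
      HasCompactSupport.of_support_subset_isCompact hKc (subset_closure.trans hφs)
    have hφ0 : ∀ p, 0 ≤ φ p := fun p => mul_nonneg (hθ0 _) (by positivity)
    have hrel := relative_entropy_nonneg hU hUM h.continuous_source hent hv hφ hφc
      (hφs.trans (Set.prod_mono hθs (subset_univ _))) hφ0
    have hθd := hθ.differentiable one_ne_zero
    have hexp : ∀ t : ℝ, HasDerivAt (fun t : ℝ => Real.exp (-(3 * B) * t))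
        (-(3 * B) * Real.exp (-(3 * B) * t)) t := fun t => by
      have h1 : HasDerivAt (fun t : ℝ => -(3 * B) * t) (-(3 * B)) t := by
        simpa using (hasDerivAt_id t).const_mul (-(3 * B))
      exact h1.exp.congr_deriv (mul_comm _ _)
    have hφt : ∀ p, fderiv ℝ φ p (1, 0) = deriv θ p.1 * η p + θ p.1 *
        (-(3 * B) * Real.exp (-(3 * B) * p.1) * (max (ψ p) 0) ^ 2 +
          Real.exp (-(3 * B) * p.1) * (2 * max (ψ p) 0 * (-(2 * r * L)))) := fun p => by
      refine fderiv_one_zero (hφ.differentiable one_ne_zero p) ?_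
      have h1 : HasDerivAt (fun t : ℝ => ψ (t, p.2)) (-(2 * r * L)) p.1 := by
        simp only [ψ]
        have := (((hasDerivAt_id p.1).sub_const t₀).const_mul (2 * r * L)).const_sub
          (r ^ 2 - (p.2 - c) ^ 2)
        simpa using this
      have h2 := (hasDerivAt_max_zero_sq (ψ p)).comp p.1 h1
      exact (hθd p.1).hasDerivAt.mul ((hexp p.1).mul h2)
    have hφx : ∀ p, fderiv ℝ φ p (0, 1) = θ p.1 * (Real.exp (-(3 * B) * p.1) *
          (2 * max (ψ p) 0 * (-(2 * (p.2 - c))))) := fun p => by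
      refine fderiv_zero_one (hφ.differentiable one_ne_zero p) ?_
      have h1 : HasDerivAt (fun x : ℝ => ψ (p.1, x)) (-(2 * (p.2 - c))) p.2 := by
        simp only [ψ]
        have h0 : HasDerivAt (fun x : ℝ => x - c) 1 p.2 := (hasDerivAt_id p.2).sub_const c
        have := ((h0.pow 2).const_sub (r ^ 2)).sub_const (2 * r * L * (p.1 - t₀))
        exact this.congr_deriv (by simp)
      have h2 := (hasDerivAt_max_zero_sq (ψ p)).comp p.2 h1
      exact (h2.const_mul (Real.exp (-(3 * B) * p.1))).const_mul (θ p.1)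
    have hdφ : ∀ e, Continuous fun p => fderiv ℝ φ p e := fun e =>
      (hφ.continuous_fderiv one_ne_zero).clm_apply continuous_const
    have hθ'c : Continuous (deriv θ) := hθ.continuous_deriv le_rfl
    have hscont := h.continuous_source
    have hφcont := hφ.continuous
    have hJi : Integrable fun p => (max (U p - v p) 0) ^ 4 / 12 * η p * deriv θ p.1 := by
      refine integrable_comp_of_bounded hU hUM (F := fun q =>
        (max (q.1 - v q.2) 0) ^ 4 / 12 * η q.2 * deriv θ q.2.1) (by fun_prop) hKc
        fun ω p hp => ?_
      by_cases h1 : p.1 ∈ tsupport θ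
      · simp [hηz p (hθs h1).1.le fun h2 => hp ⟨h1, h2⟩]
      · have : deriv θ p.1 = 0 := by
          by_contra hn
          exact h1 (support_deriv_subset hn)
        simp [this]
    have hIi : Integrable fun p => ((max (U p - v p) 0) ^ 4 / 12 * fderiv ℝ φ p (1, 0)
      + (v p * (max (U p - v p) 0) ^ 4 / 12 + (max (U p - v p) 0) ^ 5 / 15) * fderiv ℝ φ p (0, 1)
      - φ p * ((max (U p - v p) 0) ^ 3 / 3 *
          (fderiv ℝ v p (1, 0) + v p * fderiv ℝ v p (0, 1) - s p)
        + fderiv ℝ v p (0, 1) * ((max (U p - v p) 0) ^ 4 / 4))) := by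
      have c0 : ∀ e, Continuous fun q : ℝ × (ℝ × ℝ) => fderiv ℝ φ q.2 e := fun e =>
        (hdφ e).comp continuous_snd
      have c1 : Continuous fun q : ℝ × (ℝ × ℝ) => fderiv ℝ v q.2 (1, 0) := hvt.comp continuous_snd
      have c2 : Continuous fun q : ℝ × (ℝ × ℝ) => fderiv ℝ v q.2 (0, 1) := hvx.comp continuous_snd
      have c3 := c0 (1, 0)
      have c4 := c0 (0, 1)
      refine integrable_comp_of_bounded hU hUM (F := fun q =>
        ((max (q.1 - v q.2) 0) ^ 4 / 12 * fderiv ℝ φ q.2 (1, 0)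
        + (v q.2 * (max (q.1 - v q.2) 0) ^ 4 / 12 + (max (q.1 - v q.2) 0) ^ 5 / 15) *
          fderiv ℝ φ q.2 (0, 1)
        - φ q.2 * ((max (q.1 - v q.2) 0) ^ 3 / 3 *
          (fderiv ℝ v q.2 (1, 0) + v q.2 * fderiv ℝ v q.2 (0, 1) - s q.2)
        + fderiv ℝ v q.2 (0, 1) * ((max (q.1 - v q.2) 0) ^ 4 / 4)))) (by fun_prop) hKc
        fun ω p hp => ?_
      have hp' : p ∉ tsupport φ := fun h => hp (hφs h)
      simp [fderiv_apply_eq_zero_of_notMem hp', hφz p hp]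
    have hle : ∫ p, ((max (U p - v p) 0) ^ 4 / 12 * fderiv ℝ φ p (1, 0)
      + (v p * (max (U p - v p) 0) ^ 4 / 12 + (max (U p - v p) 0) ^ 5 / 15) * fderiv ℝ φ p (0, 1)
      - φ p * ((max (U p - v p) 0) ^ 3 / 3 *
          (fderiv ℝ v p (1, 0) + v p * fderiv ℝ v p (0, 1) - s p)
        + fderiv ℝ v p (0, 1) * ((max (U p - v p) 0) ^ 4 / 4))) ≤
        ∫ p, (max (U p - v p) 0) ^ 4 / 12 * η p * deriv θ p.1 := by
      refine integral_mono hIi hJi fun p => ?_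
      by_cases hp1 : p.1 ∈ tsupport θ
      · have hp := hθs hp1
        rcases le_or_gt (U p) (v p) with hle | hlt
        · simp [max_eq_right (sub_nonpos.2 hle)]
        · have hw0 : 0 < U p - v p := sub_pos.2 hlt
          have hsup' := hsup p hp
          have hB' := abs_le.1 (hB p hp)
          have hU' := abs_le.1 (hUM p)
          rw [hφt, hφx]
          simp only [φ, η, max_eq_left hw0.le]
          set w := U p - v p with hw
          set E := Real.exp (-(3 * B) * p.1) with hE
          have hE0 : 0 < E := Real.exp_pos _
          have hth := hθ0 p.1
          set m := max (ψ p) 0 with hm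
          have hm0 : 0 ≤ m := le_max_right _ _
          have k1 : 0 ≤ θ p.1 * E * m ^ 2 * (w ^ 3 / 3) *
              (fderiv ℝ v p (1, 0) + v p * fderiv ℝ v p (0, 1) - s p) :=
            mul_nonneg (by positivity) (by linarith)
          have k2 : 0 ≤ θ p.1 * E * m ^ 2 * (w ^ 4 / 4) * (fderiv ℝ v p (0, 1) + B) :=
            mul_nonneg (by positivity) (by linarith)
          have k3 : 0 ≤ θ p.1 * E * (w ^ 4 / 12) *
              (m * (4 * r * L + (v p + 4 / 5 * w) * (4 * (p.2 - c)))) := by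
            refine mul_nonneg (by positivity) ?_
            rcases hm0.eq_or_lt with h0 | hpos
            · rw [← h0, zero_mul]
            · refine mul_nonneg hm0 ?_
              have hψpos : 0 < ψ p := by
                by_contra! hn
                rw [hm, max_eq_right hn] at hpos
                exact lt_irrefl _ hpos
              have hxr := hψr p hp.1.le hψpos
              have hlow' := hlow p hp hxr
              -- The relative flux is `w⁴/12` times `v + 4w/5`, because `(1/15) / (1/12) = 4/5`.
              -- This speed is `v/5 + 4U/5`, a value between `v ≥ -L` and `U ≤ L`; thus no separate
              -- upper bound on `v` is needed.
              have hq : |v p + 4 / 5 * w| ≤ L := by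
                rw [abs_le]; constructor <;> linarith
              have := mul_le_mul hq hxr.le (abs_nonneg _) hL0
              rw [← abs_mul] at this
              have := (abs_le.1 this).1
              linarith
          nlinarith [k1, k2, k3]
      · have h1 : deriv θ p.1 = 0 := by
          by_contra hn
          exact hp1 (support_deriv_subset hn)
        have hp' : p ∉ tsupport φ := fun h => hp1 (hφs h).1
        simp [fderiv_apply_eq_zero_of_notMem hp', image_eq_zero_of_notMem_tsupport hp', h1]
    have hJ := hrel.trans hle
    rw [Measure.volume_eq_prod] at hJ hJi
    rw [integral_prod _ hJi] at hJ
    refine hJ.trans_eq (integral_congr_ae ?_)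
    filter_upwards [ae_ae_of_ae_restrict (measurableSet_Ioo.prod MeasurableSet.univ) hUu] with t ht
    by_cases htm : t ∈ Ioo t₀ t₁
    · simp only [F]
      rw [← integral_mul_const]
      refine integral_congr_ae ?_
      filter_upwards [ht] with x hx
      rw [hx ⟨htm, mem_univ _⟩]
    · have h1 : deriv θ t = 0 := by
        by_contra hn
        exact htm (hθs (support_deriv_subset hn))
      simp [h1]
  have hFt : F t = 0 :=
    le_antisymm ((hFanti ⟨le_rfl, ht01⟩ ht ht.1).trans_eq hFinit) (hF0 t)
  have hti : Integrable fun x => (max (u t x - v (t, x)) 0) ^ 4 / 12 * η (t, x) :=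
    h.integrable_comp (Φ := fun q => (max (q.1 - v (t, q.2)) 0) ^ 4 / 12 * η (t, q.2))
      (by fun_prop) (a := c - r) (b := c + r) (fun ω x hx => by simp [hηz (t, x) ht.1 hx])
      ⟨ht.1, ht.2.le⟩
  have := (integral_eq_zero_iff_of_nonneg (fun x => by positivity) hti).1 hFt
  filter_upwards [this] with x hx hxr
  have hψpos : 0 < ψ (t, x) := by simp only [ψ]; linarith
  have hηpos : 0 < η (t, x) := by
    simp only [η, max_eq_left hψpos.le]
    positivity
  by_contra! hlt
  have : 0 < (max (u t x - v (t, x)) 0) ^ 4 / 12 * η (t, x) := by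
    rw [max_eq_left (sub_pos.2 hlt).le]
    have := sub_pos.2 hlt
    positivity
  exact this.ne' hx

end EntropySlab

/-! ### Source terms extended in time and trajectories of `Z'' = S(t, Z)`. -/

/-- The projection of the line onto `[t₀, t₁]`. -/
def clamp (t₀ t₁ t : ℝ) : ℝ := max t₀ (min t₁ t)

@[fun_prop]
lemma continuous_clamp (t₀ t₁ : ℝ) : Continuous (clamp t₀ t₁) := by
  unfold clamp
  fun_prop

lemma clamp_mem {t₀ t₁ : ℝ} (h : t₀ ≤ t₁) (t : ℝ) : clamp t₀ t₁ t ∈ Icc t₀ t₁ :=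
  ⟨le_max_left _ _, max_le h (min_le_left _ _)⟩

lemma clamp_of_mem {t₀ t₁ t : ℝ} (h : t ∈ Icc t₀ t₁) : clamp t₀ t₁ t = t := by
  rw [clamp, min_eq_right h.2, max_eq_right h.1]

namespace IsWeakEntropySolution
variable {ubar : ℝ → ℝ} {u : ℝ → ℝ → ℝ}

/-- The source is continuous only for `t ≥ 0`, whereas `EntropySlab` and the solver of the second
order equation ask for a globally continuous one. -/
lemma continuous_source_clamp (hu : IsWeakEntropySolution ubar u) {t₀ t₁ : ℝ} (h0 : 0 ≤ t₀)
    (h01 : t₀ ≤ t₁) : Continuous fun p : ℝ × ℝ => source (u (clamp t₀ t₁ p.1)) p.2 :=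
  hu.continuousOn_source.comp_continuous
    (f := fun p : ℝ × ℝ => (clamp t₀ t₁ p.1, p.2)) (by fun_prop)
    fun p => ⟨h0.trans (clamp_mem h01 _).1, mem_univ _⟩

lemma continuous_potential_clamp (hu : IsWeakEntropySolution ubar u) {t₀ t₁ : ℝ} (h0 : 0 ≤ t₀)
    (h01 : t₀ ≤ t₁) : Continuous fun p : ℝ × ℝ => potential (u (clamp t₀ t₁ p.1)) p.2 :=
  hu.continuousOn_potential.comp_continuous
    (f := fun p : ℝ × ℝ => (clamp t₀ t₁ p.1, p.2)) (by fun_prop)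
    fun p => ⟨h0.trans (clamp_mem h01 _).1, mem_univ _⟩

lemma entropySlab (hu : IsWeakEntropySolution ubar u) {t₀ t₁ M : ℝ} (h0 : 0 < t₀)
    (h01 : t₀ ≤ t₁) (hM : ∀ t ∈ Icc t₀ t₁, ∀ᵐ x, |u t x| ≤ M) :
    EntropySlab u (fun p => source (u (clamp t₀ t₁ p.1)) p.2) t₀ t₁ M where
  integrable t ht := hu.integrable t (h0.le.trans ht.1)
  bound := hM
  tendsto t ht := (hu.continuous t (h0.le.trans ht.1)).mono_left
    (nhdsWithin_mono _ fun s hs => h0.le.trans hs.1)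
  continuous_source := hu.continuous_source_clamp h0.le h01
  exists_rep := by
    have hO : MeasurableSet (Ioo t₀ t₁ ×ˢ (univ : Set ℝ)) :=
      measurableSet_Ioo.prod MeasurableSet.univ
    have hm := (hu.aestronglyMeasurable (S := Ioo t₀ t₁ ×ˢ univ) (Set.prod_mono
      (fun t ht => h0.le.trans ht.1.le) le_rfl)).aemeasurable
    obtain ⟨g, hg, hug⟩ := id hm
    have hM0 : 0 ≤ M := by
      obtain ⟨x, hx⟩ := (hM t₀ ⟨le_rfl, h01⟩).exists
      exact (abs_nonneg _).trans hx
    have hb : ∀ᵐ p : ℝ × ℝ ∂(volume.restrict (Ioo t₀ t₁ ×ˢ univ)), |u p.1 p.2| ≤ M := by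
      refine ae_restrict_of_ae_slice hO hm (Q := fun _ y => |y| ≤ M) ?_ (ae_of_all _ fun t => ?_)
      · have h1 : MeasurableSet {q : (ℝ × ℝ) × ℝ | q.1 ∈ Ioo t₀ t₁ ×ˢ (univ : Set ℝ)} :=
          hO.preimage measurable_fst
        have h2 : MeasurableSet {q : (ℝ × ℝ) × ℝ | |q.2| ≤ M} :=
          measurableSet_le (by fun_prop) measurable_const
        convert h1.compl.union h2 using 1
        ext q
        simp only [mem_ofPred_eq, mem_union, mem_compl_iff]
        tauto
      · by_cases ht : t ∈ Ioo t₀ t₁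
        · filter_upwards [hM t ⟨ht.1.le, ht.2.le⟩] with x hx _ using hx
        · exact ae_of_all _ fun x hx => (ht hx.1).elim
    have hUu : ∀ᵐ p : ℝ × ℝ ∂(volume.restrict (Ioo t₀ t₁ ×ˢ univ)),
        u p.1 p.2 = max (-M) (min M (g p)) := by
      filter_upwards [hug, hb] with p hp hpb
      rw [← hp, min_eq_right (abs_le.1 hpb).2, max_eq_right (abs_le.1 hpb).1]
    refine ⟨fun p => max (-M) (min M (g p)), by fun_prop, fun p => abs_le.2
      ⟨le_max_left _ _, max_le (by linarith) (min_le_left _ _)⟩, hUu, fun k φ hφ hc hs hp0 => ?_⟩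
    refine (hu.entropy_univ k hφ hc (hs.trans (Set.prod_mono (fun t ht => h0.trans ht.1) le_rfl))
      hp0).trans_eq (integral_congr_ae ?_)
    rw [ae_restrict_iff' hO] at hUu
    filter_upwards [hUu] with p hp
    by_cases hpt : p ∈ tsupport φ
    · have hpO := hs hpt
      rw [kruzhkov, ← hp hpO, clamp_of_mem ⟨hpO.1.1.le, hpO.1.2.le⟩]
    · simp [kruzhkov, fderiv_apply_eq_zero_of_notMem hpt, image_eq_zero_of_notMem_tsupport hpt]

end IsWeakEntropySolution

/-- Grönwall's inequality for a second order system. -/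
lemma abs_le_of_second_order {Z V A : ℝ → ℝ} {a b Λ δ ε : ℝ} (hΛ : 1 ≤ Λ) (hε : 0 ≤ ε)
    (hZc : ContinuousOn Z (Icc a b)) (hVc : ContinuousOn V (Icc a b))
    (hZ : ∀ t ∈ Ico a b, HasDerivWithinAt Z (V t) (Ici t) t)
    (hV : ∀ t ∈ Ico a b, HasDerivWithinAt V (A t) (Ici t) t)
    (hA : ∀ t ∈ Ico a b, |A t| ≤ Λ * |Z t| + ε) (hZa : |Z a| ≤ δ) (hVa : |V a| ≤ δ)
    {t : ℝ} (ht : t ∈ Icc a b) :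
    |Z t| ≤ (δ + ε) * Real.exp (Λ * (t - a)) ∧ |V t| ≤ (δ + ε) * Real.exp (Λ * (t - a)) := by
  have h := norm_le_gronwallBound_of_norm_deriv_right_le (f := fun t => (Z t, V t))
    (f' := fun t => (V t, A t)) (δ := δ) (K := Λ) (ε := ε) (hZc.prodMk hVc)
    (fun t ht => (hZ t ht).prodMk (hV t ht)) (max_le hZa hVa) (fun t ht => by
      have h1 : |Z t| ≤ ‖(Z t, V t)‖ := norm_fst_le (Z t, V t)
      have h2 : |V t| ≤ ‖(Z t, V t)‖ := norm_snd_le (Z t, V t)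
      refine max_le ?_ ?_
      · calc |V t| ≤ 1 * ‖(Z t, V t)‖ + 0 := by linarith
          _ ≤ Λ * ‖(Z t, V t)‖ + ε := by gcongr
      · calc |A t| ≤ Λ * |Z t| + ε := hA t ht
          _ ≤ Λ * ‖(Z t, V t)‖ + ε := by gcongr) t ht
  have hb : gronwallBound δ Λ ε (t - a) ≤ (δ + ε) * Real.exp (Λ * (t - a)) := by
    rw [gronwallBound_of_K_ne_0 (by linarith)]
    have he : 1 ≤ Real.exp (Λ * (t - a)) :=
      Real.one_le_exp (mul_nonneg (by linarith) (sub_nonneg.2 ht.1))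
    have h1 : ε / Λ ≤ ε := div_le_self hε hΛ
    have h2 : ε / Λ * (Real.exp (Λ * (t - a)) - 1) ≤ ε * (Real.exp (Λ * (t - a)) - 1) :=
      mul_le_mul_of_nonneg_right h1 (by linarith)
    simp only
    linarith
  exact ⟨(norm_fst_le (Z t, V t)).trans (h.trans hb), (norm_snd_le (Z t, V t)).trans (h.trans hb)⟩

lemma exp_le_two_of_le_half {x : ℝ} (h : x ≤ 1 / 2) : Real.exp x ≤ 2 := by
  have h1 : Real.exp x * Real.exp x ≤ 2 * 2 := by
    rw [← Real.exp_add]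
    refine (Real.exp_le_exp.2 (by linarith : x + x ≤ 1)).trans ?_
    linarith [Real.exp_one_lt_d9]
  nlinarith [Real.exp_pos x]

/-- Solvability of `Z'' = S(t, Z)` on a short time interval; the solution is extended to a
globally defined twice differentiable function. -/
lemma exists_second_order {S : ℝ × ℝ → ℝ} (hS : Continuous S) {t₀ τ Λ : ℝ} (hτ : 0 ≤ τ)
    (hΛ : 1 ≤ Λ) (hΛτ : Λ * τ ≤ 1 / 2)
    (hL : ∀ t ∈ Icc t₀ (t₀ + τ), ∀ x y, |S (t, x) - S (t, y)| ≤ Λ * |x - y|) (z w : ℝ) :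
    ∃ Z V A : ℝ → ℝ, Continuous A ∧ (∀ t, HasDerivAt Z (V t) t) ∧ (∀ t, HasDerivAt V (A t) t) ∧
      Z t₀ = z ∧ V t₀ = w ∧ ∀ t ∈ Icc t₀ (t₀ + τ), A t = S (t, Z t) := by
  have h01 : t₀ ≤ t₀ + τ := by linarith
  obtain ⟨m, hm⟩ := (isCompact_Icc (a := t₀) (b := t₀ + τ)).exists_bound_of_continuousOn
    (f := fun t => S (t, z)) (by fun_prop)
  have hm0 : 0 ≤ m := (norm_nonneg _).trans (hm t₀ ⟨le_rfl, h01⟩)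
  set F : ℝ → ℝ × ℝ → ℝ × ℝ := fun t q => (q.2, S (t, q.1)) with hF
  -- Radius of the ball for the Picard iteration: the field is at most `m + |w| + Λ a` on it, and `Λ
  -- τ ≤ 1/2` gives `(m + |w| + Λ a) τ ≤ a/2 + a/2`.
  set a : ℝ := 2 * (m + |w|) * τ with ha
  have ha0 : 0 ≤ a := by positivity
  have hPL : IsPicardLindelof F (tmin := t₀) (tmax := t₀ + τ) ⟨t₀, le_rfl, h01⟩ (z, w)
      ⟨a, ha0⟩ 0 ⟨m + |w| + Λ * a, by positivity⟩ ⟨Λ, by linarith⟩ := by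
    refine ⟨fun t ht => (LipschitzWith.of_dist_le_mul fun q q' => ?_).lipschitzOnWith,
      fun q hq => ?_, fun t ht q hq => ?_, ?_⟩
    · refine max_le ?_ ?_
      · refine (le_max_right (dist q.1 q'.1) _).trans ?_
        exact le_mul_of_one_le_left (dist_nonneg (x := q) (y := q')) hΛ
      · refine (hL t ht q.1 q'.1).trans ?_
        exact mul_le_mul_of_nonneg_left (le_max_left _ _) (by linarith)
    · simp only [hF]
      fun_prop
    · have h1 : |q.1 - z| ≤ a := (le_max_left _ _).trans (Metric.mem_closedBall.1 hq)
      have h2 : |q.2 - w| ≤ a := (le_max_right _ _).trans (Metric.mem_closedBall.1 hq)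
      refine max_le ?_ ?_
      · have h3 : |q.2| ≤ |q.2 - w| + |w| := by
          simpa using abs_add_le (q.2 - w) w
        have h4 : a ≤ Λ * a := le_mul_of_one_le_left ha0 hΛ
        change |q.2| ≤ m + |w| + Λ * a
        linarith
      · have h3 : |S (t, q.1)| ≤ |S (t, q.1) - S (t, z)| + |S (t, z)| := by
          simpa using abs_add_le (S (t, q.1) - S (t, z)) (S (t, z))
        have h4 := hm t ht
        rw [Real.norm_eq_abs] at h4
        have h5 : Λ * |q.1 - z| ≤ Λ * a := by gcongr
        change |S (t, q.1)| ≤ m + |w| + Λ * a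
        linarith [hL t ht q.1 z, abs_nonneg w]
    · change (m + |w| + Λ * a) * max (t₀ + τ - t₀) (t₀ - t₀) ≤ a - 0
      rw [add_sub_cancel_left, sub_self, max_eq_left hτ, sub_zero]
      nlinarith [mul_le_mul_of_nonneg_left hΛτ ha0]
  obtain ⟨α, hα0, hα⟩ := hPL.exists_eq_forall_mem_Icc_hasDerivWithinAt₀
  have hαc : ContinuousOn α (Icc t₀ (t₀ + τ)) := fun t ht => (hα t ht).continuousWithinAt
  have hα1 : ∀ t ∈ Icc t₀ (t₀ + τ), HasDerivWithinAt (fun t => (α t).1) (α t).2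
      (Icc t₀ (t₀ + τ)) t := fun t ht =>
    (hasFDerivAt_fst (𝕜 := ℝ) (p := α t)).comp_hasDerivWithinAt t (hα t ht)
  have hα2 : ∀ t ∈ Icc t₀ (t₀ + τ), HasDerivWithinAt (fun t => (α t).2) (S (t, (α t).1))
      (Icc t₀ (t₀ + τ)) t := fun t ht =>
    (hasFDerivAt_snd (𝕜 := ℝ) (p := α t)).comp_hasDerivWithinAt t (hα t ht)
  -- The position is frozen outside the interval, so `A` is continuous on the whole line. `V` and
  -- `Z` are its successive primitives, hence differentiable everywhere; they agree with the Picard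
  -- solution on the interval.
  set A : ℝ → ℝ := fun t => S (t, (α (clamp t₀ (t₀ + τ) t)).1) with hA
  have hAc : Continuous A := by
    have h1 : Continuous fun t => (α (clamp t₀ (t₀ + τ) t)).1 :=
      continuous_fst.comp (hαc.comp_continuous (continuous_clamp _ _) fun t => clamp_mem h01 t)
    fun_prop
  set V : ℝ → ℝ := fun t => w + ∫ σ in t₀..t, A σ with hV
  have hV' : ∀ t, HasDerivAt V (A t) t := fun t =>
    (hAc.integral_hasStrictDerivAt t₀ t).hasDerivAt.const_add w
  have hVc : Continuous V := continuous_iff_continuousAt.2 fun t => (hV' t).continuousAt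
  set Z : ℝ → ℝ := fun t => z + ∫ σ in t₀..t, V σ with hZ
  have hZ' : ∀ t, HasDerivAt Z (V t) t := fun t =>
    (hVc.integral_hasStrictDerivAt t₀ t).hasDerivAt.const_add z
  have hVα : ∀ t ∈ Icc t₀ (t₀ + τ), V t = (α t).2 := by
    refine eq_of_has_deriv_right_eq (f' := fun t => S (t, (α t).1)) (fun t ht => ?_)
      (fun t ht => ?_) (fun t ht => (hV' t).continuousAt.continuousWithinAt)
      (continuous_snd.comp_continuousOn hαc) ?_
    · have := (hV' t).hasDerivWithinAt (s := Ici t)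
      simp only [hA] at this
      rwa [clamp_of_mem ⟨ht.1, ht.2.le⟩] at this
    · exact (hα2 t ⟨ht.1, ht.2.le⟩).mono_of_mem_nhdsWithin
        (Icc_mem_nhdsGE_of_mem ht)
    · simp [hV, hα0]
  have hZα : ∀ t ∈ Icc t₀ (t₀ + τ), Z t = (α t).1 := by
    refine eq_of_has_deriv_right_eq (f' := fun t => (α t).2) (fun t ht => ?_)
      (fun t ht => ?_) (fun t ht => (hZ' t).continuousAt.continuousWithinAt)
      (continuous_fst.comp_continuousOn hαc) ?_
    · have := (hZ' t).hasDerivWithinAt (s := Ici t)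
      rwa [hVα t ⟨ht.1, ht.2.le⟩] at this
    · exact (hα1 t ⟨ht.1, ht.2.le⟩).mono_of_mem_nhdsWithin
        (Icc_mem_nhdsGE_of_mem ht)
    · simp [hZ, hα0]
  refine ⟨Z, V, A, hAc, hZ', hV', by simp [hZ], by simp [hV], fun t ht => ?_⟩
  simp only [hA]
  rw [clamp_of_mem ht, hZα t ht]

/-- `Z` solves `Z'' = S(t, Z)` on `[t₀, t₁]`, with velocity `V` and acceleration `A`. -/
structure IsTrajectory (S : ℝ × ℝ → ℝ) (t₀ t₁ : ℝ) (Z V A : ℝ → ℝ) : Prop where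
  continuous_acc : Continuous A
  hasDerivAt_pos : ∀ t, HasDerivAt Z (V t) t
  hasDerivAt_vel : ∀ t, HasDerivAt V (A t) t
  acc_eq : ∀ t ∈ Icc t₀ t₁, A t = S (t, Z t)

namespace IsTrajectory
variable {S : ℝ × ℝ → ℝ} {t₀ t₁ : ℝ} {Z V A Z' V' A' : ℝ → ℝ}

lemma continuous_vel (h : IsTrajectory S t₀ t₁ Z V A) : Continuous V :=
  continuous_iff_continuousAt.2 fun t => (h.hasDerivAt_vel t).continuousAt

lemma continuous_pos (h : IsTrajectory S t₀ t₁ Z V A) : Continuous Z :=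
  continuous_iff_continuousAt.2 fun t => (h.hasDerivAt_pos t).continuousAt

lemma contDiff_vel (h : IsTrajectory S t₀ t₁ Z V A) : ContDiff ℝ 1 V :=
  contDiff_one_iff_deriv.2 ⟨fun t => (h.hasDerivAt_vel t).differentiableAt, by
    rw [funext fun t => (h.hasDerivAt_vel t).deriv]; exact h.continuous_acc⟩

lemma contDiff_pos (h : IsTrajectory S t₀ t₁ Z V A) : ContDiff ℝ 1 Z :=
  contDiff_one_iff_deriv.2 ⟨fun t => (h.hasDerivAt_pos t).differentiableAt, by
    rw [funext fun t => (h.hasDerivAt_pos t).deriv]; exact h.continuous_vel⟩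

lemma neg (h : IsTrajectory S t₀ t₁ Z V A) :
    IsTrajectory (fun p => -S (p.1, -p.2)) t₀ t₁ (fun t => -Z t) (fun t => -V t)
      (fun t => -A t) where
  continuous_acc := h.continuous_acc.neg
  hasDerivAt_pos t := (h.hasDerivAt_pos t).neg
  hasDerivAt_vel t := (h.hasDerivAt_vel t).neg
  acc_eq t ht := by simp [h.acc_eq t ht]

lemma abs_vel_sub_le (h : IsTrajectory S t₀ t₁ Z V A) {M : ℝ}
    (hM : ∀ t ∈ Icc t₀ t₁, |A t| ≤ M) {t : ℝ} (ht : t ∈ Icc t₀ t₁) :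
    |V t - V t₀| ≤ M * (t - t₀) := by
  have := (convex_Icc t₀ t₁).norm_image_sub_le_of_norm_hasDerivWithin_le (f := V) (f' := A)
    (fun s _ => (h.hasDerivAt_vel s).hasDerivWithinAt) hM ⟨le_rfl, ht.1.trans ht.2⟩ ht
  rwa [Real.norm_eq_abs, Real.norm_eq_abs, abs_of_nonneg (sub_nonneg.2 ht.1)] at this

/-- Two trajectories whose initial velocities are close separate at a controlled rate. -/
lemma abs_sub_le (h : IsTrajectory S t₀ t₁ Z V A) (h' : IsTrajectory S t₀ t₁ Z' V' A')
    {M K : ℝ} (hM : 1 ≤ M) (hK : 0 ≤ K)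
    (hL : ∀ t ∈ Icc t₀ t₁, ∀ x y, |S (t, x) - S (t, y)| ≤ M * |x - y|)
    (hτ : 4 * (K + 1 + M) * (t₁ - t₀) ≤ 1)
    (hV : |V' t₀ - V t₀| ≤ K * |Z' t₀ - Z t₀|) {t : ℝ} (ht : t ∈ Icc t₀ t₁) :
    |Z' t - Z t| ≤ 2 * (K + 1) * |Z' t₀ - Z t₀| ∧ |V' t - V t| ≤ 2 * (K + 1) * |Z' t₀ - Z t₀| ∧
      |Z' t - Z t - (Z' t₀ - Z t₀)| ≤ 1 / 2 * |Z' t₀ - Z t₀| := by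
  set d := |Z' t₀ - Z t₀| with hd
  have hd0 : 0 ≤ d := abs_nonneg _
  have h01 : 0 ≤ t₁ - t₀ := sub_nonneg.2 (ht.1.trans ht.2)
  have hg : ∀ t ∈ Icc t₀ t₁, |Z' t - Z t| ≤ 2 * (K + 1) * d ∧ |V' t - V t| ≤ 2 * (K + 1) * d := by
    intro t ht
    have h1 := abs_le_of_second_order (Z := fun t => Z' t - Z t) (V := fun t => V' t - V t)
      (A := fun t => A' t - A t) (a := t₀) (b := t₁) (δ := (K + 1) * d) hM le_rfl
      (h'.continuous_pos.sub h.continuous_pos).continuousOn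
      (h'.continuous_vel.sub h.continuous_vel).continuousOn
      (fun t _ => ((h'.hasDerivAt_pos t).sub (h.hasDerivAt_pos t)).hasDerivWithinAt)
      (fun t _ => ((h'.hasDerivAt_vel t).sub (h.hasDerivAt_vel t)).hasDerivWithinAt)
      (fun t ht => by
        rw [h'.acc_eq t ⟨ht.1, ht.2.le⟩, h.acc_eq t ⟨ht.1, ht.2.le⟩, add_zero]
        exact hL t ⟨ht.1, ht.2.le⟩ _ _) (by nlinarith) (by nlinarith) ht
    have h2 : Real.exp (M * (t - t₀)) ≤ 2 := exp_le_two_of_le_half <| by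
      have : M * (t - t₀) ≤ M * (t₁ - t₀) := by
        have := ht.2
        gcongr
      nlinarith
    have h3 : ((K + 1) * d + 0) * Real.exp (M * (t - t₀)) ≤ 2 * (K + 1) * d := by
      rw [add_zero]
      nlinarith [mul_nonneg (by linarith : 0 ≤ K + 1) hd0]
    exact ⟨h1.1.trans h3, h1.2.trans h3⟩
  refine ⟨(hg t ht).1, (hg t ht).2, ?_⟩
  -- The velocity gap `2 (K + 1) d` acts for a time at most `1 / (4 (K + 1))`, so the separation
  -- changes by at most half of its initial value. This is why trajectories do not cross.
  have := (convex_Icc t₀ t₁).norm_image_sub_le_of_norm_hasDerivWithin_le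
    (f := fun t => Z' t - Z t) (f' := fun t => V' t - V t) (C := 2 * (K + 1) * d)
    (fun s _ => ((h'.hasDerivAt_pos s).sub (h.hasDerivAt_pos s)).hasDerivWithinAt)
    (fun s hs => (hg s hs).2) ⟨le_rfl, ht.1.trans ht.2⟩ ht
  refine this.trans ?_
  rw [Real.norm_eq_abs, abs_of_nonneg (sub_nonneg.2 ht.1)]
  have h4 : 2 * (K + 1) * d * (t - t₀) ≤ 2 * (K + 1) * d * (t₁ - t₀) := by
    have := ht.2
    gcongr
  nlinarith [mul_nonneg hd0 h01, mul_nonneg (mul_nonneg hd0 h01) (by linarith : 0 ≤ M)]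

end IsTrajectory

/-! ### Wedge bounds for the solution around a trajectory. -/

/-- The supersolution is `v = V + κ(t) ρ` with `ρ = √(ε² + (x - Z)²)` and `κ = K + Λ (t - t₀)`.
Along the trajectory's equation one finds `v_t + v v_x = s(t, Z) + Λ ρ + κ² (x - Z)`. In `Λ = (K +
1)² + M` the first summand beats `κ² |x - Z|`, since `κ ≤ K + 1` on the short interval, and the
second beats the Lipschitz variation of `s`. The smoothing `ε` makes `v` a `C¹` function and is sent
to zero at the end. -/
lemma EntropySlab.le_of_trajectory {u : ℝ → ℝ → ℝ} {s : ℝ × ℝ → ℝ} {t₀ t₁ M : ℝ}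
    (h : EntropySlab u s t₀ t₁ M) {Z V A : ℝ → ℝ} (hT : IsTrajectory s t₀ t₁ Z V A) {K : ℝ}
    (hK : 0 ≤ K) (hM : 0 ≤ M) (hs : ∀ p, |s p| ≤ M)
    (hL : ∀ t x y, |s (t, x) - s (t, y)| ≤ M * |x - y|)
    (hτ : 4 * ((K + 1) ^ 2 + M) * (t₁ - t₀) ≤ 1) (hV : |V t₀| ≤ M) {c r : ℝ} (hr : 0 < r)
    (hinit : ∀ᵐ x, |x - c| < r → u t₀ x ≤ V t₀ + K * |x - Z t₀|) {t : ℝ} (ht : t ∈ Ico t₀ t₁) :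
    ∀ᵐ x, (x - c) ^ 2 < r ^ 2 - 2 * r * (M + 1) * (t - t₀) →
      u t x ≤ V t + (K + 1) * |x - Z t| := by
  set Λ := (K + 1) ^ 2 + M with hΛ
  have hΛ0 : 0 ≤ Λ := by positivity
  have hVlow : ∀ t ∈ Icc t₀ t₁, -(M + 1) ≤ V t := fun t ht => by
    have h1 := (abs_le.1 (hT.abs_vel_sub_le (M := M)
      (fun t ht => by rw [hT.acc_eq t ht]; exact hs _) ht)).1
    have h2 : M * (t - t₀) ≤ 1 := by
      have h3 : M * (t - t₀) ≤ M * (t₁ - t₀) := by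
        have := ht.2
        gcongr
      nlinarith [mul_nonneg (sq_nonneg (K + 1)) (sub_nonneg.2 (ht.1.trans ht.2))]
    linarith [(abs_le.1 hV).1]
  have hκ : ∀ t ∈ Icc t₀ t₁, 0 ≤ K + Λ * (t - t₀) ∧ K + Λ * (t - t₀) ≤ K + 1 := fun t ht => by
    have h0 : 0 ≤ Λ * (t - t₀) := mul_nonneg hΛ0 (sub_nonneg.2 ht.1)
    have h3 : Λ * (t - t₀) ≤ Λ * (t₁ - t₀) := by
      have := ht.2
      gcongr
    constructor <;> linarith
  have key : ∀ ε : ℝ, 0 < ε → ∀ᵐ x, (x - c) ^ 2 < r ^ 2 - 2 * r * (M + 1) * (t - t₀) →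
      u t x ≤ V t + (K + Λ * (t - t₀)) * √(ε ^ 2 + (x - Z t) ^ 2) := by
    intro ε hε
    let ρ : ℝ × ℝ → ℝ := fun p => √(ε ^ 2 + (p.2 - Z p.1) ^ 2)
    have hpos : ∀ p : ℝ × ℝ, 0 < ε ^ 2 + (p.2 - Z p.1) ^ 2 := fun p => by positivity
    have hρ0 : ∀ p, 0 < ρ p := fun p => Real.sqrt_pos.2 (hpos p)
    have hρsq : ∀ p, ρ p * ρ p = ε ^ 2 + (p.2 - Z p.1) ^ 2 := fun p =>
      Real.mul_self_sqrt (hpos p).le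
    have hρge : ∀ p : ℝ × ℝ, |p.2 - Z p.1| ≤ ρ p := fun p => by
      rw [← Real.sqrt_sq_eq_abs]
      exact Real.sqrt_le_sqrt (by nlinarith [sq_nonneg ε])
    have hZc := hT.contDiff_pos
    have hVc := hT.contDiff_vel
    have hρ : ContDiff ℝ 1 ρ := by
      refine ContDiff.sqrt ?_ fun p => (hpos p).ne'
      have : ContDiff ℝ 1 fun p : ℝ × ℝ => Z p.1 := hZc.comp contDiff_fst
      fun_prop
    let v : ℝ × ℝ → ℝ := fun p => V p.1 + (K + Λ * (p.1 - t₀)) * ρ p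
    have hv : ContDiff ℝ 1 v := by
      have : ContDiff ℝ 1 fun p : ℝ × ℝ => V p.1 := hVc.comp contDiff_fst
      fun_prop
    have hvx : ∀ p, fderiv ℝ v p (0, 1) =
        (K + Λ * (p.1 - t₀)) * ((p.2 - Z p.1) / ρ p) := fun p => by
      refine fderiv_zero_one (hv.differentiable one_ne_zero p) ?_
      have h1 : HasDerivAt (fun x : ℝ => ε ^ 2 + (x - Z p.1) ^ 2) (2 * (p.2 - Z p.1)) p.2 := by
        have := (((hasDerivAt_id p.2).sub_const (Z p.1)).pow 2).const_add (ε ^ 2)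
        exact this.congr_deriv (by simp)
      have h2 := ((h1.sqrt (hpos p).ne').const_mul (K + Λ * (p.1 - t₀))).const_add (V p.1)
      refine h2.congr_deriv ?_
      have := (hρ0 p).ne'
      simp only [ρ] at this ⊢
      field_simp
    have hvt : ∀ p, fderiv ℝ v p (1, 0) = A p.1 + Λ * ρ p -
        (K + Λ * (p.1 - t₀)) * ((p.2 - Z p.1) / ρ p) * V p.1 := fun p => by
      refine fderiv_one_zero (hv.differentiable one_ne_zero p) ?_
      have h1 : HasDerivAt (fun t : ℝ => ε ^ 2 + (p.2 - Z t) ^ 2)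
          (-(2 * (p.2 - Z p.1) * V p.1)) p.1 := by
        have := (((hT.hasDerivAt_pos p.1).const_sub p.2).pow 2).const_add (ε ^ 2)
        exact this.congr_deriv (by simp)
      have h2 : HasDerivAt (fun t : ℝ => K + Λ * (t - t₀)) Λ p.1 := by
        have := (((hasDerivAt_id p.1).sub_const t₀).const_mul Λ).const_add K
        exact this.congr_deriv (by simp)
      refine ((hT.hasDerivAt_vel p.1).add (h2.mul (h1.sqrt (hpos p).ne'))).congr_deriv ?_
      have := (hρ0 p).ne'
      simp only [ρ] at this ⊢
      field_simp
      ring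
    refine h.le_of_supersolution hv hr (c := c) (L := M + 1) (B := K + 1) (by linarith)
      (fun p hp => ?_) (fun p hp _ => ?_) (fun p hp => ?_) ?_ ht
    · have hp' : p.1 ∈ Icc t₀ t₁ := ⟨hp.1.le, hp.2.le⟩
      obtain ⟨k0, k1⟩ := hκ p.1 hp'
      rw [hvt, hvx, hT.acc_eq _ hp']
      have h1 := (abs_le.1 (hL p.1 p.2 (Z p.1))).2
      simp only [v]
      set κ := K + Λ * (p.1 - t₀) with hκ
      have e1 : s (p.1, Z p.1) + Λ * ρ p - κ * ((p.2 - Z p.1) / ρ p) * V p.1 +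
          (V p.1 + κ * ρ p) * (κ * ((p.2 - Z p.1) / ρ p)) =
          s (p.1, Z p.1) + Λ * ρ p + κ ^ 2 * (p.2 - Z p.1) := by
        have := (hρ0 p).ne'
        field_simp
        ring
      rw [e1]
      have h2 : Λ * |p.2 - Z p.1| ≤ Λ * ρ p := mul_le_mul_of_nonneg_left (hρge p) hΛ0
      have h3 : κ ^ 2 ≤ (K + 1) ^ 2 := pow_le_pow_left₀ k0 k1 2
      have h4 : κ ^ 2 * |p.2 - Z p.1| ≤ (K + 1) ^ 2 * |p.2 - Z p.1| :=
        mul_le_mul_of_nonneg_right h3 (abs_nonneg _)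
      have h5 : -(κ ^ 2 * |p.2 - Z p.1|) ≤ κ ^ 2 * (p.2 - Z p.1) := by
        nlinarith [mul_le_mul_of_nonneg_left (neg_abs_le (p.2 - Z p.1)) (sq_nonneg κ)]
      rw [hΛ] at h2
      have h6 : s p = s (p.1, p.2) := rfl
      rw [h6]
      linarith
    · have hp' : p.1 ∈ Icc t₀ t₁ := ⟨hp.1.le, hp.2.le⟩
      exact (hVlow _ hp').trans (le_add_of_nonneg_right (mul_nonneg (hκ _ hp').1 (hρ0 p).le))
    · have hp' : p.1 ∈ Icc t₀ t₁ := ⟨hp.1.le, hp.2.le⟩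
      obtain ⟨k0, k1⟩ := hκ p.1 hp'
      rw [hvx, abs_mul, abs_div, abs_of_pos (hρ0 p), abs_of_nonneg k0]
      exact (mul_le_of_le_one_right k0 ((div_le_one (hρ0 p)).2 (hρge p))).trans k1
    · filter_upwards [hinit] with x hx hxr
      refine (hx hxr).trans ?_
      simp only [v, sub_self, mul_zero, add_zero]
      have := mul_le_mul_of_nonneg_left (hρge (t₀, x)) hK
      linarith
  have hall : ∀ᵐ x, ∀ n : ℕ, (x - c) ^ 2 < r ^ 2 - 2 * r * (M + 1) * (t - t₀) →
      u t x ≤ V t + (K + Λ * (t - t₀)) * √((1 / ((n : ℝ) + 1)) ^ 2 + (x - Z t) ^ 2) :=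
    ae_all_iff.2 fun n => key _ Nat.one_div_pos_of_nat
  filter_upwards [hall] with x hx hxr
  have hlim : Tendsto (fun n : ℕ => V t + (K + Λ * (t - t₀)) *
      √((1 / ((n : ℝ) + 1)) ^ 2 + (x - Z t) ^ 2)) atTop
      (𝓝 (V t + (K + Λ * (t - t₀)) * √(0 ^ 2 + (x - Z t) ^ 2))) :=
    ((((tendsto_one_div_add_atTop_nhds_zero_nat.pow 2).add_const _).sqrt).const_mul _).const_add _
  have h1 := ge_of_tendsto' hlim fun n => hx n hxr
  rw [zero_pow two_ne_zero, zero_add, Real.sqrt_sq_eq_abs] at h1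
  refine h1.trans ?_
  have := mul_le_mul_of_nonneg_right (hκ t ⟨ht.1, ht.2.le⟩).2 (abs_nonneg (x - Z t))
  linarith

/-- The lower half of the wedge is the upper half for the reflected solution around the reflected
trajectory. -/
lemma EntropySlab.abs_sub_le_of_trajectory {u : ℝ → ℝ → ℝ} {s : ℝ × ℝ → ℝ} {t₀ t₁ M : ℝ}
    (h : EntropySlab u s t₀ t₁ M) {Z V A : ℝ → ℝ} (hT : IsTrajectory s t₀ t₁ Z V A) {K : ℝ}
    (hK : 0 ≤ K) (hM : 0 ≤ M) (hs : ∀ p, |s p| ≤ M)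
    (hL : ∀ t x y, |s (t, x) - s (t, y)| ≤ M * |x - y|)
    (hτ : 4 * ((K + 1) ^ 2 + M) * (t₁ - t₀) ≤ 1) (hV : |V t₀| ≤ M) {c r : ℝ} (hr : 0 < r)
    (hinit : ∀ᵐ x, |x - c| < r → |u t₀ x - V t₀| ≤ K * |x - Z t₀|) {t : ℝ} (ht : t ∈ Ico t₀ t₁) :
    ∀ᵐ x, (x - c) ^ 2 < r ^ 2 - 2 * r * (M + 1) * (t - t₀) →
      |u t x - V t| ≤ (K + 1) * |x - Z t| := by
  have h1 := h.le_of_trajectory hT hK hM hs hL hτ hV hr (c := c) (by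
    filter_upwards [hinit] with x hx hxr
    linarith [(abs_le.1 (hx hxr)).2]) ht
  have hneg := (Measure.measurePreserving_neg (volume : Measure ℝ)).quasiMeasurePreserving
  have h2 := h.reflect.le_of_trajectory hT.neg hK hM (fun p => by rw [abs_neg]; exact hs _)
    (fun t x y => by
      have e1 : -s (t, -x) - -s (t, -y) = s (t, -y) - s (t, -x) := by ring
      have e2 : |x - y| = |-y - -x| := by congr 1; ring
      rw [e1, e2]
      exact hL t (-y) (-x)) hτ (by rwa [abs_neg]) hr (c := -c) (by
    filter_upwards [hneg.ae hinit] with x hx hxr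
    have e1 : |-x - c| = |x - -c| := by rw [← abs_neg]; congr 1; ring
    have e2 : |x - -Z t₀| = |-x - Z t₀| := by rw [← abs_neg]; congr 1; ring
    rw [e2]
    linarith [(abs_le.1 (hx (e1 ▸ hxr))).1]) ht
  filter_upwards [h1, hneg.ae h2] with x hx hx' hxr
  have e1 : (-x - -c) ^ 2 = (x - c) ^ 2 := by ring
  have e2 : |-x - -Z t| = |x - Z t| := by rw [← abs_neg]; congr 1; ring
  rw [e1, neg_neg, e2] at hx'
  rw [abs_le]
  constructor <;> linarith [hx hxr, hx' hxr]

/-! ### Functions transported by a `C¹` flow. -/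

lemma contDiffAt_uncurry_of_partial {f f₁ f₂ : ℝ → ℝ → ℝ} {O : Set (ℝ × ℝ)} (hO : IsOpen O)
    (h1 : ∀ p ∈ O, HasDerivAt (fun t => f t p.2) (f₁ p.1 p.2) p.1)
    (h2 : ∀ p ∈ O, HasDerivAt (fun a => f p.1 a) (f₂ p.1 p.2) p.2)
    (c1 : ContinuousOn (fun p : ℝ × ℝ => f₁ p.1 p.2) O)
    (c2 : ContinuousOn (fun p : ℝ × ℝ => f₂ p.1 p.2) O) {p : ℝ × ℝ} (hp : p ∈ O) :
    ContDiffAt ℝ 1 (fun p : ℝ × ℝ => f p.1 p.2) p ∧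
      HasFDerivAt (fun p : ℝ × ℝ => f p.1 p.2)
        (f₁ p.1 p.2 • ContinuousLinearMap.fst ℝ ℝ ℝ + f₂ p.1 p.2 • ContinuousLinearMap.snd ℝ ℝ ℝ)
        p := by
  have key : ∀ q ∈ O, HasFDerivAt (fun p : ℝ × ℝ => f p.1 p.2)
      (f₁ q.1 q.2 • ContinuousLinearMap.fst ℝ ℝ ℝ + f₂ q.1 q.2 • ContinuousLinearMap.snd ℝ ℝ ℝ)
      q := fun q hq => by
    have hq' := hO.mem_nhds hq
    have := (hasStrictFDerivAt_uncurry_coprod (𝕜 := ℝ) (u := q) (f := f)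
      (f₁ := fun t a => ContinuousLinearMap.toSpanSingleton ℝ (f₁ t a))
      (f₂ := fun t a => ContinuousLinearMap.toSpanSingleton ℝ (f₂ t a))
      (by filter_upwards [hq'] with v hv using (h1 v hv).hasFDerivAt)
      (by filter_upwards [hq'] with v hv using (h2 v hv).hasFDerivAt)
      ((ContinuousLinearMap.toSpanSingletonCLE (𝕜 := ℝ) (E := ℝ)).continuous.continuousAt.comp
        (c1.continuousAt hq'))
      ((ContinuousLinearMap.toSpanSingletonCLE (𝕜 := ℝ) (E := ℝ)).continuous.continuousAt.comp
        (c2.continuousAt hq'))).hasFDerivAt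
    refine this.congr_fderiv ?_
    ext <;> simp [Function.HasUncurry.uncurry]
  refine ⟨contDiffAt_one_iff.2 ⟨_, O, hO.mem_nhds hp, ?_, key⟩, key p hp⟩
  exact (c1.smul continuousOn_const).add (c2.smul continuousOn_const)

/-- The shear `(t, x) ↦ (t, v t + j x)` as a linear equivalence. -/
def shearEquiv (v j : ℝ) (hj : j ≠ 0) : (ℝ × ℝ) ≃L[ℝ] (ℝ × ℝ) :=
  ContinuousLinearEquiv.equivOfInverse
    ((ContinuousLinearMap.fst ℝ ℝ ℝ).prod
      (v • ContinuousLinearMap.fst ℝ ℝ ℝ + j • ContinuousLinearMap.snd ℝ ℝ ℝ))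
    ((ContinuousLinearMap.fst ℝ ℝ ℝ).prod
      (j⁻¹ • (ContinuousLinearMap.snd ℝ ℝ ℝ - v • ContinuousLinearMap.fst ℝ ℝ ℝ)))
    (fun p => by
      ext
      · simp
      · simp only [ContinuousLinearMap.prod_apply, add_apply,
          smul_apply, sub_apply,
          ContinuousLinearMap.coe_fst', ContinuousLinearMap.coe_snd', smul_eq_mul]
        field_simp
        ring)
    (fun p => by
      ext
      · simp
      · simp only [ContinuousLinearMap.prod_apply, add_apply,
          smul_apply, sub_apply,
          ContinuousLinearMap.coe_fst', ContinuousLinearMap.coe_snd', smul_eq_mul]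
        field_simp
        ring)

/-- A `C¹` flow `(t, a) ↦ (t, Z t a)` with non-degenerate stretching transports `V` to a `C¹`
function on the (open) region it sweeps. -/
lemma exists_contDiffOn_of_flow {Z V A J W : ℝ → ℝ → ℝ} {O : Set (ℝ × ℝ)} (hO : IsOpen O)
    (hZt : ∀ p ∈ O, HasDerivAt (fun t => Z t p.2) (V p.1 p.2) p.1)
    (hZa : ∀ p ∈ O, HasDerivAt (fun a => Z p.1 a) (J p.1 p.2) p.2)
    (hVt : ∀ p ∈ O, HasDerivAt (fun t => V t p.2) (A p.1 p.2) p.1)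
    (hVa : ∀ p ∈ O, HasDerivAt (fun a => V p.1 a) (W p.1 p.2) p.2)
    (cV : ContinuousOn (fun p : ℝ × ℝ => V p.1 p.2) O)
    (cA : ContinuousOn (fun p : ℝ × ℝ => A p.1 p.2) O)
    (cJ : ContinuousOn (fun p : ℝ × ℝ => J p.1 p.2) O)
    (cW : ContinuousOn (fun p : ℝ × ℝ => W p.1 p.2) O)
    (hJ : ∀ p ∈ O, J p.1 p.2 ≠ 0) (hinj : InjOn (fun p : ℝ × ℝ => (p.1, Z p.1 p.2)) O) :
    IsOpen ((fun p : ℝ × ℝ => (p.1, Z p.1 p.2)) '' O) ∧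
      ∃ g : ℝ × ℝ → ℝ, ContDiffOn ℝ 1 g ((fun p : ℝ × ℝ => (p.1, Z p.1 p.2)) '' O) ∧
        ∀ p ∈ O, g (p.1, Z p.1 p.2) = V p.1 p.2 := by
  set Ψ : ℝ × ℝ → ℝ × ℝ := fun p => (p.1, Z p.1 p.2) with hΨ
  have hΨd : ∀ p (hp : p ∈ O), ContDiffAt ℝ 1 Ψ p ∧
      HasFDerivAt Ψ (shearEquiv (V p.1 p.2) (J p.1 p.2) (hJ p hp) : ℝ × ℝ →L[ℝ] ℝ × ℝ) p :=
    fun p hp => by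
      have h := contDiffAt_uncurry_of_partial hO hZt hZa cV cJ hp
      exact ⟨contDiffAt_fst.prodMk h.1, hasFDerivAt_fst.prodMk h.2⟩
  have hmap : ∀ p ∈ O, map Ψ (𝓝 p) = 𝓝 (Ψ p) := fun p hp =>
    ((hΨd p hp).1.hasStrictFDerivAt' (hΨd p hp).2 one_ne_zero).map_nhds_eq_of_equiv
  have hopen : IsOpen (Ψ '' O) := by
    refine isOpen_iff_mem_nhds.2 ?_
    rintro _ ⟨p, hp, rfl⟩
    rw [← hmap p hp]
    exact image_mem_map (hO.mem_nhds hp)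
  refine ⟨hopen, fun q => V (Function.invFunOn Ψ O q).1 (Function.invFunOn Ψ O q).2, ?_, ?_⟩
  · rintro _ ⟨p, hp, rfl⟩
    refine ContDiffAt.contDiffWithinAt ?_
    have hd := hΨd p hp
    have hloc := hd.1.to_localInverse hd.2 one_ne_zero
    have hVd := (contDiffAt_uncurry_of_partial hO hVt hVa cA cW hp).1
    have hstr := hd.1.hasStrictFDerivAt' hd.2 one_ne_zero
    have hleft : ∀ᶠ x in 𝓝 p, Function.invFunOn Ψ O (Ψ x) = x := by
      filter_upwards [hO.mem_nhds hp] with x hx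
      exact hinj.leftInvOn_invFunOn hx
    -- The global inverse supplied by injectivity coincides near `Ψ p` with the one of the inverse
    -- function theorem, and thereby inherits its `C¹` regularity.
    have heq := hstr.localInverse_unique hleft
    have himg : hd.1.localInverse hd.2 one_ne_zero (Ψ p) = p :=
      hd.1.localInverse_apply_image hd.2 one_ne_zero
    have hcomp := ContDiffAt.comp (Ψ p)
      (g := fun p : ℝ × ℝ => V p.1 p.2) (by rw [himg]; exact hVd) hloc
    refine hcomp.congr_of_eventuallyEq ?_
    filter_upwards [heq] with q hq
    rw [hq]
    rfl
  · intro p hp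
    have : Function.invFunOn Ψ O (p.1, Z p.1 p.2) = p := hinj.leftInvOn_invFunOn hp
    simp only [this]

/-! ### The flow of characteristics, its linearisation and the regularity of the solution it sweeps.
-/

/-- Uniform bounds for the solution and its nonlocal terms on the time interval `[t₀, t₁]`. -/
structure SlabBounds (u : ℝ → ℝ → ℝ) (t₀ t₁ M : ℝ) : Prop where
  pos : 0 < t₀
  le : t₀ ≤ t₁
  one_le : 1 ≤ M
  bound : ∀ t ∈ Icc t₀ t₁, ∀ᵐ x, |u t x| ≤ M
  source_le : ∀ t ∈ Icc t₀ t₁, ∀ x, |source (u t) x| ≤ M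
  source_lip : ∀ t ∈ Icc t₀ t₁, ∀ x y, |source (u t) x - source (u t) y| ≤ M * |x - y|
  potential_le : ∀ t ∈ Icc t₀ t₁, ∀ x, |potential (u t) x| ≤ M
  potential_lip : ∀ t ∈ Icc t₀ t₁, ∀ x y,
    |potential (u t) x - potential (u t) y| ≤ M * |x - y|

lemma SlabBounds.mono {u : ℝ → ℝ → ℝ} {t₀ t₁ M s₀ s₁ : ℝ} (h : SlabBounds u t₀ t₁ M)
    (h0 : t₀ ≤ s₀) (h01 : s₀ ≤ s₁) (h1 : s₁ ≤ t₁) : SlabBounds u s₀ s₁ M :=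
  have hs : ∀ t ∈ Icc s₀ s₁, t ∈ Icc t₀ t₁ := fun _ ht => ⟨h0.trans ht.1, ht.2.trans h1⟩
  ⟨h.pos.trans_le h0, h01, h.one_le, fun t ht => h.bound t (hs t ht),
    fun t ht => h.source_le t (hs t ht), fun t ht => h.source_lip t (hs t ht),
    fun t ht => h.potential_le t (hs t ht), fun t ht => h.potential_lip t (hs t ht)⟩

/-- A family of characteristics issuing at time `t₀` from the points `a ∈ (c - ε, c + ε)` with
velocities `v₀ a`, on a short time interval. -/
structure IsFlow (u : ℝ → ℝ → ℝ) (t₀ t₁ M K c ε : ℝ) (v₀ v₀' : ℝ → ℝ) (Z V A : ℝ → ℝ → ℝ) :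
    Prop where
  bounds : SlabBounds u t₀ t₁ M
  K_nonneg : 0 ≤ K
  short : 4 * ((K + 1) ^ 2 + M) * (t₁ - t₀) ≤ 1
  traj : ∀ a ∈ Ioo (c - ε) (c + ε),
    IsTrajectory (fun p => source (u p.1) p.2) t₀ t₁ (Z a) (V a) (A a)
  pos_init : ∀ a ∈ Ioo (c - ε) (c + ε), Z a t₀ = a
  vel_init : ∀ a ∈ Ioo (c - ε) (c + ε), V a t₀ = v₀ a
  hasDerivAt : ∀ a ∈ Ioo (c - ε) (c + ε), HasDerivAt v₀ (v₀' a) a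
  continuous_deriv : ContinuousOn v₀' (Ioo (c - ε) (c + ε))
  init_le : ∀ a ∈ Ioo (c - ε) (c + ε), |v₀ a| ≤ M
  lipschitz : ∀ a ∈ Ioo (c - ε) (c + ε), ∀ b ∈ Ioo (c - ε) (c + ε),
    |v₀ b - v₀ a| ≤ K * |b - a|

namespace IsWeakEntropySolution
variable {ubar : ℝ → ℝ} {u : ℝ → ℝ → ℝ}

lemma exists_slabBounds (hu : IsWeakEntropySolution ubar u) {a b : ℝ} (ha : 0 < a)
    (hab : a < b) : ∃ M, SlabBounds u a b M := by
  obtain ⟨M, hM, h⟩ := hu.exists_bounds ha hab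
  have hM1 : M ≤ M + 1 := by linarith
  have hn : ∀ t ∈ Icc a b, 1 / 2 * ∫ y, |u t y| ≤ M + 1 := fun t ht => by
    linarith [(h t ht).2.2.1]
  refine ⟨M + 1, ha, hab.le, by linarith, fun t ht => ?_, fun t ht x =>
    ((h t ht).2.1 x).trans hM1, fun t ht x y => ((h t ht).2.2.2 x y).trans
    (mul_le_mul_of_nonneg_right hM1 (abs_nonneg _)), fun t ht x =>
    (abs_potential_le (hu.integrable t (ha.le.trans ht.1)) x).trans (hn t ht), fun t ht x y =>
    (abs_potential_sub_le_abs_sub (hu.integrable t (ha.le.trans ht.1)) x y).trans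
      (mul_le_mul_of_nonneg_right (hn t ht) (abs_nonneg _))⟩
  filter_upwards [(h t ht).1] with x hx using hx.trans hM1

lemma exists_flow (hu : IsWeakEntropySolution ubar u) {t₀ t₁ M K c ε : ℝ} {v₀ v₀' : ℝ → ℝ}
    (hB : SlabBounds u t₀ t₁ M) (hK : 0 ≤ K) (hτ : 4 * ((K + 1) ^ 2 + M) * (t₁ - t₀) ≤ 1)
    (hd : ∀ a ∈ Ioo (c - ε) (c + ε), HasDerivAt v₀ (v₀' a) a)
    (hc : ContinuousOn v₀' (Ioo (c - ε) (c + ε))) (hM : ∀ a ∈ Ioo (c - ε) (c + ε), |v₀ a| ≤ M)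
    (hL : ∀ a ∈ Ioo (c - ε) (c + ε), ∀ b ∈ Ioo (c - ε) (c + ε), |v₀ b - v₀ a| ≤ K * |b - a|) :
    ∃ Z V A : ℝ → ℝ → ℝ, IsFlow u t₀ t₁ M K c ε v₀ v₀' Z V A := by
  have h01 := hB.le
  have hM1 := hB.one_le
  have hS := hu.continuous_source_clamp hB.pos.le h01
  have key : ∀ a, ∃ Z V A : ℝ → ℝ, Continuous A ∧ (∀ t, HasDerivAt Z (V t) t) ∧
      (∀ t, HasDerivAt V (A t) t) ∧ Z t₀ = a ∧ V t₀ = v₀ a ∧ ∀ t ∈ Icc t₀ t₁,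
        A t = source (u (clamp t₀ t₁ t)) (Z t) := fun a => by
    have := exists_second_order hS (t₀ := t₀) (τ := t₁ - t₀) (Λ := M) (by linarith) hM1
      (by nlinarith [mul_nonneg (sq_nonneg (K + 1)) (sub_nonneg.2 h01)])
      (fun t _ x y => hB.source_lip _ (clamp_mem h01 t) x y) a (v₀ a)
    rwa [add_sub_cancel] at this
  choose Z V A h1 h2 h3 h4 h5 h6 using key
  refine ⟨Z, V, A, hB, hK, hτ, fun a _ => ⟨h1 a, h2 a, h3 a, fun t ht => ?_⟩, fun a _ => h4 a,
    fun a _ => h5 a, hd, hc, hM, hL⟩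
  rw [h6 a t ht, clamp_of_mem ht]

end IsWeakEntropySolution

namespace IsFlow
variable {ubar : ℝ → ℝ} {u : ℝ → ℝ → ℝ} {t₀ t₁ M K c ε : ℝ} {v₀ v₀' : ℝ → ℝ} {Z V A : ℝ → ℝ → ℝ}

lemma separation (h : IsFlow u t₀ t₁ M K c ε v₀ v₀' Z V A) {a b : ℝ}
    (ha : a ∈ Ioo (c - ε) (c + ε)) (hb : b ∈ Ioo (c - ε) (c + ε)) {t : ℝ} (ht : t ∈ Icc t₀ t₁) :
    |Z b t - Z a t| ≤ 2 * (K + 1) * |b - a| ∧ |V b t - V a t| ≤ 2 * (K + 1) * |b - a| ∧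
      |Z b t - Z a t - (b - a)| ≤ 1 / 2 * |b - a| := by
  have hK := h.K_nonneg
  have := (h.traj a ha).abs_sub_le (h.traj b hb) h.bounds.one_le hK
    (fun t ht x y => h.bounds.source_lip t ht x y)
    (by nlinarith [h.short, mul_nonneg hK (sub_nonneg.2 h.bounds.le),
      mul_nonneg (mul_nonneg hK hK) (sub_nonneg.2 h.bounds.le)])
    (by rw [h.vel_init a ha, h.vel_init b hb, h.pos_init a ha, h.pos_init b hb]
        exact h.lipschitz a ha b hb) ht
  rwa [h.pos_init a ha, h.pos_init b hb] at this

lemma abs_vel_le (h : IsFlow u t₀ t₁ M K c ε v₀ v₀' Z V A) {a : ℝ}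
    (ha : a ∈ Ioo (c - ε) (c + ε)) {t : ℝ} (ht : t ∈ Icc t₀ t₁) : |V a t| ≤ M + 1 := by
  have h1 := (h.traj a ha).abs_vel_sub_le (M := M) (fun t ht => by
    rw [(h.traj a ha).acc_eq t ht]; exact h.bounds.source_le t ht _) ht
  have h2 : M * (t - t₀) ≤ M * (t₁ - t₀) :=
    mul_le_mul_of_nonneg_left (by linarith [ht.2]) (by linarith [h.bounds.one_le])
  have h3 : M * (t₁ - t₀) ≤ 1 := by
    nlinarith [h.short, mul_nonneg (sq_nonneg (K + 1)) (sub_nonneg.2 h.bounds.le),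
      mul_nonneg (by linarith [h.bounds.one_le] : 0 ≤ M) (sub_nonneg.2 h.bounds.le)]
  have h4 := h.init_le a ha
  rw [h.vel_init a ha] at h1
  have h5 := abs_add_le (V a t - v₀ a) (v₀ a)
  rw [sub_add_cancel] at h5
  linarith

lemma abs_pos_sub_le (h : IsFlow u t₀ t₁ M K c ε v₀ v₀' Z V A) {a : ℝ}
    (ha : a ∈ Ioo (c - ε) (c + ε)) {t : ℝ} (ht : t ∈ Icc t₀ t₁) :
    |Z a t - a| ≤ (M + 1) * (t - t₀) := by
  have := (convex_Icc t₀ t₁).norm_image_sub_le_of_norm_hasDerivWithin_le (f := Z a) (f' := V a)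
    (fun s _ => ((h.traj a ha).hasDerivAt_pos s).hasDerivWithinAt)
    (fun s hs => h.abs_vel_le ha hs) ⟨le_rfl, ht.1.trans ht.2⟩ ht
  rwa [Real.norm_eq_abs, Real.norm_eq_abs, abs_of_nonneg (sub_nonneg.2 ht.1),
    h.pos_init a ha] at this

lemma strictMonoOn (h : IsFlow u t₀ t₁ M K c ε v₀ v₀' Z V A) {t : ℝ} (ht : t ∈ Icc t₀ t₁) :
    StrictMonoOn (fun a => Z a t) (Ioo (c - ε) (c + ε)) := fun a ha b hb hab => by
  have h1 := (h.separation ha hb ht).2.2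
  rw [abs_of_pos (sub_pos.2 hab)] at h1
  have := (abs_le.1 h1).1
  simp only
  linarith

lemma continuousOn_pos (h : IsFlow u t₀ t₁ M K c ε v₀ v₀' Z V A) {t : ℝ} (ht : t ∈ Icc t₀ t₁) :
    ContinuousOn (fun a => Z a t) (Ioo (c - ε) (c + ε)) := by
  have hK := h.K_nonneg
  refine (LipschitzOnWith.of_dist_le_mul (K := ⟨2 * (K + 1), by positivity⟩)
    fun a ha b hb => ?_).continuousOn
  exact (h.separation hb ha ht).1

/-- The linearised growth rate along the trajectory issuing from `a`. -/
def rate (u : ℝ → ℝ → ℝ) (t₀ t₁ : ℝ) (Z V : ℝ → ℝ → ℝ) (a t : ℝ) : ℝ :=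
  V a t + potential (u (clamp t₀ t₁ t)) (Z a t)

/-- `J` and `W` are the candidates for `∂Z/∂a` and `∂V/∂a`: the equation `Z'' = source(Z)` is
formally differentiated in `a`, with `source' = u + potential` and `u` replaced by `V` on the
trajectory. The identification is made in `hasDerivAt_of_jacobi`. -/
lemma exists_jacobi (h : IsFlow u t₀ t₁ M K c ε v₀ v₀' Z V A) (hu : IsWeakEntropySolution ubar u) :
    ∃ J W B : ℝ → ℝ → ℝ, ∀ a ∈ Ioo (c - ε) (c + ε),
      IsTrajectory (fun p => rate u t₀ t₁ Z V a p.1 * p.2) t₀ t₁ (J a) (W a) (B a) ∧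
      J a t₀ = 1 ∧ W a t₀ = v₀' a := by
  have h01 := h.bounds.le
  have hM1 := h.bounds.one_le
  have key : ∀ a, ∃ J W B : ℝ → ℝ, a ∈ Ioo (c - ε) (c + ε) →
      IsTrajectory (fun p => rate u t₀ t₁ Z V a p.1 * p.2) t₀ t₁ J W B ∧
      J t₀ = 1 ∧ W t₀ = v₀' a := fun a => by
    by_cases ha : a ∈ Ioo (c - ε) (c + ε)
    · have hV := (h.traj a ha).continuous_vel
      have hZ := (h.traj a ha).continuous_pos
      have hP := hu.continuous_potential_clamp h.bounds.pos.le h01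
      have hr : Continuous (rate u t₀ t₁ Z V a) :=
        hV.add (hP.comp (continuous_id.prodMk hZ))
      obtain ⟨J, W, B, b1, b2, b3, b4, b5, b6⟩ := exists_second_order
        (S := fun p => rate u t₀ t₁ Z V a p.1 * p.2) (by fun_prop)
        (t₀ := t₀) (τ := t₁ - t₀) (Λ := 2 * M + 1) (by linarith) (by linarith)
        (by nlinarith [h.short, h.K_nonneg, mul_nonneg h.K_nonneg (sub_nonneg.2 h01),
          mul_nonneg (mul_nonneg h.K_nonneg h.K_nonneg) (sub_nonneg.2 h01)])
        (fun t ht x y => by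
          rw [add_sub_cancel] at ht
          simp only
          rw [← mul_sub, abs_mul]
          refine mul_le_mul_of_nonneg_right ?_ (abs_nonneg _)
          refine (abs_add_le _ _).trans ?_
          linarith [h.abs_vel_le ha ht, h.bounds.potential_le _ (clamp_mem h01 t) (Z a t)])
        1 (v₀' a)
      rw [add_sub_cancel] at b6
      exact ⟨J, W, B, fun _ => ⟨⟨b1, b2, b3, b6⟩, b4, b5⟩⟩
    · exact ⟨0, 0, 0, fun h => (ha h).elim⟩
  choose J W B h1 using key
  exact ⟨J, W, B, h1⟩

end IsFlow

lemma abs_le_two_mul_of_second_order {Z V A : ℝ → ℝ} {a b Λ δ ε : ℝ} (hΛ : 1 ≤ Λ) (hε : 0 ≤ ε)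
    (hΛb : Λ * (b - a) ≤ 1 / 2) (hZ : ∀ t, HasDerivAt Z (V t) t) (hV : ∀ t, HasDerivAt V (A t) t)
    (hA : ∀ t ∈ Ico a b, |A t| ≤ Λ * |Z t| + ε) (hZa : |Z a| ≤ δ) (hVa : |V a| ≤ δ)
    {t : ℝ} (ht : t ∈ Icc a b) : |Z t| ≤ 2 * (δ + ε) ∧ |V t| ≤ 2 * (δ + ε) := by
  have h := abs_le_of_second_order hΛ hε (fun t _ => (hZ t).continuousAt.continuousWithinAt)
    (fun t _ => (hV t).continuousAt.continuousWithinAt) (fun t _ => (hZ t).hasDerivWithinAt)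
    (fun t _ => (hV t).hasDerivWithinAt) hA hZa hVa ht
  have h1 : Real.exp (Λ * (t - a)) ≤ 2 := exp_le_two_of_le_half
    ((mul_le_mul_of_nonneg_left (by linarith [ht.2]) (by linarith)).trans hΛb)
  have h2 : (δ + ε) * Real.exp (Λ * (t - a)) ≤ 2 * (δ + ε) := by
    rw [mul_comm 2]
    exact mul_le_mul_of_nonneg_left h1 (add_nonneg ((abs_nonneg _).trans hZa) hε)
  exact ⟨h.1.trans h2, h.2.trans h2⟩

namespace IsFlow
variable {ubar : ℝ → ℝ} {u : ℝ → ℝ → ℝ} {t₀ t₁ M K c ε : ℝ} {v₀ v₀' : ℝ → ℝ} {Z V A : ℝ → ℝ → ℝ}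

lemma rate_short (h : IsFlow u t₀ t₁ M K c ε v₀ v₀' Z V A) :
    (2 * M + 1) * (t₁ - t₀) ≤ 1 / 2 := by
  have h01 := sub_nonneg.2 h.bounds.le
  nlinarith [h.short, h.K_nonneg, mul_nonneg h.K_nonneg h01,
    mul_nonneg (mul_nonneg h.K_nonneg h.K_nonneg) h01]

lemma abs_rate_le (h : IsFlow u t₀ t₁ M K c ε v₀ v₀' Z V A) {a : ℝ}
    (ha : a ∈ Ioo (c - ε) (c + ε)) {t : ℝ} (ht : t ∈ Icc t₀ t₁) :
    |rate u t₀ t₁ Z V a t| ≤ 2 * M + 1 := by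
  refine (abs_add_le _ _).trans ?_
  linarith [h.abs_vel_le ha ht, h.bounds.potential_le _ (clamp_mem h.bounds.le t) (Z a t)]

lemma abs_rate_sub_le (h : IsFlow u t₀ t₁ M K c ε v₀ v₀' Z V A) {a b : ℝ}
    (ha : a ∈ Ioo (c - ε) (c + ε)) (hb : b ∈ Ioo (c - ε) (c + ε)) {t : ℝ} (ht : t ∈ Icc t₀ t₁) :
    |rate u t₀ t₁ Z V b t - rate u t₀ t₁ Z V a t| ≤ 2 * (K + 1) * (M + 1) * |b - a| := by
  have h1 := h.separation ha hb ht
  have h2 := h.bounds.potential_lip _ (clamp_mem h.bounds.le t) (Z b t) (Z a t)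
  have h3 : M * |Z b t - Z a t| ≤ M * (2 * (K + 1) * |b - a|) :=
    mul_le_mul_of_nonneg_left h1.1 (by linarith [h.bounds.one_le])
  have e : rate u t₀ t₁ Z V b t - rate u t₀ t₁ Z V a t = (V b t - V a t) +
      (potential (u (clamp t₀ t₁ t)) (Z b t) - potential (u (clamp t₀ t₁ t)) (Z a t)) := by
    simp only [rate]; ring
  rw [e]
  refine (abs_add_le _ _).trans ?_
  linarith [h1.2.1]

/-- Continuous dependence of the linearised flow on the starting point. -/
lemma jacobi_sub_le (h : IsFlow u t₀ t₁ M K c ε v₀ v₀' Z V A) {J W B J' W' B' : ℝ → ℝ} {a b : ℝ}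
    (ha : a ∈ Ioo (c - ε) (c + ε)) (hb : b ∈ Ioo (c - ε) (c + ε))
    (hJ : IsTrajectory (fun p => rate u t₀ t₁ Z V a p.1 * p.2) t₀ t₁ J W B)
    (hJ' : IsTrajectory (fun p => rate u t₀ t₁ Z V b p.1 * p.2) t₀ t₁ J' W' B')
    (hJ0 : J t₀ = 1) (hW0 : W t₀ = v₀' a) (hJ0' : J' t₀ = 1) (hW0' : W' t₀ = v₀' b)
    {t : ℝ} (ht : t ∈ Icc t₀ t₁) :
    |J' t - J t| ≤ 2 * (|v₀' b - v₀' a| +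
        2 * (K + 1) * (M + 1) * |b - a| * (2 * (1 + |v₀' a|))) ∧
      |W' t - W t| ≤ 2 * (|v₀' b - v₀' a| +
        2 * (K + 1) * (M + 1) * |b - a| * (2 * (1 + |v₀' a|))) := by
  have hM1 := h.bounds.one_le
  have hK := h.K_nonneg
  have hJb : ∀ t ∈ Icc t₀ t₁, |J t| ≤ 2 * (1 + |v₀' a|) := fun t ht => by
    have := (abs_le_two_mul_of_second_order (Λ := 2 * M + 1) (ε := 0) (δ := 1 + |v₀' a|)
      (by linarith) le_rfl h.rate_short hJ.hasDerivAt_pos hJ.hasDerivAt_vel (fun t ht => by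
        rw [hJ.acc_eq t ⟨ht.1, ht.2.le⟩, abs_mul, add_zero]
        exact mul_le_mul_of_nonneg_right (h.abs_rate_le ha ⟨ht.1, ht.2.le⟩) (abs_nonneg _))
      (by rw [hJ0, abs_one]; linarith [abs_nonneg (v₀' a)]) (by rw [hW0]; linarith) ht).1
    simpa using this
  refine abs_le_two_mul_of_second_order (Z := fun t => J' t - J t) (V := fun t => W' t - W t)
    (A := fun t => B' t - B t) (Λ := 2 * M + 1) (by linarith) (by positivity) h.rate_short
    (fun t => (hJ'.hasDerivAt_pos t).sub (hJ.hasDerivAt_pos t))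
    (fun t => (hJ'.hasDerivAt_vel t).sub (hJ.hasDerivAt_vel t)) (fun t ht => ?_)
    (by rw [hJ0, hJ0', sub_self, abs_zero]; exact abs_nonneg _) (by rw [hW0, hW0']) ht
  have ht' : t ∈ Icc t₀ t₁ := ⟨ht.1, ht.2.le⟩
  rw [hJ'.acc_eq t ht', hJ.acc_eq t ht']
  have e : rate u t₀ t₁ Z V b t * J' t - rate u t₀ t₁ Z V a t * J t =
      rate u t₀ t₁ Z V b t * (J' t - J t) +
        (rate u t₀ t₁ Z V b t - rate u t₀ t₁ Z V a t) * J t := by ring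
  simp only
  rw [e]
  refine (abs_add_le _ _).trans (add_le_add ?_ ?_)
  · rw [abs_mul]
    exact mul_le_mul_of_nonneg_right (h.abs_rate_le hb ht') (abs_nonneg _)
  · rw [abs_mul]
    exact mul_le_mul (h.abs_rate_sub_le ha hb ht') (hJb t ht') (abs_nonneg _) (by positivity)

/-- The slice `u t` is not yet known to be continuous. The wedge bound replaces this: between the
two trajectories `u + potential` differs from `rate` by at most `(K + 1 + M) |z - Z_a|`, and
integrating over the gap gives a quadratic error. -/
lemma source_linearisation (h : IsFlow u t₀ t₁ M K c ε v₀ v₀' Z V A)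
    (hu : IsWeakEntropySolution ubar u) {y R : ℝ}
    (hcmp : ∀ t ∈ Ico t₀ t₁, ∀ a ∈ Ioo (c - ε) (c + ε), ∀ᵐ x, |x - y| < R →
      |u t x - V a t| ≤ (K + 1) * |x - Z a t|)
    (hR : ∀ t ∈ Icc t₀ t₁, ∀ a ∈ Ioo (c - ε) (c + ε), |Z a t - y| < R) {a b : ℝ}
    (ha : a ∈ Ioo (c - ε) (c + ε)) (hb : b ∈ Ioo (c - ε) (c + ε)) {t : ℝ} (ht : t ∈ Ico t₀ t₁) :
    |source (u t) (Z b t) - source (u t) (Z a t) - rate u t₀ t₁ Z V a t * (Z b t - Z a t)| ≤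
      (K + 1 + M) * (2 * (K + 1) * |b - a|) ^ 2 := by
  have ht' : t ∈ Icc t₀ t₁ := ⟨ht.1, ht.2.le⟩
  have hint := hu.integrable t (h.bounds.pos.le.trans ht.1)
  have hKM : 0 ≤ K + 1 + M := by linarith [h.K_nonneg, h.bounds.one_le]
  have e : source (u t) (Z b t) - source (u t) (Z a t) - rate u t₀ t₁ Z V a t * (Z b t - Z a t) =
      ∫ z in (Z a t)..(Z b t), (u t z + potential (u t) z - rate u t₀ t₁ Z V a t) := by
    rw [intervalIntegral.integral_sub (intervalIntegrable_add_potential hint _ _)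
      intervalIntegrable_const, ← source_sub hint, intervalIntegral.integral_const, smul_eq_mul]
    ring
  have hsep := (h.separation ha hb ht').1
  rw [e, ← Real.norm_eq_abs]
  have hbd := intervalIntegral.norm_integral_le_of_norm_le_const_ae (a := Z a t) (b := Z b t)
    (f := fun z => u t z + potential (u t) z - rate u t₀ t₁ Z V a t)
    (C := (K + 1 + M) * |Z b t - Z a t|) (by
      filter_upwards [hcmp t ht a ha] with z hz hzm
      have hz1 : |z - Z a t| ≤ |Z b t - Z a t| :=
        abs_sub_left_of_mem_uIcc (uIoc_subset_uIcc hzm)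
      have hz2 : |z - y| < R := by
        have h1 := abs_lt.1 (hR t ht' a ha)
        have h2 := abs_lt.1 (hR t ht' b hb)
        have h3 := uIoc_subset_uIcc hzm
        rw [abs_lt]
        rcases le_total (Z a t) (Z b t) with hle | hle
        · rw [uIcc_of_le hle] at h3
          constructor <;> linarith [h3.1, h3.2]
        · rw [uIcc_of_ge hle] at h3
          constructor <;> linarith [h3.1, h3.2]
      have h4 := hz hz2
      have h5 := h.bounds.potential_lip t ht' z (Z a t)
      have e2 : u t z + potential (u t) z - rate u t₀ t₁ Z V a t =
          (u t z - V a t) + (potential (u t) z - potential (u t) (Z a t)) := by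
        rw [rate, clamp_of_mem ht']; ring
      rw [Real.norm_eq_abs, e2]
      refine (abs_add_le _ _).trans ?_
      have h6 := mul_le_mul_of_nonneg_left hz1 hKM
      linarith)
  refine hbd.trans ?_
  have := mul_le_mul_of_nonneg_left (pow_le_pow_left₀ (abs_nonneg _) hsep 2) hKM
  calc _ = (K + 1 + M) * |Z b t - Z a t| ^ 2 := by ring
    _ ≤ _ := this

/-- The defect `Z_b - Z_a - (b - a) J` solves the linearised equation with a forcing of order `(b -
a)²` and initial velocity `v₀ b - v₀ a - (b - a) v₀' a = o(b - a)`. Grönwall's inequality makes both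
it and its velocity `o(b - a)`. -/
lemma hasDerivAt_of_jacobi (h : IsFlow u t₀ t₁ M K c ε v₀ v₀' Z V A)
    (hu : IsWeakEntropySolution ubar u) {y R : ℝ}
    (hcmp : ∀ t ∈ Ico t₀ t₁, ∀ a ∈ Ioo (c - ε) (c + ε), ∀ᵐ x, |x - y| < R →
      |u t x - V a t| ≤ (K + 1) * |x - Z a t|)
    (hR : ∀ t ∈ Icc t₀ t₁, ∀ a ∈ Ioo (c - ε) (c + ε), |Z a t - y| < R) {a : ℝ}
    (ha : a ∈ Ioo (c - ε) (c + ε)) {J W B : ℝ → ℝ}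
    (hJ : IsTrajectory (fun p => rate u t₀ t₁ Z V a p.1 * p.2) t₀ t₁ J W B)
    (hJ0 : J t₀ = 1) (hW0 : W t₀ = v₀' a) {t : ℝ} (ht : t ∈ Icc t₀ t₁) :
    HasDerivAt (fun b => Z b t) (J t) a ∧ HasDerivAt (fun b => V b t) (W t) a := by
  have hM1 := h.bounds.one_le
  have hK := h.K_nonneg
  set C := (K + 1 + M) * (2 * (K + 1)) ^ 2 with hC
  have hC0 : 0 ≤ C := by positivity
  have hest : ∀ b ∈ Ioo (c - ε) (c + ε),
      |Z b t - Z a t - (b - a) * J t| ≤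
        2 * (|v₀ b - v₀ a - (b - a) * v₀' a| + C * (b - a) ^ 2) ∧
      |V b t - V a t - (b - a) * W t| ≤
        2 * (|v₀ b - v₀ a - (b - a) * v₀' a| + C * (b - a) ^ 2) := fun b hb => by
    refine abs_le_two_mul_of_second_order (Z := fun t => Z b t - Z a t - (b - a) * J t)
      (V := fun t => V b t - V a t - (b - a) * W t) (A := fun t => A b t - A a t - (b - a) * B t)
      (Λ := 2 * M + 1) (by linarith) (by positivity) h.rate_short
      (fun t => (((h.traj b hb).hasDerivAt_pos t).sub ((h.traj a ha).hasDerivAt_pos t)).sub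
        ((hJ.hasDerivAt_pos t).const_mul _))
      (fun t => (((h.traj b hb).hasDerivAt_vel t).sub ((h.traj a ha).hasDerivAt_vel t)).sub
        ((hJ.hasDerivAt_vel t).const_mul _)) (fun t ht => ?_) ?_ ?_ ht
    · have ht' : t ∈ Icc t₀ t₁ := ⟨ht.1, ht.2.le⟩
      have h1 := h.source_linearisation hu hcmp hR ha hb ht
      rw [(h.traj b hb).acc_eq t ht', (h.traj a ha).acc_eq t ht', hJ.acc_eq t ht']
      simp only
      have e : source (u t) (Z b t) - source (u t) (Z a t) -
          (b - a) * (rate u t₀ t₁ Z V a t * J t) =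
          rate u t₀ t₁ Z V a t * (Z b t - Z a t - (b - a) * J t) +
          (source (u t) (Z b t) - source (u t) (Z a t) -
            rate u t₀ t₁ Z V a t * (Z b t - Z a t)) := by ring
      rw [e]
      refine (abs_add_le _ _).trans (add_le_add ?_ (h1.trans_eq ?_))
      · rw [abs_mul]
        exact mul_le_mul_of_nonneg_right (h.abs_rate_le ha ht') (abs_nonneg _)
      · rw [mul_pow, sq_abs, hC]; ring
    · simp only [h.pos_init b hb, h.pos_init a ha, hJ0, mul_one, sub_self, abs_zero]
      exact abs_nonneg _
    · simp only [h.vel_init b hb, h.vel_init a ha, hW0, le_refl]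
  have hlo : (fun b => |v₀ b - v₀ a - (b - a) * v₀' a| + C * (b - a) ^ 2) =o[𝓝 a]
      fun b => b - a :=
    ((hasDerivAt_iff_isLittleO.1 (h.hasDerivAt a ha)).norm_left).add
      (((Asymptotics.isLittleO_pow_sub_sub a one_lt_two).const_mul_left C).congr_left
        fun b => by rw [Real.norm_eq_abs, sq_abs])
  have hI : ∀ᶠ b in 𝓝 a, b ∈ Ioo (c - ε) (c + ε) := isOpen_Ioo.mem_nhds ha
  constructor
  · refine hasDerivAt_iff_isLittleO.2 (Asymptotics.IsBigO.trans_isLittleO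
      (Asymptotics.IsBigO.of_bound 2 ?_) hlo)
    filter_upwards [hI] with b hb
    rw [Real.norm_eq_abs, Real.norm_eq_abs, abs_of_nonneg (a := _ + _) (by positivity)]
    exact (hest b hb).1
  · refine hasDerivAt_iff_isLittleO.2 (Asymptotics.IsBigO.trans_isLittleO
      (Asymptotics.IsBigO.of_bound 2 ?_) hlo)
    filter_upwards [hI] with b hb
    rw [Real.norm_eq_abs, Real.norm_eq_abs, abs_of_nonneg (a := _ + _) (by positivity)]
    exact (hest b hb).2

end IsFlow

/-- Continuity in `t` for fixed `a` becomes joint continuity once the modulus in `a` is uniform in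
`t`. It supplies the continuity of the four partial derivatives of the flow. -/
lemma continuousOn_of_equicontinuous {f : ℝ → ℝ → ℝ} {I T : Set ℝ}
    (hc : ∀ a ∈ I, Continuous (f a))
    (h : ∀ a ∈ I, ∃ m : ℝ → ℝ, Tendsto m (𝓝[I] a) (𝓝 0) ∧
      ∀ b ∈ I, ∀ t ∈ T, |f b t - f a t| ≤ m b) :
    ContinuousOn (fun p : ℝ × ℝ => f p.2 p.1) (T ×ˢ I) := by
  rintro ⟨t, a⟩ ⟨ht, ha⟩
  obtain ⟨m, hm, hle⟩ := h a ha
  rw [ContinuousWithinAt, tendsto_iff_dist_tendsto_zero]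
  have h1 : Tendsto (fun p : ℝ × ℝ => m p.2 + dist (f a p.1) (f a t)) (𝓝[T ×ˢ I] (t, a))
      (𝓝 (0 + 0)) := by
    refine (hm.comp (tendsto_nhdsWithin_iff.2 ⟨?_, ?_⟩)).add ?_
    · exact (continuous_snd.tendsto (t, a)).mono_left nhdsWithin_le_nhds
    · filter_upwards [self_mem_nhdsWithin] with p hp using hp.2
    · refine tendsto_iff_dist_tendsto_zero.1 ?_
      exact (((hc a ha).comp continuous_fst).tendsto (t, a)).mono_left nhdsWithin_le_nhds
  rw [add_zero] at h1
  refine squeeze_zero' (Eventually.of_forall fun _ => dist_nonneg) ?_ h1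
  filter_upwards [self_mem_nhdsWithin] with p hp
  exact (dist_triangle _ (f a p.1) _).trans (add_le_add (hle _ hp.2 _ hp.1) le_rfl)

namespace IsFlow
variable {ubar : ℝ → ℝ} {u : ℝ → ℝ → ℝ} {t₀ t₁ M K c ε : ℝ} {v₀ v₀' : ℝ → ℝ} {Z V A : ℝ → ℝ → ℝ}

/-- In the region swept by the flow the solution is `C¹`, and it is transported by the flow. -/
lemma exists_contDiffOn (h : IsFlow u t₀ t₁ M K c ε v₀ v₀' Z V A)
    (hu : IsWeakEntropySolution ubar u) {y R : ℝ}
    (hcmp : ∀ t ∈ Ico t₀ t₁, ∀ a ∈ Ioo (c - ε) (c + ε), ∀ᵐ x, |x - y| < R →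
      |u t x - V a t| ≤ (K + 1) * |x - Z a t|)
    (hR : ∀ t ∈ Icc t₀ t₁, ∀ a ∈ Ioo (c - ε) (c + ε), |Z a t - y| < R) :
    ∃ (O : Set (ℝ × ℝ)) (g : ℝ × ℝ → ℝ), IsOpen O ∧ O ⊆ Ioo t₀ t₁ ×ˢ univ ∧
      ContDiffOn ℝ 1 g O ∧ (∀ᵐ p ∂(volume.restrict O), u p.1 p.2 = g p) ∧
      ∀ t ∈ Ioo t₀ t₁, ∀ a ∈ Ioo (c - ε) (c + ε), (t, Z a t) ∈ O ∧ g (t, Z a t) = V a t := by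
  have hK := h.K_nonneg
  obtain ⟨J, W, B, hJ⟩ := h.exists_jacobi hu
  set I := Ioo (c - ε) (c + ε) with hI
  have hI' : IsOpen I := isOpen_Ioo
  set Ω : Set (ℝ × ℝ) := Ioo t₀ t₁ ×ˢ I with hΩ
  have hΩo : IsOpen Ω := isOpen_Ioo.prod hI'
  have hT : ∀ {t}, t ∈ Ioo t₀ t₁ → t ∈ Icc t₀ t₁ := fun ht => ⟨ht.1.le, ht.2.le⟩
  have hlin : ∀ C : ℝ, ∀ a, Tendsto (fun b => C * |b - a|) (𝓝[I] a) (𝓝 0) := fun C a => by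
    have : Continuous fun b => C * |b - a| := by fun_prop
    have := (this.tendsto a).mono_left (nhdsWithin_le_nhds (s := I))
    simpa using this
  have hder : ∀ p ∈ Ω, HasDerivAt (fun b => Z b p.1) (J p.2 p.1) p.2 ∧
      HasDerivAt (fun b => V b p.1) (W p.2 p.1) p.2 := fun p hp =>
    h.hasDerivAt_of_jacobi hu hcmp hR hp.2 (hJ p.2 hp.2).1 (hJ p.2 hp.2).2.1 (hJ p.2 hp.2).2.2
      (hT hp.1)
  have hmod : ∀ a ∈ I, Tendsto (fun b => 2 * (|v₀' b - v₀' a| +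
      2 * (K + 1) * (M + 1) * |b - a| * (2 * (1 + |v₀' a|)))) (𝓝[I] a) (𝓝 0) := fun a ha => by
    have h1 : Tendsto (fun b => |v₀' b - v₀' a|) (𝓝[I] a) (𝓝 |v₀' a - v₀' a|) :=
      ((h.continuous_deriv a ha).sub_const _).abs
    have h2 := (h1.add ((hlin (2 * (K + 1) * (M + 1)) a).mul_const (2 * (1 + |v₀' a|)))).const_mul 2
    simpa using h2
  -- The difference quotients of `Z` in `a` differ from `1` by at most `1/2`, so `J ≥ 1/2`.
  have hJne : ∀ p ∈ Ω, J p.2 p.1 ≠ 0 := fun p hp => by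
    have h1 := ((hder p hp).1.sub (hasDerivAt_id p.2)).le_of_lip' (C := 1 / 2) (by norm_num) (by
      filter_upwards [hI'.mem_nhds hp.2] with b hb
      have := (h.separation hp.2 hb (hT hp.1)).2.2
      rw [Real.norm_eq_abs, Real.norm_eq_abs]
      convert this using 2
      simp only [Pi.sub_apply, id]
      ring)
    have h2 := (abs_le.1 h1).1
    intro h0
    rw [h0] at h2
    linarith
  have hinj : InjOn (fun p : ℝ × ℝ => (p.1, Z p.2 p.1)) Ω := by
    rintro ⟨t, a⟩ hp ⟨t', b⟩ hq he
    obtain ⟨rfl, he⟩ : t = t' ∧ Z a t = Z b t' := by simpa [Prod.ext_iff] using he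
    have := (h.strictMonoOn (hT hp.1)).injOn hp.2 hq.2 he
    exact Prod.ext rfl this
  obtain ⟨hopen, g, hg, hgV⟩ := exists_contDiffOn_of_flow (Z := fun t a => Z a t)
    (V := fun t a => V a t) (A := fun t a => A a t) (J := fun t a => J a t)
    (W := fun t a => W a t) hΩo
    (fun p hp => (h.traj p.2 hp.2).hasDerivAt_pos p.1) (fun p hp => (hder p hp).1)
    (fun p hp => (h.traj p.2 hp.2).hasDerivAt_vel p.1) (fun p hp => (hder p hp).2)
    (continuousOn_of_equicontinuous (f := V) (fun a ha => (h.traj a ha).continuous_vel)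
      fun a ha => ⟨_, hlin (2 * (K + 1)) a, fun b hb t ht => (h.separation ha hb (hT ht)).2.1⟩)
    (continuousOn_of_equicontinuous (f := A) (fun a ha => (h.traj a ha).continuous_acc)
      fun a ha => ⟨_, hlin (M * (2 * (K + 1))) a, fun b hb t ht => by
        rw [(h.traj b hb).acc_eq t (hT ht), (h.traj a ha).acc_eq t (hT ht), mul_assoc]
        exact (h.bounds.source_lip t (hT ht) _ _).trans (mul_le_mul_of_nonneg_left
          (h.separation ha hb (hT ht)).1 (by linarith [h.bounds.one_le]))⟩)
    (continuousOn_of_equicontinuous (f := J) (fun a ha => (hJ a ha).1.continuous_pos)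
      fun a ha => ⟨_, hmod a ha, fun b hb t ht => (h.jacobi_sub_le ha hb (hJ a ha).1 (hJ b hb).1
        (hJ a ha).2.1 (hJ a ha).2.2 (hJ b hb).2.1 (hJ b hb).2.2 (hT ht)).1⟩)
    (continuousOn_of_equicontinuous (f := W) (fun a ha => (hJ a ha).1.continuous_vel)
      fun a ha => ⟨_, hmod a ha, fun b hb t ht => (h.jacobi_sub_le ha hb (hJ a ha).1 (hJ b hb).1
        (hJ a ha).2.1 (hJ a ha).2.2 (hJ b hb).2.1 (hJ b hb).2.2 (hT ht)).2⟩)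
    hJne hinj
  · refine ⟨_, g, hopen, ?_, hg, ?_, fun t ht a ha =>
      ⟨mem_image_of_mem _ (show (t, a) ∈ Ω from ⟨ht, ha⟩), hgV (t, a) ⟨ht, ha⟩⟩⟩
    · rintro _ ⟨p, hp, rfl⟩
      exact ⟨hp.1, mem_univ _⟩
    · set O := (fun p : ℝ × ℝ => (p.1, Z p.2 p.1)) '' Ω with hO
      have hOs : O ⊆ Ici 0 ×ˢ univ := by
        rintro _ ⟨p, hp, rfl⟩
        exact ⟨h.bounds.pos.le.trans hp.1.1.le, mem_univ _⟩
      have hm := ((hu.aestronglyMeasurable hOs).aemeasurable).sub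
        (hg.continuousOn.aemeasurable (μ := volume) hopen.measurableSet)
      have h1 := ae_restrict_of_ae_slice hopen.measurableSet hm (Q := fun _ y => y = 0) ?_
        (ae_of_all _ fun t => ?_)
      · filter_upwards [h1] with p hp using sub_eq_zero.1 hp
      · have h1 : MeasurableSet {q : (ℝ × ℝ) × ℝ | q.1 ∈ O} :=
          hopen.measurableSet.preimage measurable_fst
        have h2 : MeasurableSet {q : (ℝ × ℝ) × ℝ | q.2 = 0} :=
          measurableSet_eq_fun measurable_snd measurable_const
        convert h1.compl.union h2 using 1
        ext q
        simp only [mem_ofPred_eq, mem_union, mem_compl_iff]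
        tauto
      · by_cases ht : t ∈ Ioo t₀ t₁
        -- The null set in the wedge bound depends on the trajectory. Rational starting points give
        -- one null set for all; every other `a` is reached by density, since the flow is Lipschitz
        -- in `a`.
        · have hall : ∀ᵐ x, ∀ q : ℚ, (q : ℝ) ∈ I → |x - y| < R →
              |u t x - V q t| ≤ (K + 1) * |x - Z q t| := ae_all_iff.2 fun q => by
            by_cases hq : (q : ℝ) ∈ I
            · filter_upwards [hcmp t ⟨ht.1.le, ht.2⟩ q hq] with x hx _ using hx
            · exact ae_of_all _ fun x hx => (hq hx).elim
          filter_upwards [hall] with x hx hxO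
          obtain ⟨⟨t', a⟩, ⟨ht', ha⟩, hp⟩ := hxO
          obtain ⟨rfl, rfl⟩ : t' = t ∧ Z a t' = x := by simpa [Prod.ext_iff] using hp
          have e : g (t', Z a t') = V a t' := hgV (t', a) ⟨ht', ha⟩
          simp only [Pi.sub_apply, e]
          by_contra hne
          have hpos : 0 < |u t' (Z a t') - V a t'| := abs_pos.2 hne
          -- Lipschitz constant of the error: `2 (K + 1)` from `V_q - V_a`, and the wedge slope `K +
          -- 1` times the bound `2 (K + 1)` for `Z_q - Z_a`.
          set D := 2 * (K + 1) + (K + 1) * (2 * (K + 1)) with hD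
          have hD0 : 0 < D := by positivity
          obtain ⟨q, hq1, hq2⟩ := exists_rat_btwn (show a <
            min (c + ε) (a + |u t' (Z a t') - V a t'| / D) from
            lt_min ha.2 (lt_add_of_pos_right _ (by positivity)))
          have hqI : (q : ℝ) ∈ I := ⟨ha.1.trans hq1, hq2.trans_le (min_le_left _ _)⟩
          have h2 := hx q hqI (hR t' (hT ht') a ha)
          have hs := h.separation ha hqI (hT ht')
          have h3 : |(q : ℝ) - a| < |u t' (Z a t') - V a t'| / D := by
            rw [abs_of_pos (sub_pos.2 hq1)]
            linarith [hq2.trans_le (min_le_right _ _)]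
          rw [lt_div_iff₀ hD0] at h3
          have h4 : |u t' (Z a t') - V a t'| ≤
              |u t' (Z a t') - V q t'| + |V q t' - V a t'| := abs_sub_le _ _ _
          rw [abs_sub_comm (Z a t')] at h2
          have h5 : (K + 1) * |Z q t' - Z a t'| ≤ (K + 1) * (2 * (K + 1) * |(q : ℝ) - a|) :=
            mul_le_mul_of_nonneg_left hs.1 (by positivity)
          have h6 := hs.2.1
          rw [hD] at h3
          linarith
        · refine ae_of_all _ fun x hx => ?_
          obtain ⟨p, hp, hpe⟩ := hx
          have h1 : p.1 = t := (Prod.ext_iff.1 hpe).1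
          exact (ht (h1 ▸ hp.1)).elim

end IsFlow

/-! ### Agreement and gluing of smooth versions of the solution. -/

lemma nonneg_of_ae {f : ℝ → ℝ} {I : Set ℝ} (hI : IsOpen I) (hf : ContinuousOn f I)
    (h : ∀ᵐ x, x ∈ I → 0 ≤ f x) : ∀ x ∈ I, 0 ≤ f x := by
  intro x hx
  by_contra! hneg
  have h1 : ∀ᶠ y in 𝓝 x, f y < 0 ∧ y ∈ I :=
    ((hf.continuousAt (hI.mem_nhds hx)).eventually_lt continuousAt_const hneg).and
      (hI.mem_nhds hx)
  obtain ⟨s, hs, hso, hxs⟩ := eventually_nhds_iff.1 h1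
  obtain ⟨y, hys, hy⟩ := (Measure.dense_of_ae h).exists_mem_open hso ⟨x, hxs⟩
  exact absurd (hys (hs y hy).2) (not_le.2 (hs y hy).1)

/-- The closed half plane `t ≥ 0`. -/
abbrev halfPlane : Set (ℝ × ℝ) := {p | 0 ≤ p.1}

namespace IsWeakEntropySolution
variable {ubar : ℝ → ℝ} {u : ℝ → ℝ → ℝ}

/-- Two continuous versions of `u` agree where both are defined. -/
lemma eqOn_of_versions (hu : IsWeakEntropySolution ubar u) {O₁ O₂ : Set (ℝ × ℝ)}
    (h1 : IsOpen O₁) (h2 : IsOpen O₂) {g₁ g₂ : ℝ × ℝ → ℝ}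
    (c1 : ContinuousOn g₁ (O₁ ∩ halfPlane)) (c2 : ContinuousOn g₂ (O₂ ∩ halfPlane))
    (e1 : ∀ᵐ p ∂(volume.restrict (O₁ ∩ halfPlane)), u p.1 p.2 = g₁ p)
    (e2 : ∀ᵐ p ∂(volume.restrict (O₂ ∩ halfPlane)), u p.1 p.2 = g₂ p) :
    ∀ p ∈ O₁ ∩ O₂ ∩ halfPlane, g₁ p = g₂ p := by
  rintro ⟨t, x⟩ ⟨⟨hp1, hp2⟩, ht⟩
  have ht' : (0 : ℝ) ≤ t := ht
  have s1 := hu.ae_slice_eq h1 c1 e1 ht'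
  have s2 := hu.ae_slice_eq h2 c2 e2 ht'
  have hsl : Continuous fun x : ℝ => (t, x) := by fun_prop
  have hI : IsOpen ((fun x : ℝ => (t, x)) ⁻¹' (O₁ ∩ O₂)) := (h1.inter h2).preimage hsl
  have k1 : ContinuousOn (fun x => g₁ (t, x)) ((fun x : ℝ => (t, x)) ⁻¹' (O₁ ∩ O₂)) :=
    c1.comp hsl.continuousOn fun x hx => ⟨hx.1, ht'⟩
  have k2 : ContinuousOn (fun x => g₂ (t, x)) ((fun x : ℝ => (t, x)) ⁻¹' (O₁ ∩ O₂)) :=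
    c2.comp hsl.continuousOn fun x hx => ⟨hx.2, ht'⟩
  refine le_antisymm ?_ ?_
  · refine sub_nonneg.1 (nonneg_of_ae hI (k2.sub k1) ?_ x ⟨hp1, hp2⟩)
    filter_upwards [s1, s2] with z z1 z2 hz
    rw [Pi.sub_apply, ← z1 hz.1, ← z2 hz.2, sub_self]
  · refine sub_nonneg.1 (nonneg_of_ae hI (k1.sub k2) ?_ x ⟨hp1, hp2⟩)
    filter_upwards [s1, s2] with z z1 z2 hz
    rw [Pi.sub_apply, ← z1 hz.1, ← z2 hz.2, sub_self]

/-- Countably many `C¹` versions of `u` can be glued together. -/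
lemma exists_glue (hu : IsWeakEntropySolution ubar u) {ι : Type*} [Countable ι]
    {O : ι → Set (ℝ × ℝ)} {g : ι → ℝ × ℝ → ℝ} (hO : ∀ i, IsOpen (O i))
    (hg : ∀ i, ContDiffOn ℝ 1 (g i) (O i ∩ halfPlane))
    (he : ∀ i, ∀ᵐ p ∂(volume.restrict (O i ∩ halfPlane)), u p.1 p.2 = g i p) :
    ∃ w : ℝ × ℝ → ℝ, (∀ i, EqOn w (g i) (O i ∩ halfPlane)) ∧
      ContDiffOn ℝ 1 w ((⋃ i, O i) ∩ halfPlane) ∧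
      ∀ᵐ p ∂(volume.restrict ((⋃ i, O i) ∩ halfPlane)), u p.1 p.2 = w p := by
  classical
  let w : ℝ × ℝ → ℝ := fun p => if h : ∃ i, p ∈ O i then g h.choose p else 0
  have hw : ∀ i, EqOn w (g i) (O i ∩ halfPlane) := fun i p hp => by
    have h : ∃ i, p ∈ O i := ⟨i, hp.1⟩
    simp only [w, dif_pos h]
    exact hu.eqOn_of_versions (hO _) (hO i) (hg _).continuousOn (hg i).continuousOn (he _) (he i)
      p ⟨⟨h.choose_spec, hp.1⟩, hp.2⟩
  refine ⟨w, hw, ?_, ?_⟩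
  · rintro p ⟨hp, hp0⟩
    obtain ⟨i, hi⟩ := mem_iUnion.1 hp
    have h1 : ContDiffWithinAt ℝ 1 w (O i ∩ halfPlane) p :=
      (hg i p ⟨hi, hp0⟩).congr (fun q hq => hw i hq) (hw i ⟨hi, hp0⟩)
    refine h1.mono_of_mem_nhdsWithin ?_
    filter_upwards [self_mem_nhdsWithin, mem_nhdsWithin_of_mem_nhds ((hO i).mem_nhds hi)]
      with q hq hq' using ⟨hq', hq.2⟩
  · rw [iUnion_inter, ae_restrict_iUnion_iff]
    intro i
    have hm : MeasurableSet (O i ∩ halfPlane) :=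
      (hO i).measurableSet.inter (measurableSet_le measurable_const measurable_fst)
    filter_upwards [he i, ae_restrict_mem hm] with p hp hpm
    rw [hp, hw i hpm]

end IsWeakEntropySolution

/-! ### Classical characteristics as trajectories of the second order equation. -/

namespace IsClassicalCharacteristic
variable {ubar : ℝ → ℝ} {u : ℝ → ℝ → ℝ} {xbar T : ℝ} {x : ℝ → ℝ} {v : ℝ × ℝ → ℝ}

lemma continuousOn (hx : IsClassicalCharacteristic u xbar T x v) : ContinuousOn x (Ico 0 T) :=
  fun t ht => (hx.ode t ht).continuousWithinAt

lemma hasDerivAt (hx : IsClassicalCharacteristic u xbar T x v) {t : ℝ} (ht : t ∈ Ioo 0 T) :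
    HasDerivAt x (v (t, x t)) t :=
  (hx.ode t ⟨ht.1.le, ht.2⟩).hasDerivAt (Ico_mem_nhds ht.1 ht.2)

lemma continuousOn_vel (hx : IsClassicalCharacteristic u xbar T x v) :
    ContinuousOn (fun t => v (t, x t)) (Ico 0 T) := by
  obtain ⟨U, _, hUx, hv, _⟩ := hx.classical
  exact hv.continuousOn.comp (continuousOn_id.prodMk hx.continuousOn)
    fun t ht => ⟨hUx t ht, ht.1⟩

/-- Inside the open half plane the neighbourhood in the definition may be taken open. -/
lemma exists_open (hx : IsClassicalCharacteristic u xbar T x v) :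
    ∃ O : Set (ℝ × ℝ), IsOpen O ∧ O ⊆ Ioi 0 ×ˢ univ ∧ (∀ t ∈ Ioo 0 T, (t, x t) ∈ O) ∧
      ContDiffOn ℝ 1 v O ∧ ∀ᵐ p ∂(volume.restrict O), u p.1 p.2 = v p := by
  obtain ⟨U, hU, hUx, hv, he⟩ := hx.classical
  have hsub : U ∩ Ioi 0 ×ˢ univ ⊆ U ∩ {p | 0 ≤ p.1} := fun p hp =>
    ⟨hp.1, show (0 : ℝ) ≤ p.1 from le_of_lt hp.2.1⟩
  exact ⟨U ∩ Ioi 0 ×ˢ univ, hU.inter (isOpen_Ioi.prod isOpen_univ), inter_subset_right,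
    fun t ht => ⟨hUx t ⟨ht.1.le, ht.2⟩, ht.1, mem_univ _⟩, hv.mono hsub,
    ae_restrict_of_ae_restrict_of_subset hsub he⟩

lemma hasDerivAt_vel (hx : IsClassicalCharacteristic u xbar T x v)
    (hu : IsWeakEntropySolution ubar u) {t : ℝ} (ht : t ∈ Ioo 0 T) :
    HasDerivAt (fun t => v (t, x t)) (source (u t) (x t)) t := by
  obtain ⟨O, hO, hO0, hOx, hv, he⟩ := hx.exists_open
  have hp := hOx t ht
  have hd := ((hv.contDiffAt (hO.mem_nhds hp)).differentiableAt one_ne_zero).hasFDerivAt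
  have h1 := hd.comp_hasDerivAt t ((hasDerivAt_id t).prodMk (hx.hasDerivAt ht))
  refine h1.congr_deriv ?_
  have h2 := hu.pde hO hO0 hv he hp
  have e : ((1 : ℝ), v (t, x t)) = (1, 0) + v (t, x t) • ((0 : ℝ), (1 : ℝ)) := by simp
  rw [e, map_add, map_smul, smul_eq_mul, h2]

/-- A classical characteristic stays on the trajectory which it touches. -/
lemma eq_trajectory (hx : IsClassicalCharacteristic u xbar T x v)
    (hu : IsWeakEntropySolution ubar u) {t₀ t₁ M : ℝ} (hB : SlabBounds u t₀ t₁ M)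
    {Z V A : ℝ → ℝ} (hZ : IsTrajectory (fun p => source (u p.1) p.2) t₀ t₁ Z V A)
    (h0 : Z t₀ = x t₀) (hV0 : V t₀ = v (t₀, x t₀)) {t : ℝ} (ht : t₀ ≤ t) (htT : t < T)
    (ht1 : t ≤ t₁) : x t = Z t ∧ v (t, x t) = V t := by
  have hI : ∀ s ∈ Icc t₀ t, s ∈ Ioo 0 T := fun s hs =>
    ⟨hB.pos.trans_le hs.1, hs.2.trans_lt htT⟩
  have h := abs_le_of_second_order (Z := fun t => x t - Z t) (V := fun t => v (t, x t) - V t)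
    (A := fun t => source (u t) (x t) - A t) (a := t₀) (b := t) (δ := 0) (ε := 0) hB.one_le le_rfl
    (fun s hs => ((hx.hasDerivAt (hI s hs)).continuousAt.sub
      (hZ.hasDerivAt_pos s).continuousAt).continuousWithinAt)
    (fun s hs => ((hx.hasDerivAt_vel hu (hI s hs)).continuousAt.sub
      (hZ.hasDerivAt_vel s).continuousAt).continuousWithinAt)
    (fun s hs => ((hx.hasDerivAt (hI s ⟨hs.1, hs.2.le⟩)).sub
      (hZ.hasDerivAt_pos s)).hasDerivWithinAt)
    (fun s hs => ((hx.hasDerivAt_vel hu (hI s ⟨hs.1, hs.2.le⟩)).sub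
      (hZ.hasDerivAt_vel s)).hasDerivWithinAt)
    (fun s hs => by
      have hs' : s ∈ Icc t₀ t₁ := ⟨hs.1, hs.2.le.trans ht1⟩
      rw [hZ.acc_eq s hs', add_zero]
      exact hB.source_lip s hs' _ _) (by simp [h0]) (by simp [hV0]) (t := t) ⟨ht, le_rfl⟩
  rw [add_zero, zero_mul] at h
  exact ⟨sub_eq_zero.1 (abs_nonpos_iff.1 h.1), sub_eq_zero.1 (abs_nonpos_iff.1 h.2)⟩

end IsClassicalCharacteristic

/-! ### Restarting the flow from a Lipschitz slice. -/

namespace IsWeakEntropySolution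
variable {ubar : ℝ → ℝ} {u : ℝ → ℝ → ℝ}

/-- Restarting the solution from a time at which it is `C¹` near a point, and essentially
`K`-Lipschitz in a neighbourhood of size `r`. -/
lemma exists_flow_of_lipschitz (hu : IsWeakEntropySolution ubar u) {t₀ t₁ M K r y ε : ℝ}
    {v₀ v₀' : ℝ → ℝ} (hB : SlabBounds u t₀ t₁ M) (hK : 0 ≤ K)
    (hτ : 4 * ((K + 1) ^ 2 + M) * (t₁ - t₀) ≤ 1) (hτr : 8 * (M + 1) * (t₁ - t₀) ≤ r)
    (hr : 0 < r) (hεr : ε ≤ r / 4)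
    (hd : ∀ a ∈ Ioo (y - ε) (y + ε), HasDerivAt v₀ (v₀' a) a)
    (hc : ContinuousOn v₀' (Ioo (y - ε) (y + ε)))
    (hv : ∀ᵐ x, x ∈ Ioo (y - ε) (y + ε) → u t₀ x = v₀ x)
    (hlip : ∀ᵐ a : ℝ, ∀ᵐ b : ℝ, |a - y| < r → |b - y| < r → |u t₀ a - u t₀ b| ≤ K * |a - b|) :
    ∃ Z V A, IsFlow u t₀ t₁ M K y ε v₀ v₀' Z V A ∧
      ∃ (O : Set (ℝ × ℝ)) (g : ℝ × ℝ → ℝ), IsOpen O ∧ O ⊆ Ioo t₀ t₁ ×ˢ univ ∧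
      ContDiffOn ℝ 1 g O ∧ (∀ᵐ p ∂(volume.restrict O), u p.1 p.2 = g p) ∧
      ∀ t ∈ Ioo t₀ t₁, ∀ a ∈ Ioo (y - ε) (y + ε), (t, Z a t) ∈ O ∧ g (t, Z a t) = V a t := by
  have hM1 := hB.one_le
  have h01 := hB.le
  have hI : IsOpen (Ioo (y - ε) (y + ε)) := isOpen_Ioo
  have hvc : ContinuousOn v₀ (Ioo (y - ε) (y + ε)) := fun a ha =>
    (hd a ha).continuousAt.continuousWithinAt
  have hIr : ∀ a ∈ Ioo (y - ε) (y + ε), |a - y| < r := fun a ha => by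
    rw [abs_lt]; constructor <;> linarith [ha.1, ha.2]
  have hM : ∀ a ∈ Ioo (y - ε) (y + ε), |v₀ a| ≤ M := fun a ha =>
    sub_nonneg.1 <| nonneg_of_ae (f := fun a => M - |v₀ a|) hI
      (continuousOn_const.sub hvc.abs) (by
        filter_upwards [hv, hB.bound t₀ ⟨le_rfl, h01⟩] with x hx hx' hxI
        rw [← hx hxI]
        linarith) a ha
  have hinit : ∀ a ∈ Ioo (y - ε) (y + ε), ∀ᵐ x, |x - y| < r →
      |u t₀ x - v₀ a| ≤ K * |x - a| := by
    -- The Lipschitz hypothesis concerns almost every pair only. It is transferred to each `a` by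
    -- approximation with points of a dense set at which `u t₀` equals the continuous `v₀`.
    have hD : Dense {a | (∀ᵐ b : ℝ, |a - y| < r → |b - y| < r →
        |u t₀ a - u t₀ b| ≤ K * |a - b|) ∧ (a ∈ Ioo (y - ε) (y + ε) → u t₀ a = v₀ a)} :=
      Measure.dense_of_ae (hlip.and hv)
    intro a ha
    have hseq : ∀ n : ℕ, ∃ q, ((∀ᵐ b : ℝ, |q - y| < r → |b - y| < r →
        |u t₀ q - u t₀ b| ≤ K * |q - b|) ∧ (q ∈ Ioo (y - ε) (y + ε) → u t₀ q = v₀ q)) ∧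
        a < q ∧ q < min (y + ε) (a + 1 / ((n : ℝ) + 1)) := fun n => by
      obtain ⟨q, hq, hq'⟩ := hD.exists_between (lt_min ha.2
        (lt_add_of_pos_right a (Nat.one_div_pos_of_nat (α := ℝ) (n := n))))
      exact ⟨q, hq, hq'⟩
    choose q hq hq1 hq2 using hseq
    have hqI : ∀ n, q n ∈ Ioo (y - ε) (y + ε) := fun n =>
      ⟨ha.1.trans (hq1 n), (hq2 n).trans_le (min_le_left _ _)⟩
    have hlim : Tendsto q atTop (𝓝 a) := by
      refine tendsto_of_tendsto_of_tendsto_of_le_of_le tendsto_const_nhds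
        (h := fun n : ℕ => a + 1 / ((n : ℝ) + 1)) ?_ (fun n => (hq1 n).le)
        fun n => ((hq2 n).trans_le (min_le_right _ _)).le
      simpa using tendsto_one_div_add_atTop_nhds_zero_nat.const_add a
    filter_upwards [ae_all_iff.2 fun n => (hq n).1] with x hx hxr
    have h1 : ∀ n, |u t₀ x - v₀ (q n)| ≤ K * |x - q n| := fun n => by
      rw [← (hq n).2 (hqI n), abs_sub_comm, abs_sub_comm x]
      exact hx n (hIr _ (hqI n)) hxr
    have l1 : Tendsto (fun n => |u t₀ x - v₀ (q n)|) atTop (𝓝 |u t₀ x - v₀ a|) :=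
      (tendsto_const_nhds.sub ((hd a ha).continuousAt.tendsto.comp hlim)).abs
    have l2 : Tendsto (fun n => K * |x - q n|) atTop (𝓝 (K * |x - a|)) :=
      ((tendsto_const_nhds.sub hlim).abs).const_mul K
    exact le_of_tendsto_of_tendsto' l1 l2 h1
  have hL : ∀ a ∈ Ioo (y - ε) (y + ε), ∀ b ∈ Ioo (y - ε) (y + ε), |v₀ b - v₀ a| ≤ K * |b - a| :=
    fun a ha b hb => sub_nonneg.1 <| nonneg_of_ae (f := fun b => K * |b - a| - |v₀ b - v₀ a|) hI
      ((by fun_prop : Continuous fun b => K * |b - a|).continuousOn.sub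
        (hvc.sub continuousOn_const).abs) (by
        filter_upwards [hinit a ha, hv] with x hx hx' hxI
        rw [← hx' hxI]
        linarith [hx (hIr x hxI)]) b hb
  obtain ⟨Z, V, A, hF⟩ := hu.exists_flow hB hK hτ hd hc hM hL
  refine ⟨Z, V, A, hF, hF.exists_contDiffOn hu (y := y) (R := r / 2) (fun t ht a ha => ?_)
    fun t ht a ha => ?_⟩
  · have hS := hu.entropySlab hB.pos h01 hB.bound
    have hT := hF.traj a ha
    have hT' : IsTrajectory (fun p => source (u (clamp t₀ t₁ p.1)) p.2) t₀ t₁ (Z a) (V a) (A a) :=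
      ⟨hT.continuous_acc, hT.hasDerivAt_pos, hT.hasDerivAt_vel, fun t ht => by
        rw [hT.acc_eq t ht, clamp_of_mem ht]⟩
    have h1 := hS.abs_sub_le_of_trajectory hT' hK (by linarith)
      (fun p => hB.source_le _ (clamp_mem h01 _) _)
      (fun t x y => hB.source_lip _ (clamp_mem h01 _) x y) hτ
      (by rw [hF.vel_init a ha]; exact hM a ha) hr (c := y)
      (by rw [hF.vel_init a ha, hF.pos_init a ha]; exact hinit a ha) ht
    filter_upwards [h1] with x hx hxr
    refine hx ?_
    -- Since `8 (M + 1) (t - t₀) ≤ r`, the cone has lost at most `r²/4` from `r²`, and it still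
    -- contains the points with `|x - y| < r/2`.
    have h2 : (x - y) ^ 2 < (r / 2) ^ 2 := by
      rw [← sq_abs]
      exact pow_lt_pow_left₀ hxr (abs_nonneg _) two_ne_zero
    have h3 : 8 * (M + 1) * (t - t₀) ≤ r := (mul_le_mul_of_nonneg_left
      (by linarith [ht.2]) (by linarith)).trans hτr
    nlinarith
  -- A trajectory starts within `ε ≤ r/4` of `y` and drifts by at most `r/8`, so it stays within
  -- `r/2`.
  · have h1 := hF.abs_pos_sub_le ha ht
    have h3 : 8 * (M + 1) * (t - t₀) ≤ r := (mul_le_mul_of_nonneg_left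
      (by linarith [ht.2]) (by linarith)).trans hτr
    have h4 : |a - y| < ε := by rw [abs_lt]; constructor <;> linarith [ha.1, ha.2]
    have h5 := abs_sub_le (Z a t) a y
    linarith

end IsWeakEntropySolution

/-! ### Uniqueness of classical characteristics and existence of a maximal one. -/

lemma Ico_mem_nhdsWithin_Ico {T S t : ℝ} (ht : t < T) : Ico 0 T ∈ 𝓝[Ico 0 S] t := by
  filter_upwards [self_mem_nhdsWithin, mem_nhdsWithin_of_mem_nhds (Iio_mem_nhds ht)] with s hs hs'
  exact ⟨hs.1, hs'⟩

namespace IsClassicalCharacteristic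
variable {ubar : ℝ → ℝ} {u : ℝ → ℝ → ℝ} {xbar T T' : ℝ} {x x' : ℝ → ℝ} {v v' : ℝ × ℝ → ℝ}

lemma vel_eq (hx : IsClassicalCharacteristic u xbar T x v)
    (hx' : IsClassicalCharacteristic u xbar T' x' v') (hu : IsWeakEntropySolution ubar u) {t : ℝ}
    (ht : 0 ≤ t) (htT : t < T) (htT' : t < T') (he : x t = x' t) : v (t, x t) = v' (t, x t) := by
  obtain ⟨U, hU, hUx, hv, hue⟩ := hx.classical
  obtain ⟨U', hU', hUx', hv', hue'⟩ := hx'.classical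
  refine hu.eqOn_of_versions hU hU' hv.continuousOn hv'.continuousOn hue hue' _
    ⟨⟨hUx t ⟨ht, htT⟩, ?_⟩, ht⟩
  rw [he]
  exact hUx' t ⟨ht, htT'⟩

/-- The solution is assumed bounded only on compact time intervals in `(0, ∞)`, so the Lipschitz
bound on the source is not available down to `t = 0`. Near the initial time uniqueness rests instead
on the first order equation `x' = v`, with `v` Lipschitz near `(0, xbar)` because it is `C¹` up to
the boundary of the convex half plane. -/
lemma eventually_eq (hx : IsClassicalCharacteristic u xbar T x v)
    (hx' : IsClassicalCharacteristic u xbar T' x' v') (hu : IsWeakEntropySolution ubar u) :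
    ∃ δ > 0, δ < T ∧ δ < T' ∧ ∀ t ∈ Icc 0 δ, x t = x' t := by
  obtain ⟨U, hU, hUx, hv, hue⟩ := hx.classical
  obtain ⟨U', hU', hUx', hv', hue'⟩ := hx'.classical
  have hT := hx.pos
  have hT' := hx'.pos
  have hpU : ((0 : ℝ), xbar) ∈ U := by
    have := hUx 0 ⟨le_rfl, hT⟩
    rwa [hx.initial] at this
  have hconv : Convex ℝ halfPlane := by
    intro p hp q hq a b ha hb _
    exact add_nonneg (mul_nonneg ha hp) (mul_nonneg hb hq)
  have hvw : ContDiffWithinAt ℝ 1 v halfPlane (0, xbar) :=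
    (hv _ ⟨hpU, le_refl (0 : ℝ)⟩).mono_of_mem_nhdsWithin (by
      filter_upwards [self_mem_nhdsWithin, mem_nhdsWithin_of_mem_nhds (hU.mem_nhds hpU)]
        with p hp hp' using ⟨hp', hp⟩)
  obtain ⟨K, W, hW, hLip⟩ := hvw.exists_lipschitzOnWith hconv
  have hmem : ∀ {T : ℝ} {x : ℝ → ℝ} {v : ℝ × ℝ → ℝ} (_ : IsClassicalCharacteristic u xbar T x v),
      ∀ᶠ t in 𝓝[≥] (0 : ℝ), (t, x t) ∈ W ∩ U := fun {T x v} hx => by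
    have h1 : Tendsto (fun t => (t, x t)) (𝓝[≥] (0 : ℝ)) (𝓝[halfPlane] (0, xbar)) := by
      refine tendsto_nhdsWithin_iff.2 ⟨?_, ?_⟩
      · have hc := hx.continuousOn 0 ⟨le_rfl, hx.pos⟩
        rw [ContinuousWithinAt, nhdsWithin_Ico_eq_nhdsGE hx.pos, hx.initial] at hc
        exact (tendsto_id.mono_left nhdsWithin_le_nhds).prodMk_nhds hc
      · filter_upwards [self_mem_nhdsWithin] with t ht using ht
    exact h1 (inter_mem hW (mem_nhdsWithin_of_mem_nhds (hU.mem_nhds hpU)))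
  obtain ⟨δ₀, hδ₀, hsub⟩ := mem_nhdsGE_iff_exists_Icc_subset.1 ((hmem hx).and (hmem hx'))
  obtain ⟨δ, hδ, hδ1⟩ : ∃ δ > 0, δ < min δ₀ (min T T') :=
    ⟨_, half_pos (lt_min hδ₀ (lt_min hT hT')), half_lt_self (lt_min hδ₀ (lt_min hT hT'))⟩
  have k0 : δ < δ₀ := hδ1.trans_le (min_le_left _ _)
  have k1 : δ < T := hδ1.trans_le ((min_le_right _ _).trans (min_le_left _ _))
  have k2 : δ < T' := hδ1.trans_le ((min_le_right _ _).trans (min_le_right _ _))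
  refine ⟨δ, hδ, k1, k2, fun t ht => ?_⟩
  have hder : ∀ {T : ℝ} {x : ℝ → ℝ} {v : ℝ × ℝ → ℝ} (_ : IsClassicalCharacteristic u xbar T x v),
      δ < T → ∀ t ∈ Ico 0 δ, HasDerivWithinAt x (v (t, x t)) (Ici t) t :=
    fun {T x v} hx hδT t ht => (hx.ode t ⟨ht.1, ht.2.trans hδT⟩).mono_of_mem_nhdsWithin
      (mem_of_superset (Ico_mem_nhdsGE (ht.2.trans hδT)) (Ico_subset_Ico_left ht.1))
  refine sub_eq_zero.1 (eq_zero_of_abs_deriv_le_mul_abs_self_of_eq_zero_right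
    (f := fun t => x t - x' t) (f' := fun t => v (t, x t) - v' (t, x' t)) (K := K) (a := 0)
    (b := δ) ((hx.continuousOn.mono fun s hs => ⟨hs.1, hs.2.trans_lt k1⟩).sub
      (hx'.continuousOn.mono fun s hs => ⟨hs.1, hs.2.trans_lt k2⟩))
    (fun s hs => (hder hx k1 s hs).sub (hder hx' k2 s hs))
    (by simp [hx.initial, hx'.initial]) (fun s hs => ?_) t ht)
  have hsW := hsub ⟨hs.1, hs.2.le.trans k0.le⟩
  have hveq : v (s, x' s) = v' (s, x' s) :=
    hu.eqOn_of_versions hU hU' hv.continuousOn hv'.continuousOn hue hue' _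
      ⟨⟨hsW.2.2, hUx' s ⟨hs.1, hs.2.trans k2⟩⟩, hs.1⟩
  rw [← hveq]
  have := hLip.dist_le_mul _ hsW.1.1 _ hsW.2.1
  rwa [Prod.dist_eq, dist_self, max_eq_right dist_nonneg, Real.dist_eq, Real.dist_eq] at this

/-- Classical characteristics through a given point are unique. -/
lemma eq_of_lt (hx : IsClassicalCharacteristic u xbar T x v)
    (hx' : IsClassicalCharacteristic u xbar T' x' v') (hu : IsWeakEntropySolution ubar u) {t : ℝ}
    (ht : 0 ≤ t) (htT : t < T) (htT' : t < T') : x t = x' t := by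
  obtain ⟨δ, hδ, h1, h2, he⟩ := hx.eventually_eq hx' hu
  rcases le_or_gt t δ with htδ | htδ
  · exact he t ⟨ht, htδ⟩
  -- From the positive time `δ` on, both curves solve `x'' = source(x)` with a Lipschitz right-hand
  -- side, and they have the same position and velocity at `δ`.
  obtain ⟨M, hB⟩ := hu.exists_slabBounds hδ htδ
  have hI : ∀ s ∈ Icc δ t, s ∈ Ioo 0 T ∧ s ∈ Ioo 0 T' := fun s hs =>
    ⟨⟨hδ.trans_le hs.1, hs.2.trans_lt htT⟩, hδ.trans_le hs.1, hs.2.trans_lt htT'⟩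
  have hδe := he δ ⟨hδ.le, le_rfl⟩
  have h := abs_le_of_second_order (Z := fun t => x t - x' t)
    (V := fun t => v (t, x t) - v' (t, x' t))
    (A := fun t => source (u t) (x t) - source (u t) (x' t)) (a := δ) (b := t) (δ := 0) (ε := 0)
    hB.one_le le_rfl
    (fun s hs => ((hx.hasDerivAt (hI s hs).1).continuousAt.sub
      (hx'.hasDerivAt (hI s hs).2).continuousAt).continuousWithinAt)
    (fun s hs => ((hx.hasDerivAt_vel hu (hI s hs).1).continuousAt.sub
      (hx'.hasDerivAt_vel hu (hI s hs).2).continuousAt).continuousWithinAt)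
    (fun s hs => ((hx.hasDerivAt (hI s ⟨hs.1, hs.2.le⟩).1).sub
      (hx'.hasDerivAt (hI s ⟨hs.1, hs.2.le⟩).2)).hasDerivWithinAt)
    (fun s hs => ((hx.hasDerivAt_vel hu (hI s ⟨hs.1, hs.2.le⟩).1).sub
      (hx'.hasDerivAt_vel hu (hI s ⟨hs.1, hs.2.le⟩).2)).hasDerivWithinAt)
    (fun s hs => by
      rw [add_zero]
      exact hB.source_lip s ⟨hs.1, hs.2.le⟩ _ _) (by simp [hδe])
    (by simp [hx.vel_eq hx' hu hδ.le h1 h2 hδe, ← hδe]) (t := t) ⟨htδ.le, le_rfl⟩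
  rw [add_zero, zero_mul] at h
  exact sub_eq_zero.1 (abs_nonpos_iff.1 h.1)

end IsClassicalCharacteristic

/-- If the life times of the classical characteristics through `xbar` are bounded, there is a
maximal one. -/
lemma IsWeakEntropySolution.exists_maximal {ubar : ℝ → ℝ} {u : ℝ → ℝ → ℝ} {xbar : ℝ}
    (hu : IsWeakEntropySolution ubar u)
    (hne : {T | ∃ x v, IsClassicalCharacteristic u xbar T x v}.Nonempty)
    (hb : BddAbove {T | ∃ x v, IsClassicalCharacteristic u xbar T x v}) :
    ∃ S x v, IsMaximalCharacteristic u xbar S x v := by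
  classical
  set 𝒯 := {T | ∃ x v, IsClassicalCharacteristic u xbar T x v} with h𝒯
  -- A sequence of life times tending to the supremum suffices, and keeps the gluing countable.
  obtain ⟨T, -, hTlim, hT⟩ := exists_seq_tendsto_sSup hne hb
  choose x v hx using hT
  set S := sSup 𝒯 with hS
  have hTS : ∀ n, T n ≤ S := fun n => le_csSup hb ⟨x n, v n, hx n⟩
  choose U hU hUx hv hue using fun n => (hx n).classical
  have hex : ∀ {t}, t < S → ∃ n, t < T n := fun ht => (hTlim.eventually (lt_mem_nhds ht)).exists
  obtain ⟨w, hw, hwc, hwe⟩ := hu.exists_glue (O := U) (g := v) hU hv hue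
  let y : ℝ → ℝ := fun t => if h : ∃ n, t < T n then x h.choose t else 0
  have hy : ∀ n, ∀ t ∈ Ico 0 (T n), y t = x n t := fun n t ht => by
    have h : ∃ n, t < T n := ⟨n, ht.2⟩
    simp only [y, dif_pos h]
    exact (hx _).eq_of_lt (hx n) hu ht.1 h.choose_spec ht.2
  refine ⟨S, y, w, ⟨(hx 0).pos.trans_le (hTS 0), ?_, ⟨_, isOpen_iUnion hU, ?_, hwc, hwe⟩, ?_⟩,
    fun S' x' v' hx' => ⟨le_csSup hb ⟨x', v', hx'⟩, fun t ht => ?_⟩⟩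
  · rw [hy 0 0 ⟨le_rfl, (hx 0).pos⟩, (hx 0).initial]
  · intro t ht
    obtain ⟨n, hn⟩ := hex ht.2
    rw [hy n t ⟨ht.1, hn⟩]
    exact mem_iUnion.2 ⟨n, hUx n t ⟨ht.1, hn⟩⟩
  · intro t ht
    obtain ⟨n, hn⟩ := hex ht.2
    have h1 := ((hx n).ode t ⟨ht.1, hn⟩).congr (hy n) (hy n t ⟨ht.1, hn⟩)
    have h2 : w (t, y t) = v n (t, x n t) := by
      rw [hy n t ⟨ht.1, hn⟩]
      exact hw n ⟨hUx n t ⟨ht.1, hn⟩, ht.1⟩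
    rw [h2]
    exact h1.mono_of_mem_nhdsWithin (Ico_mem_nhdsWithin_Ico hn)
  · obtain ⟨n, hn⟩ := hex (ht.2.trans_le (le_csSup hb ⟨x', v', hx'⟩))
    rw [hy n t ⟨ht.1, hn⟩]
    exact hx'.eq_of_lt (hx n) hu ht.1 ht.2 hn

lemma exists_pos_forall_mul_le {A B C : ℝ} (hC : 0 < C) :
    ∃ δ > 0, δ < C ∧ A * δ ≤ 1 ∧ B * δ ≤ C := by
  have h1 : Tendsto (fun δ : ℝ => A * δ) (𝓝[>] 0) (𝓝 (A * 0)) :=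
    ((continuous_const_mul A).tendsto 0).mono_left nhdsWithin_le_nhds
  have h2 : Tendsto (fun δ : ℝ => B * δ) (𝓝[>] 0) (𝓝 (B * 0)) :=
    ((continuous_const_mul B).tendsto 0).mono_left nhdsWithin_le_nhds
  rw [mul_zero] at h1 h2
  obtain ⟨δ, ⟨⟨h3, h4⟩, h5⟩, h6⟩ := (((h1.eventually (ge_mem_nhds one_pos)).and
    (h2.eventually (ge_mem_nhds hC))).and
    (mem_nhdsWithin_of_mem_nhds (Iio_mem_nhds hC)) |>.and self_mem_nhdsWithin).exists
  exact ⟨δ, h6, h5, h3, h4⟩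

/-! ### Continuation of characteristics and propagation of slope bounds in a smooth tube. -/

namespace IsClassicalCharacteristic
variable {ubar : ℝ → ℝ} {u : ℝ → ℝ → ℝ} {xbar T S : ℝ} {x : ℝ → ℝ} {v : ℝ × ℝ → ℝ}

/-- Near the characteristic, the slices of the `C¹` version are continuously differentiable. -/
lemma exists_slice (hx : IsClassicalCharacteristic u xbar T x v)
    (hu : IsWeakEntropySolution ubar u) {t : ℝ} (ht : t ∈ Ioo 0 T) {r : ℝ} (hr : 0 < r) :
    ∃ ε > 0, ε ≤ r ∧ (∀ a ∈ Ioo (x t - ε) (x t + ε),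
      HasDerivAt (fun a => v (t, a)) (fderiv ℝ v (t, a) (0, 1)) a) ∧
      ContinuousOn (fun a => fderiv ℝ v (t, a) (0, 1)) (Ioo (x t - ε) (x t + ε)) ∧
      ∀ᵐ a, a ∈ Ioo (x t - ε) (x t + ε) → u t a = v (t, a) := by
  obtain ⟨O, hO, hO0, hOx, hv, he⟩ := hx.exists_open
  have hsl : Continuous fun a : ℝ => (t, a) := by fun_prop
  obtain ⟨ε, hε, hball⟩ := Metric.isOpen_iff.1 (hO.preimage hsl) (x t) (hOx t ht)
  have hsub : ∀ a ∈ Ioo (x t - min ε r) (x t + min ε r), (t, a) ∈ O := fun a ha => by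
    refine hball ?_
    rw [Real.ball_eq_Ioo]
    exact ⟨by linarith [ha.1, min_le_left ε r], by linarith [ha.2, min_le_left ε r]⟩
  have hinter : O ∩ {p | 0 ≤ p.1} = O := inter_eq_left.2 fun p hp =>
    show (0 : ℝ) ≤ p.1 from le_of_lt (hO0 hp).1
  refine ⟨min ε r, lt_min hε hr, min_le_right _ _, fun a ha => ?_, ?_, ?_⟩
  · have hd := ((hv.contDiffAt (hO.mem_nhds (hsub a ha))).differentiableAt one_ne_zero).hasFDerivAt
    exact hd.comp_hasDerivAt a ((hasDerivAt_const a t).prodMk (hasDerivAt_id a))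
  · have hc := (hv.continuousOn_fderiv_of_isOpen hO le_rfl).clm_apply
      (continuousOn_const (c := ((0 : ℝ), (1 : ℝ))))
    exact hc.comp hsl.continuousOn hsub
  · have := hu.ae_slice_eq hO (g := v) (by rw [hinter]; exact hv.continuousOn)
      (by rw [hinter]; exact he) ht.1.le
    filter_upwards [this] with a ha haI using ha (hsub a haI)

/-- A classical characteristic around which `u` has bounded slope can be continued. -/
lemma exists_extension (hx : IsClassicalCharacteristic u xbar S x v)
    (hu : IsWeakEntropySolution ubar u) (hb : HasBoundedSlopeAroundBefore u x S) :
    ∃ S' x' v', S < S' ∧ IsClassicalCharacteristic u xbar S' x' v' := by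
  classical
  obtain ⟨r, hr, K₀, hK₀⟩ := hb
  have hS := hx.pos
  set K := max K₀ 0 with hKdef
  have hK : 0 ≤ K := le_max_right _ _
  obtain ⟨M, hB0⟩ := hu.exists_slabBounds (a := S / 2) (b := S + 1) (by linarith) (by linarith)
  obtain ⟨δ, hδ, hδC, hδ1, hδ2⟩ := exists_pos_forall_mul_le (A := 4 * ((K + 1) ^ 2 + M))
    (B := 8 * (M + 1)) (C := min r (min S 1)) (lt_min hr (lt_min hS one_pos))
  have hδr : δ < r := hδC.trans_le (min_le_left _ _)
  have hδS : δ < S := hδC.trans_le ((min_le_right _ _).trans (min_le_left _ _))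
  have hδ1' : δ < 1 := hδC.trans_le ((min_le_right _ _).trans (min_le_right _ _))
  -- The admissible running time `δ` depends on bounds that are uniform up to `S`. Restarting half
  -- of it before `S` carries the flow beyond `S`.
  set t₀ := S - δ / 2 with ht₀
  set t₁ := S + δ / 2 with ht₁
  have hB : SlabBounds u t₀ t₁ M := hB0.mono (by linarith) (by linarith) (by linarith)
  have hsub : t₁ - t₀ = δ := by rw [ht₀, ht₁]; ring
  have ht₀m : t₀ ∈ Ioo 0 S := ⟨by linarith, by linarith⟩
  obtain ⟨ε, hε, hεr, hd, hc, hv⟩ := hx.exists_slice hu ht₀m (r := r / 4) (by positivity)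
  obtain ⟨Z, V, A, hF, O, g, hO, hO0, hg, hge, hgV⟩ := hu.exists_flow_of_lipschitz hB hK
    (by rw [hsub]; exact hδ1) (by rw [hsub]; exact hδ2.trans (min_le_left _ _)) hr hεr hd hc hv (by
      filter_upwards [hK₀ t₀ ht₀m.1 (by linarith) ht₀m.2] with a ha
      filter_upwards [ha] with b hb hay hby
      have htub : ∀ c, |c - x t₀| < r → (t₀, c) ∈ tube x S r := fun c hc =>
        ⟨ht₀m.1, by simp only; linarith, ht₀m.2, hc⟩
      refine (hb (htub a hay) (htub b hby)).trans ?_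
      exact mul_le_mul_of_nonneg_right (le_max_left _ _) (abs_nonneg _))
  have hyI : x t₀ ∈ Ioo (x t₀ - ε) (x t₀ + ε) := ⟨by linarith, by linarith⟩
  set z := Z (x t₀) with hz
  have hT := hF.traj _ hyI
  have heq : ∀ t, t₀ ≤ t → t < S → x t = z t := fun t h1 h2 =>
    (hx.eq_trajectory hu hB hT (hF.pos_init _ hyI) (hF.vel_init _ hyI) h1 h2 (by linarith)).1
  obtain ⟨U, hU, hUx, hvU, hue⟩ := hx.classical
  have hOH : O ∩ halfPlane = O := inter_eq_left.2 fun p hp =>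
    show (0 : ℝ) ≤ p.1 from (ht₀m.1.trans (hO0 hp).1.1).le
  -- The old neighbourhood `U` serves for times before `S`; the swept region `O` takes over from `S`
  -- on.
  obtain ⟨w, hw, hwc, hwe⟩ := hu.exists_glue (ι := Bool) (O := fun b => cond b U O)
    (g := fun b => cond b v g) (by rintro (_ | _); exacts [hO, hU])
    (by rintro (_ | _)
        · simp only [cond_false]; rw [hOH]; exact hg
        · exact hvU)
    (by rintro (_ | _)
        · simp only [cond_false]; rw [hOH]; exact hge
        · exact hue)
  let x' : ℝ → ℝ := fun t => if t < S then x t else z t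
  have hx'1 : ∀ t, t < S → x' t = x t := fun t ht => if_pos ht
  have hx'2 : ∀ t, t₀ ≤ t → x' t = z t := fun t ht => by
    by_cases h : t < S
    · rw [hx'1 t h, heq t ht h]
    · exact if_neg h
  have hmO : ∀ t ∈ Ioo t₀ t₁, (t, x' t) ∈ O ∧ g (t, x' t) = V (x t₀) t := fun t ht => by
    rw [hx'2 t ht.1.le]
    exact hgV t ht _ hyI
  refine ⟨t₁, x', w, by linarith, ⟨by linarith, by rw [hx'1 0 hS, hx.initial],
    ⟨_, isOpen_iUnion (by rintro (_ | _); exacts [hO, hU]), fun t ht => ?_, hwc, hwe⟩,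
    fun t ht => ?_⟩⟩
  · by_cases h : t < S
    · rw [hx'1 t h]
      exact mem_iUnion.2 ⟨true, hUx t ⟨ht.1, h⟩⟩
    · exact mem_iUnion.2 ⟨false, (hmO t ⟨by linarith [not_lt.1 h], ht.2⟩).1⟩
  · by_cases h : t < S
    · have h1 := (hx.ode t ⟨ht.1, h⟩).congr (fun s hs => hx'1 s hs.2) (hx'1 t h)
      have h2 : w (t, x' t) = v (t, x t) := by
        rw [hx'1 t h]
        exact hw true ⟨hUx t ⟨ht.1, h⟩, ht.1⟩
      rw [h2]
      exact h1.mono_of_mem_nhdsWithin (Ico_mem_nhdsWithin_Ico h)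
    · have htm : t ∈ Ioo t₀ t₁ := ⟨by linarith [not_lt.1 h], ht.2⟩
      have h1 : HasDerivAt x' (V (x t₀) t) t := by
        refine (hT.hasDerivAt_pos t).congr_of_eventuallyEq ?_
        filter_upwards [Ioi_mem_nhds htm.1] with s hs using hx'2 s (le_of_lt hs)
      have h2 : w (t, x' t) = V (x t₀) t := by
        rw [← (hmO t htm).2]
        exact hw false ⟨(hmO t htm).1, ht.1⟩
      rw [h2]
      exact h1.hasDerivWithinAt

end IsClassicalCharacteristic

/-- The curve may move with a speed `w` different from `g`; the mismatch costs `(g - w) g_x`. This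
serves both for the flow inside a smooth tube and for parallel translates of the characteristic. -/
lemma hasDerivAt_comp_of_pde {g : ℝ × ℝ → ℝ} {Z : ℝ → ℝ} {w f t : ℝ}
    (hg : DifferentiableAt ℝ g (t, Z t)) (hZ : HasDerivAt Z w t)
    (hpde : fderiv ℝ g (t, Z t) (1, 0) + g (t, Z t) * fderiv ℝ g (t, Z t) (0, 1) = f) :
    HasDerivAt (fun t => g (t, Z t)) (f - (g (t, Z t) - w) * fderiv ℝ g (t, Z t) (0, 1)) t := by
  have h1 := hg.hasFDerivAt.comp_hasDerivAt t ((hasDerivAt_id t).prodMk hZ)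
  refine h1.congr_deriv ?_
  have e : ((1 : ℝ), w) = (1, 0) + w • ((0 : ℝ), (1 : ℝ)) := by simp
  rw [e, map_add, map_smul, smul_eq_mul, ← hpde]
  ring

namespace IsClassicalCharacteristic
variable {ubar : ℝ → ℝ} {u : ℝ → ℝ → ℝ} {xbar T S : ℝ} {x : ℝ → ℝ} {v : ℝ × ℝ → ℝ}

lemma slope_eq_fderiv (hx : IsClassicalCharacteristic u xbar T x v)
    (hu : IsWeakEntropySolution ubar u) {t : ℝ} (ht : t ∈ Ioo 0 T) :
    slope v x t = fderiv ℝ v (t, x t) (0, 1) := by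
  obtain ⟨ε, hε, -, hd, -⟩ := hx.exists_slice hu ht one_pos
  exact (hd (x t) ⟨by linarith, by linarith⟩).deriv

lemma isOpen_tube (hx : IsClassicalCharacteristic u xbar S x v) (r : ℝ) :
    IsOpen (tube x S r) := by
  have h1 : IsOpen (Ioo (max 0 (S - r)) S ×ˢ (univ : Set ℝ)) := isOpen_Ioo.prod isOpen_univ
  have h2 : ContinuousOn (fun p : ℝ × ℝ => |p.2 - x p.1|)
      (Ioo (max 0 (S - r)) S ×ˢ (univ : Set ℝ)) := by
    refine (continuousOn_snd.sub (hx.continuousOn.comp continuousOn_fst fun p hp => ?_)).abs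
    exact ⟨(le_max_left _ _).trans hp.1.1.le, hp.1.2⟩
  convert h2.isOpen_inter_preimage h1 (isOpen_Iio (a := r)) using 1
  ext p
  simp only [tube, mem_ofPred_eq, mem_inter_iff, mem_prod, mem_Ioo, max_lt_iff, mem_univ, and_true,
    mem_preimage, mem_Iio, and_assoc]

/-- If `u` is smooth around the characteristic and its slope is at most `C` at a time sufficiently
close to `S`, then its slope stays bounded in a tube up to time `S`. -/
lemma hasBoundedSlope_of_smooth (hx : IsClassicalCharacteristic u xbar S x v)
    (hu : IsWeakEntropySolution ubar u) (hs : IsSmoothAroundBefore u x S) (C : ℝ) :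
    ∃ δ > 0, ∀ t₁ ∈ Ioo (S - δ) S, |slope v x t₁| ≤ C → HasBoundedSlopeAroundBefore u x S := by
  obtain ⟨r, hr, g, hg, hge⟩ := hs
  have hS := hx.pos
  obtain ⟨M, hB0⟩ := hu.exists_slabBounds (a := S / 2) (b := S + 1) (by linarith) (by linarith)
  -- The margin of one makes `K` a slope bound on a neighbourhood of the foot. The length `δ` is
  -- chosen from `K`, `M`, `r`, `S` before `t₁` is given, so that any `t₁` in the last `δ` units
  -- allows the flow to reach `S`.
  set K := |C| + 1 with hKdef
  have hK : 0 ≤ K := by positivity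
  obtain ⟨δ, hδ, hδC, hδ1, -⟩ := exists_pos_forall_mul_le (A := 4 * ((K + 1) ^ 2 + M))
    (B := 0) (C := min r (S / 2)) (lt_min hr (by positivity))
  have hδr : δ < r := hδC.trans_le (min_le_left _ _)
  have hδS : δ < S / 2 := hδC.trans_le (min_le_right _ _)
  refine ⟨δ, hδ, fun t₁ ht₁ hC => ?_⟩
  have ht₁m : t₁ ∈ Ioo 0 S := ⟨by linarith [ht₁.1], ht₁.2⟩
  have hB : SlabBounds u t₁ S M := hB0.mono (by linarith [ht₁.1]) ht₁.2.le (by linarith)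
  set y := x t₁ with hy
  have hto := hx.isOpen_tube r
  have htub0 : tube x S r ⊆ Ioi 0 ×ˢ univ := fun p hp => ⟨hp.1, mem_univ _⟩
  -- a neighbourhood of the foot of the flow
  obtain ⟨ε₀, hε₀, hε₀r, hd₀, hc₀, hv₀⟩ := hx.exists_slice hu ht₁m (r := r / (4 * (K + 1)))
    (by positivity)
  obtain ⟨ε, hε, hεε₀, hεK⟩ : ∃ ε > 0, ε ≤ ε₀ ∧ ∀ a ∈ Ioo (y - ε) (y + ε),
      |fderiv ℝ v (t₁, a) (0, 1)| ≤ K := by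
    have hyI : y ∈ Ioo (y - ε₀) (y + ε₀) := ⟨by linarith, by linarith⟩
    have h1 : ∀ᶠ a in 𝓝 y, |fderiv ℝ v (t₁, a) (0, 1)| < K := by
      refine ((hc₀.continuousAt (isOpen_Ioo.mem_nhds hyI)).abs).eventually_lt continuousAt_const ?_
      rw [← hx.slope_eq_fderiv hu ht₁m]
      linarith [le_abs_self C]
    obtain ⟨ε, hε, hb⟩ := Metric.eventually_nhds_iff_ball.1 h1
    refine ⟨min ε ε₀, lt_min hε hε₀, min_le_right _ _, fun a ha => (hb a ?_).le⟩
    rw [Real.ball_eq_Ioo]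
    exact ⟨by linarith [ha.1, min_le_left ε ε₀], by linarith [ha.2, min_le_left ε ε₀]⟩
  have hII : Ioo (y - ε) (y + ε) ⊆ Ioo (y - ε₀) (y + ε₀) :=
    Ioo_subset_Ioo (by linarith) (by linarith)
  have hI : IsOpen (Ioo (y - ε) (y + ε)) := isOpen_Ioo
  have hd := fun a ha => hd₀ a (hII ha)
  have hvc : ContinuousOn (fun a => v (t₁, a)) (Ioo (y - ε) (y + ε)) := fun a ha =>
    (hd a ha).continuousAt.continuousWithinAt
  have hL : ∀ a ∈ Ioo (y - ε) (y + ε), ∀ b ∈ Ioo (y - ε) (y + ε),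
      |v (t₁, b) - v (t₁, a)| ≤ K * |b - a| := fun a ha b hb =>
    (convex_Ioo _ _).norm_image_sub_le_of_norm_hasDerivWithin_le
      (fun a ha => (hd a ha).hasDerivWithinAt) hεK ha hb
  have hM : ∀ a ∈ Ioo (y - ε) (y + ε), |v (t₁, a)| ≤ M := fun a ha =>
    sub_nonneg.1 <| nonneg_of_ae (f := fun a => M - |v (t₁, a)|) hI
      (continuousOn_const.sub hvc.abs) (by
        filter_upwards [hv₀, hB.bound t₁ ⟨le_rfl, ht₁.2.le⟩] with z hz hz' hzI
        rw [← hz (hII hzI)]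
        linarith) a ha
  obtain ⟨Z, V, A, hF⟩ := hu.exists_flow hB hK (by
    have : 0 ≤ 4 * ((K + 1) ^ 2 + M) := by have := hB.one_le; positivity
    exact (mul_le_mul_of_nonneg_left (by linarith [ht₁.1]) this).trans hδ1) hd (hc₀.mono hII) hM hL
  have hyI : y ∈ Ioo (y - ε) (y + ε) := ⟨by linarith, by linarith⟩
  have hxZ : ∀ t, t₁ ≤ t → t < S → x t = Z y t := fun t h1 h2 =>
    (hx.eq_trajectory hu hB (hF.traj y hyI) (hF.pos_init _ hyI) (hF.vel_init _ hyI) h1 h2 h2.le).1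
  have hZt : ∀ a ∈ Ioo (y - ε) (y + ε), ∀ t, t₁ ≤ t → t < S → (t, Z a t) ∈ tube x S r :=
    fun a ha t h1 h2 => by
      refine ⟨ht₁m.1.trans_le h1, by simp only; linarith [ht₁.1], h2, ?_⟩
      simp only
      rw [hxZ t h1 h2]
      have h3 := (hF.separation hyI ha ⟨h1, h2.le⟩).1
      have h4 : |a - y| < ε := by rw [abs_lt]; constructor <;> linarith [ha.1, ha.2]
      have h5 : ε ≤ r / (4 * (K + 1)) := hεε₀.trans hε₀r
      rw [le_div_iff₀ (by positivity)] at h5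
      nlinarith
  -- `g` is transported along the flow
  have hgV : ∀ a ∈ Ioo (y - ε) (y + ε), ∀ t, t₁ ≤ t → t < S → g (t, Z a t) = V a t := by
    intro a ha t h1 h2
    have hIc : ∀ s ∈ Icc t₁ t, (s, Z a s) ∈ tube x S r := fun s hs =>
      hZt a ha s hs.1 (hs.2.trans_lt h2)
    have hT := hF.traj a ha
    have hZc : ContinuousOn (fun s => (s, Z a s)) (Icc t₁ t) :=
      (continuous_id.prodMk hT.continuous_pos).continuousOn
    have hgx : ContinuousOn (fun s => fderiv ℝ g (s, Z a s) (0, 1)) (Icc t₁ t) :=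
      ((hg.continuousOn_fderiv_of_isOpen hto le_rfl).clm_apply continuousOn_const).comp hZc hIc
    obtain ⟨L, hLb⟩ := isCompact_Icc.exists_bound_of_continuousOn hgx
    -- Along a trajectory the difference `g - V` satisfies a homogeneous linear equation with
    -- coefficient `-g_x`, and it vanishes at the foot. The equation for `g` takes the place of the
    -- wedge bound here.
    refine sub_eq_zero.1 (eq_zero_of_abs_deriv_le_mul_abs_self_of_eq_zero_right
      (f := fun s => g (s, Z a s) - V a s)
      (f' := fun s => source (u s) (Z a s) -
        (g (s, Z a s) - V a s) * fderiv ℝ g (s, Z a s) (0, 1) - A a s) (K := L) (a := t₁) (b := t)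
      ((hg.continuousOn.comp hZc hIc).sub hT.continuous_vel.continuousOn) (fun s hs => ?_) ?_
      (fun s hs => ?_) t ⟨h1, le_rfl⟩)
    · have hm := hIc s ⟨hs.1, hs.2.le⟩
      exact ((hasDerivAt_comp_of_pde ((hg.contDiffAt (hto.mem_nhds hm)).differentiableAt
        one_ne_zero) (hT.hasDerivAt_pos s) (hu.pde hto htub0 hg hge hm)).sub
        (hT.hasDerivAt_vel s)).hasDerivWithinAt
    · rw [hF.pos_init a ha, hF.vel_init a ha]
      have hsl : Continuous fun a : ℝ => (t₁, a) := by fun_prop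
      have hmem : ∀ b ∈ Ioo (y - ε) (y + ε), (t₁, b) ∈ tube x S r := fun b hb => by
        have := hZt b hb t₁ le_rfl ht₁.2
        rwa [hF.pos_init b hb] at this
      have hH : tube x S r ∩ {p | 0 ≤ p.1} = tube x S r :=
        inter_eq_left.2 fun p hp => show (0 : ℝ) ≤ p.1 from le_of_lt hp.1
      have hsg := hu.ae_slice_eq hto (g := g) (by rw [hH]; exact hg.continuousOn)
        (by rw [hH]; exact hge) ht₁m.1.le
      have hgc : ContinuousOn (fun b => g (t₁, b)) (Ioo (y - ε) (y + ε)) :=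
        hg.continuousOn.comp hsl.continuousOn hmem
      have hle := nonneg_of_ae (f := fun b => -|g (t₁, b) - v (t₁, b)|) hI
        ((hgc.sub hvc).abs.neg) (by
          filter_upwards [hsg, hv₀] with z hz hz' hzI
          rw [← hz (hmem z hzI), ← hz' (hII hzI)]
          simp) a ha
      exact abs_nonpos_iff.1 (by linarith)
    · have hs' : s ∈ Icc t₁ S := ⟨hs.1, (hs.2.trans h2).le⟩
      rw [hT.acc_eq s hs']
      have e : source (u s) (Z a s) - (g (s, Z a s) - V a s) * fderiv ℝ g (s, Z a s) (0, 1) -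
          source (u s) (Z a s) = -(fderiv ℝ g (s, Z a s) (0, 1) * (g (s, Z a s) - V a s)) := by ring
      rw [e, norm_neg, norm_mul]
      exact mul_le_mul_of_nonneg_right (hLb s ⟨hs.1, hs.2.le⟩) (norm_nonneg _)
  -- Separations change by at most one half, so starting points at distance `ε/2` from `y` end at
  -- distance at least `ε/4` and the flow covers that width. The constant `4 (K + 1)` is the
  -- velocity bound `2 (K + 1)` per starting gap, times `2` to pass from starting gaps to position
  -- gaps.
  refine ⟨min (S - t₁) (ε / 4), lt_min (sub_pos.2 ht₁.2) (by positivity), 4 * (K + 1),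
    fun t ht0 htS htS' => ?_⟩
  have htt₁ : t₁ < t := by linarith [min_le_left (S - t₁) (ε / 4)]
  have htI : t ∈ Icc t₁ S := ⟨htt₁.le, htS'.le⟩
  have hH : tube x S r ∩ {p | 0 ≤ p.1} = tube x S r :=
    inter_eq_left.2 fun p hp => show (0 : ℝ) ≤ p.1 from le_of_lt hp.1
  have hsg := hu.ae_slice_eq hto (g := g) (by rw [hH]; exact hg.continuousOn)
    (by rw [hH]; exact hge) ht0.le
  have hsurj : ∀ a, (t, a) ∈ tube x S (min (S - t₁) (ε / 4)) →
      ∃ a₀ ∈ Ioo (y - ε) (y + ε), Z a₀ t = a := fun a ha => by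
    have h1 : |a - x t| < ε / 4 := lt_of_lt_of_le ha.2.2.2 (min_le_right _ _)
    rw [hxZ t htt₁.le htS', abs_lt] at h1
    have hl : y - ε / 2 ∈ Ioo (y - ε) (y + ε) := ⟨by linarith, by linarith⟩
    have hr : y + ε / 2 ∈ Ioo (y - ε) (y + ε) := ⟨by linarith, by linarith⟩
    have k1 := (abs_le.1 (hF.separation hyI hl htI).2.2).2
    have k2 := (abs_le.1 (hF.separation hyI hr htI).2.2).1
    have e1 : |y - ε / 2 - y| = ε / 2 := by
      rw [show y - ε / 2 - y = -(ε / 2) by ring, abs_neg, abs_of_pos (by positivity)]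
    have e2 : |y + ε / 2 - y| = ε / 2 := by
      rw [show y + ε / 2 - y = ε / 2 by ring, abs_of_pos (by positivity)]
    rw [e1] at k1
    rw [e2] at k2
    have hsub : Icc (y - ε / 2) (y + ε / 2) ⊆ Ioo (y - ε) (y + ε) := fun b hb =>
      ⟨by linarith [hb.1], by linarith [hb.2]⟩
    obtain ⟨a₀, ha₀, he⟩ := intermediate_value_Icc (by linarith)
      ((hF.continuousOn_pos htI).mono hsub)
      (show a ∈ Icc (Z (y - ε / 2) t) (Z (y + ε / 2) t) from ⟨by linarith, by linarith⟩)
    exact ⟨a₀, hsub ha₀, he⟩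
  filter_upwards [hsg] with a ha
  filter_upwards [hsg] with b hb hat hbt
  obtain ⟨a₀, ha₀, rfl⟩ := hsurj a hat
  obtain ⟨b₀, hb₀, rfl⟩ := hsurj b hbt
  rw [ha (hZt a₀ ha₀ t htt₁.le htS'), hb (hZt b₀ hb₀ t htt₁.le htS'),
    hgV a₀ ha₀ t htt₁.le htS', hgV b₀ hb₀ t htt₁.le htS']
  have h1 := hF.separation hb₀ ha₀ htI
  have h2 : |a₀ - b₀| ≤ 2 * |Z a₀ t - Z b₀ t| := by
    have h3 := abs_sub_abs_le_abs_sub (a₀ - b₀) (Z a₀ t - Z b₀ t)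
    rw [abs_sub_comm (a₀ - b₀)] at h3
    linarith [h1.2.2]
  have h4 := mul_le_mul_of_nonneg_left h2 (by positivity : 0 ≤ 2 * (K + 1))
  linarith [h1.2.1]

end IsClassicalCharacteristic

/-! ### The Riccati equation for the slope. -/

/-- The nonlocal source is differentiable where the density has a continuous version. -/
lemma hasDerivAt_source {w f : ℝ → ℝ} (hw : Integrable w) {I : Set ℝ} (hI : IsOpen I)
    (hf : ContinuousOn f I) (he : ∀ᵐ x, x ∈ I → w x = f x) {a : ℝ} (ha : a ∈ I) :
    HasDerivAt (source w) (f a + potential w a) a := by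
  rw [hasDerivAt_iff_isLittleO, Asymptotics.isLittleO_iff]
  intro ε hε
  have hc : ContinuousAt (fun x => f x + potential w x) a :=
    (hf.continuousAt (hI.mem_nhds ha)).add (continuous_potential hw).continuousAt
  obtain ⟨δ, hδ, hball⟩ := Metric.eventually_nhds_iff_ball.1
    ((Metric.continuousAt_iff'.1 hc ε hε).and (hI.mem_nhds ha))
  filter_upwards [Metric.ball_mem_nhds a hδ] with b hb
  have e : source w b - source w a - (b - a) • (f a + potential w a) =
      ∫ z in a..b, (w z + potential w z - (f a + potential w a)) := by
    rw [intervalIntegral.integral_sub (intervalIntegrable_add_potential hw _ _)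
      intervalIntegrable_const, ← source_sub hw, intervalIntegral.integral_const]
  rw [e, Real.norm_eq_abs (b - a)]
  refine intervalIntegral.norm_integral_le_of_norm_le_const_ae ?_
  filter_upwards [he] with z hz hzm
  have hzb : z ∈ Metric.ball a δ := by
    rw [Metric.mem_ball, Real.dist_eq] at hb ⊢
    exact (abs_sub_left_of_mem_uIcc (uIoc_subset_uIcc hzm)).trans_lt hb
  have h1 := hball z hzb
  rw [hz h1.2]
  have h2 := h1.1
  rw [Real.dist_eq] at h2
  exact h2.le

namespace IsClassicalCharacteristic
variable {ubar : ℝ → ℝ} {u : ℝ → ℝ → ℝ} {xbar T : ℝ} {x : ℝ → ℝ} {v : ℝ × ℝ → ℝ}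

/-- The coefficient of the Riccati equation for the slope along a characteristic. -/
def riccatiCoeff (u : ℝ → ℝ → ℝ) (x : ℝ → ℝ) (v : ℝ × ℝ → ℝ) (t : ℝ) : ℝ :=
  v (t, x t) + potential (u t) (x t)

lemma continuousOn_riccatiCoeff (hx : IsClassicalCharacteristic u xbar T x v)
    (hu : IsWeakEntropySolution ubar u) : ContinuousOn (riccatiCoeff u x v) (Ico 0 T) :=
  hx.continuousOn_vel.add (hu.continuousOn_potential.comp
    (continuousOn_id.prodMk hx.continuousOn) fun _ ht => ⟨ht.1, mem_univ _⟩)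

lemma hasDerivAt_source_slice (hx : IsClassicalCharacteristic u xbar T x v)
    (hu : IsWeakEntropySolution ubar u) {t : ℝ} (ht : t ∈ Ioo 0 T) :
    HasDerivAt (source (u t)) (riccatiCoeff u x v t) (x t) := by
  obtain ⟨ε, hε, -, hd, -, he⟩ := hx.exists_slice hu ht one_pos
  exact hasDerivAt_source (hu.integrable t ht.1.le) isOpen_Ioo (f := fun a => v (t, a))
    (fun a ha => (hd a ha).continuousAt.continuousWithinAt) he ⟨by linarith, by linarith⟩

/-- Since `v` is only `C¹`, the equation cannot be differentiated in `x`. The increment `e h t =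
v(t, x + h) - v(t, x)` satisfies exactly `e' = [source(x + h) - source(x)] - v_x(t, x + h) e`.
Dividing the integrated form by `h` and letting `h → 0` yields the Riccati equation in integrated
form. -/
lemma slope_sub_eq_integral (hx : IsClassicalCharacteristic u xbar T x v)
    (hu : IsWeakEntropySolution ubar u) {t₁ t₂ : ℝ} (h1 : 0 < t₁) (h12 : t₁ < t₂) (h2 : t₂ < T) :
    ContinuousOn (slope v x) (Icc t₁ t₂) ∧ slope v x t₂ - slope v x t₁ =
      ∫ t in t₁..t₂, (riccatiCoeff u x v t - slope v x t ^ 2) := by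
  obtain ⟨O, hO, hO0, hOx, hv, he⟩ := hx.exists_open
  have hIoo : ∀ t ∈ Icc t₁ t₂, t ∈ Ioo 0 T := fun t ht => ⟨h1.trans_le ht.1, ht.2.trans_lt h2⟩
  have hxc : ContinuousOn x (Icc t₁ t₂) := hx.continuousOn.mono fun t ht =>
    ⟨(hIoo t ht).1.le, (hIoo t ht).2⟩
  obtain ⟨M, hB⟩ := hu.exists_slabBounds h1 h12
  have hγ : ContinuousOn (fun t => (t, x t)) (Icc t₁ t₂) := continuousOn_id.prodMk hxc
  have hcpt := isCompact_Icc.image_of_continuousOn hγ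
  obtain ⟨δ, hδ, hthick⟩ := hcpt.exists_cthickening_subset_open hO (by
    rintro _ ⟨t, ht, rfl⟩
    exact hOx t (hIoo t ht))
  have hmem : ∀ t ∈ Icc t₁ t₂, ∀ h, |h| ≤ δ →
      (t, x t + h) ∈ Metric.cthickening δ ((fun t => (t, x t)) '' Icc t₁ t₂) := fun t ht h hh => by
    refine Metric.mem_cthickening_of_dist_le _ (t, x t) _ _ (mem_image_of_mem _ ht) ?_
    rw [Prod.dist_eq, dist_self, max_eq_right dist_nonneg, Real.dist_eq]
    simpa using hh
  have hvx : ContinuousOn (fun p => fderiv ℝ v p (0, 1)) O :=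
    (hv.continuousOn_fderiv_of_isOpen hO le_rfl).clm_apply continuousOn_const
  obtain ⟨C, hC⟩ := hcpt.cthickening.exists_bound_of_continuousOn (hvx.mono hthick)
  have hslope : ∀ t ∈ Icc t₁ t₂, slope v x t = fderiv ℝ v (t, x t) (0, 1) := fun t ht =>
    hx.slope_eq_fderiv hu (hIoo t ht)
  have hslc : ContinuousOn (slope v x) (Icc t₁ t₂) :=
    (hvx.comp hγ fun t ht => hOx t (hIoo t ht)).congr hslope
  refine ⟨hslc, ?_⟩
  have hdx : ∀ t ∈ Icc t₁ t₂, ∀ h, |h| ≤ δ →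
      HasDerivAt (fun a => v (t, a)) (fderiv ℝ v (t, x t + h) (0, 1)) (x t + h) :=
    fun t ht h hh => by
      have hd := ((hv.contDiffAt (hO.mem_nhds (hthick (hmem t ht h hh)))).differentiableAt
        one_ne_zero).hasFDerivAt
      exact hd.comp_hasDerivAt _ ((hasDerivAt_const _ t).prodMk (hasDerivAt_id _))
  -- increments of `v` across the characteristic
  let e : ℝ → ℝ → ℝ := fun h t => v (t, x t + h) - v (t, x t)
  let F : ℝ → ℝ → ℝ := fun h t => (source (u t) (x t + h) - source (u t) (x t)) -
    fderiv ℝ v (t, x t + h) (0, 1) * e h t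
  have hFc : ∀ h, |h| ≤ δ → ContinuousOn (F h) (Icc t₁ t₂) := fun h hh => by
    have c1 : ContinuousOn (fun t => (t, x t + h)) (Icc t₁ t₂) :=
      continuousOn_id.prodMk (hxc.add continuousOn_const)
    have c2 : MapsTo (fun t => (t, x t + h)) (Icc t₁ t₂) O := fun t ht => hthick (hmem t ht h hh)
    have c3 : MapsTo (fun t => (t, x t)) (Icc t₁ t₂) O := fun t ht => hOx t (hIoo t ht)
    refine ((hu.continuousOn_source.comp c1 fun t ht => ⟨(hIoo t ht).1.le, mem_univ _⟩).sub
      (hu.continuousOn_source.comp hγ fun t ht => ⟨(hIoo t ht).1.le, mem_univ _⟩)).sub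
      ((hvx.comp c1 c2).mul ((hv.continuousOn.comp c1 c2).sub (hv.continuousOn.comp hγ c3)))
  have heF : ∀ h, |h| ≤ δ → e h t₂ - e h t₁ = ∫ t in t₁..t₂, F h t := fun h hh => by
    refine (intervalIntegral.integral_eq_sub_of_hasDerivAt (fun t ht => ?_) ?_).symm
    · rw [uIcc_of_le h12.le] at ht
      have hm := hthick (hmem t ht h hh)
      have d1 := hasDerivAt_comp_of_pde (g := v) (Z := fun t => x t + h)
        ((hv.contDiffAt (hO.mem_nhds hm)).differentiableAt one_ne_zero)
        ((hx.hasDerivAt (hIoo t ht)).add_const h) (hu.pde hO hO0 hv he hm)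
      refine (d1.sub (hx.hasDerivAt_vel hu (hIoo t ht))).congr_deriv ?_
      simp only [F, e]
      ring
    · refine ContinuousOn.intervalIntegrable ?_
      rw [uIcc_of_le h12.le]
      exact hFc h hh
  have hebd : ∀ t ∈ Icc t₁ t₂, ∀ h, |h| ≤ δ → |e h t| ≤ C * |h| := fun t ht h hh => by
    have := (convex_Icc (x t - δ) (x t + δ)).norm_image_sub_le_of_norm_hasDerivWithin_le
      (f := fun a => v (t, a)) (f' := fun a => fderiv ℝ v (t, a) (0, 1)) (C := C)
      (x := x t) (y := x t + h) (fun a ha => by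
        have := hdx t ht (a - x t) (abs_le.2 ⟨by linarith [ha.1], by linarith [ha.2]⟩)
        rw [add_sub_cancel] at this
        exact this.hasDerivWithinAt) (fun a ha => by
        have := hC _ (hmem t ht (a - x t) (abs_le.2 ⟨by linarith [ha.1], by linarith [ha.2]⟩))
        rwa [add_sub_cancel] at this) ⟨by linarith, by linarith⟩
        ⟨by linarith [(abs_le.1 hh).1], by linarith [(abs_le.1 hh).2]⟩
    rw [add_sub_cancel_left] at this
    exact this
  -- difference quotients along a sequence
  let η : ℕ → ℝ := fun n => δ * (1 / ((n : ℝ) + 1))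
  have hη0 : ∀ n, 0 < η n := fun n => mul_pos hδ Nat.one_div_pos_of_nat
  have hηδ : ∀ n, |η n| ≤ δ := fun n => by
    rw [abs_of_pos (hη0 n)]
    refine mul_le_of_le_one_right hδ.le ?_
    rw [div_le_one (by positivity)]
    linarith [(Nat.cast_nonneg n : (0 : ℝ) ≤ n)]
  have hηlim : Tendsto η atTop (𝓝 0) := by
    have := (tendsto_one_div_add_atTop_nhds_zero_nat (𝕜 := ℝ)).const_mul δ
    rwa [mul_zero] at this
  have hηlim' : Tendsto η atTop (𝓝[≠] 0) :=
    tendsto_nhdsWithin_iff.2 ⟨hηlim, Eventually.of_forall fun n => (hη0 n).ne'⟩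
  have helim : ∀ t ∈ Icc t₁ t₂, Tendsto (fun n => (η n)⁻¹ * e (η n) t) atTop
      (𝓝 (slope v x t)) := fun t ht => by
    have d := hdx t ht 0 (by simpa using hδ.le)
    rw [add_zero, ← hslope t ht, hasDerivAt_iff_tendsto_slope_zero] at d
    exact d.comp hηlim'
  have hFlim : ∀ t ∈ Icc t₁ t₂, Tendsto (fun n => (η n)⁻¹ * F (η n) t) atTop
      (𝓝 (riccatiCoeff u x v t - slope v x t ^ 2)) := fun t ht => by
    have d1 := hx.hasDerivAt_source_slice hu (hIoo t ht)
    rw [hasDerivAt_iff_tendsto_slope_zero] at d1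
    have d2 := d1.comp hηlim'
    have d3 : Tendsto (fun n => fderiv ℝ v (t, x t + η n) (0, 1)) atTop (𝓝 (slope v x t)) := by
      rw [hslope t ht]
      have c1 := (hvx.continuousAt (hO.mem_nhds (hOx t (hIoo t ht)))).tendsto
      refine c1.comp (tendsto_const_nhds.prodMk_nhds ?_)
      simpa using hηlim.const_add (x t)
    refine ((d2.sub (d3.mul (helim t ht))).congr fun n => ?_).trans_eq (by rw [sq])
    simp only [F, Function.comp_apply, smul_eq_mul]
    ring
  have hlim1 : Tendsto (fun n => ∫ t in t₁..t₂, (η n)⁻¹ * F (η n) t) atTop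
      (𝓝 (∫ t in t₁..t₂, (riccatiCoeff u x v t - slope v x t ^ 2))) := by
    -- In the dominating constant, `M` is the Lipschitz constant of the source, and `C` bounds `v_x`
    -- in a compact tube and hence also `|e| / h`.
    refine intervalIntegral.tendsto_integral_filter_of_dominated_convergence
      (fun _ => M + C * C) (Eventually.of_forall fun n => ?_) (Eventually.of_forall fun n => ?_)
      intervalIntegrable_const ?_
    · rw [uIoc_of_le h12.le]
      exact ((continuousOn_const.mul (hFc _ (hηδ n))).mono
        Ioc_subset_Icc_self).aestronglyMeasurable measurableSet_Ioc
    · refine ae_of_all _ fun t ht => ?_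
      rw [uIoc_of_le h12.le] at ht
      have ht' := Ioc_subset_Icc_self ht
      have hC0 : 0 ≤ C := (norm_nonneg _).trans (hC _ (hmem t ht' 0 (by simpa using hδ.le)))
      rw [norm_mul, norm_inv, Real.norm_eq_abs, Real.norm_eq_abs, abs_of_pos (hη0 n),
        inv_mul_le_iff₀ (hη0 n)]
      have b1 := hB.source_lip t ht' (x t + η n) (x t)
      rw [add_sub_cancel_left, abs_of_pos (hη0 n)] at b1
      have b2 := hebd t ht' (η n) (hηδ n)
      rw [abs_of_pos (hη0 n)] at b2
      have b3 := hC _ (hmem t ht' (η n) (hηδ n))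
      have b4 : |fderiv ℝ v (t, x t + η n) (0, 1) * e (η n) t| ≤ C * (C * η n) := by
        rw [abs_mul]
        exact mul_le_mul b3 b2 (abs_nonneg _) hC0
      refine (abs_sub _ _).trans ?_
      linarith
    · refine ae_of_all _ fun t ht => ?_
      rw [uIoc_of_le h12.le] at ht
      exact hFlim t (Ioc_subset_Icc_self ht)
  have hlim2 : Tendsto (fun n => ∫ t in t₁..t₂, (η n)⁻¹ * F (η n) t) atTop
      (𝓝 (slope v x t₂ - slope v x t₁)) := by
    refine ((helim t₂ ⟨h12.le, le_rfl⟩).sub (helim t₁ ⟨le_rfl, h12.le⟩)).congr fun n => ?_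
    rw [intervalIntegral.integral_const_mul, ← heF _ (hηδ n)]
    ring
  exact tendsto_nhds_unique hlim2 hlim1

/-- The Riccati equation for the slope along a classical characteristic. -/
lemma hasDerivAt_slope (hx : IsClassicalCharacteristic u xbar T x v)
    (hu : IsWeakEntropySolution ubar u) {t : ℝ} (ht : t ∈ Ioo 0 T) :
    HasDerivAt (slope v x) (riccatiCoeff u x v t - slope v x t ^ 2) t := by
  obtain ⟨a, ha0, hat⟩ := exists_between ht.1
  obtain ⟨b, htb, hbT⟩ := exists_between ht.2
  have hc := (hx.slope_sub_eq_integral hu ha0 (hat.trans htb) hbT).1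
  have hf : ContinuousOn (fun t => riccatiCoeff u x v t - slope v x t ^ 2) (Icc a b) :=
    ((hx.continuousOn_riccatiCoeff hu).mono fun s hs =>
      ⟨ha0.le.trans hs.1, hs.2.trans_lt hbT⟩).sub (hc.pow 2)
  have hn : Icc a b ∈ 𝓝 t := Icc_mem_nhds hat htb
  have h1 : HasDerivAt (fun s => ∫ σ in a..s, (riccatiCoeff u x v σ - slope v x σ ^ 2))
      (riccatiCoeff u x v t - slope v x t ^ 2) t := by
    refine intervalIntegral.integral_hasDerivAt_right ?_ ?_ (hf.continuousAt hn)
    · refine ContinuousOn.intervalIntegrable ?_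
      rw [uIcc_of_le hat.le]
      exact hf.mono (Icc_subset_Icc_right htb.le)
    · exact ⟨_, hn, hf.aestronglyMeasurable measurableSet_Icc⟩
  refine (h1.const_add (slope v x a)).congr_of_eventuallyEq ?_
  filter_upwards [Ioo_mem_nhds hat htb] with s hs
  rw [← (hx.slope_sub_eq_integral hu ha0 hs.1 (hs.2.trans hbT)).2]
  ring

end IsClassicalCharacteristic

/-! ### Riccati differential inequalities with an exponentially growing coefficient. -/

section Riccati
variable {q α : ℝ → ℝ} {T m B τ : ℝ}

/-- From above, `q' ≤ α ≤ m e^t`. From below, the derivative of `arctan (q/B)` is `B (α - q²) / (B²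
+ q²)`, which exceeds `-B e^t` because `m < B²` and `e^t ≥ 1`. So the angle cannot reach `-π/2` as
long as `B (e^t - 1)` does not exceed its initial distance from it. -/
lemma bounded_of_riccati (hq : ContinuousOn q (Ico 0 T))
    (hd : ∀ t ∈ Ioo 0 T, HasDerivAt q (α t - q t ^ 2) t)
    (hα : ∀ t ∈ Ioo 0 T, |α t| ≤ m * Real.exp t) (hm : 0 ≤ m) (hB : 0 < B) (hmB : m < B ^ 2)
    (hτ : 0 < τ) (hτT : τ ≤ T)
    (h : B * (Real.exp τ - 1) ≤ Real.pi / 2 + Real.arctan (q 0 / B)) :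
    ∃ C, ∀ t ∈ Ico 0 τ, |q t| ≤ C := by
  have hint : interior (Ico 0 T) = Ioo 0 T := interior_Ico
  have h0T : (0 : ℝ) ∈ Ico 0 T := ⟨le_rfl, hτ.trans_le hτT⟩
  have hup : MonotoneOn (fun t => m * Real.exp t - q t) (Ico 0 T) := by
    have hd' : ∀ t ∈ Ioo 0 T, HasDerivAt (fun t => m * Real.exp t - q t)
        (m * Real.exp t - (α t - q t ^ 2)) t := fun t ht =>
      ((Real.hasDerivAt_exp t).const_mul m).sub (hd t ht)
    refine monotoneOn_of_deriv_nonneg (convex_Ico 0 T)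
      ((by fun_prop : Continuous fun t => m * Real.exp t).continuousOn.sub hq)
      (fun t ht => (hd' t (hint ▸ ht)).differentiableAt.differentiableWithinAt) fun t ht => ?_
    rw [hint] at ht
    rw [(hd' t ht).deriv]
    linarith [(abs_le.1 (hα t ht)).2, sq_nonneg (q t)]
  have hlow : StrictMonoOn (fun t => Real.arctan (q t / B) + B * Real.exp t) (Ico 0 T) := by
    refine strictMonoOn_of_deriv_pos (convex_Ico 0 T)
      ((Real.continuous_arctan.comp_continuousOn (hq.div_const B)).add
        (by fun_prop : Continuous fun t => B * Real.exp t).continuousOn) fun t ht => ?_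
    rw [hint] at ht
    have hd' := (((hd t ht).div_const B).arctan).add ((Real.hasDerivAt_exp t).const_mul B)
    have e : deriv (fun t => Real.arctan (q t / B) + B * Real.exp t) t = _ := hd'.deriv
    rw [e]
    have h1 := (abs_le.1 (hα t ht)).1
    have h2 : 1 ≤ Real.exp t := Real.one_le_exp ht.1.le
    have e2 : 1 / (1 + (q t / B) ^ 2) * ((α t - q t ^ 2) / B) + B * Real.exp t =
        B * (α t - q t ^ 2 + Real.exp t * (B ^ 2 + q t ^ 2)) / (B ^ 2 + q t ^ 2) := by
      have : B ^ 2 + q t ^ 2 ≠ 0 := by positivity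
      field_simp
    rw [e2]
    refine div_pos (mul_pos hB ?_) (by positivity)
    have h3 : m * Real.exp t < B ^ 2 * Real.exp t := by gcongr
    nlinarith [mul_nonneg (sub_nonneg.2 h2) (sq_nonneg (q t))]
  have ht₁ : τ / 2 ∈ Ico 0 T := ⟨by positivity, by linarith⟩
  obtain ⟨C₁, hC₁⟩ := (isCompact_Icc (a := 0) (b := τ / 2)).exists_bound_of_continuousOn
    (hq.mono fun t ht => ⟨ht.1, ht.2.trans_lt ht₁.2⟩)
  -- A lower bound for the angle on `[τ/2, τ)`. Starting at `τ/2` uses the strict monotonicity on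
  -- the first half, so that `θ > -π/2` even if equality holds in `h`.
  set θ := Real.arctan (q (τ / 2) / B) + B * Real.exp (τ / 2) - B * Real.exp τ with hθ
  have hθ1 : -(Real.pi / 2) < θ := by
    have := hlow h0T ht₁ (by positivity)
    simp only [Real.exp_zero] at this
    linarith
  have hθ2 : θ < Real.pi / 2 := by
    have h1 := Real.arctan_lt_pi_div_two (q (τ / 2) / B)
    have h2 : B * Real.exp (τ / 2) ≤ B * Real.exp τ := by
      gcongr
      linarith
    linarith
  refine ⟨C₁ + |q 0 + m * Real.exp τ - m| + |B * Real.tan θ|, fun t ht => ?_⟩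
  have htT : t ∈ Ico 0 T := ⟨ht.1, ht.2.trans_le hτT⟩
  have hC0 : 0 ≤ C₁ := (norm_nonneg _).trans (hC₁ 0 ⟨le_rfl, by positivity⟩)
  rcases le_total t (τ / 2) with h1 | h1
  · have := hC₁ t ⟨ht.1, h1⟩
    rw [Real.norm_eq_abs] at this
    linarith [abs_nonneg (q 0 + m * Real.exp τ - m), abs_nonneg (B * Real.tan θ)]
  · have h2 := hup h0T htT ht.1
    simp only [Real.exp_zero, mul_one] at h2
    have h3 : m * Real.exp t ≤ m * Real.exp τ := by
      have := ht.2.le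
      gcongr
    have h4 := hlow.monotoneOn ht₁ htT h1
    have h5 : B * Real.exp t ≤ B * Real.exp τ := by
      have := ht.2.le
      gcongr
    have h6 : Real.arctan (Real.tan θ) ≤ Real.arctan (q t / B) := by
      rw [Real.arctan_tan hθ1 hθ2]
      linarith
    rw [Real.arctan_strictMono.le_iff_le, le_div_iff₀ hB] at h6
    rw [abs_le]
    constructor
    · linarith [neg_abs_le (B * Real.tan θ), abs_nonneg (q 0 + m * Real.exp τ - m)]
    · linarith [le_abs_self (q 0 + m * Real.exp τ - m), abs_nonneg (B * Real.tan θ)]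

/-- With `p = -e^{-t} q` one has `p' ≥ p² - p - m = (p - 1/2)² - 1/4 - m`; for `w = p - 1/2 - B`
this becomes `w' ≥ w² + 2Bw`, thanks to `m ≤ B² - 1/4`. Hence `w` stays positive, `(1/w)' < -1`, and
the life time is less than `1 / w(0)`. -/
lemma blowup_of_riccati (hq : ContinuousOn q (Ico 0 T))
    (hd : ∀ t ∈ Ioo 0 T, HasDerivAt q (α t - q t ^ 2) t)
    (hα : ∀ t ∈ Ioo 0 T, |α t| ≤ m * Real.exp t) (hT : 0 < T) (hB : 0 < B)
    (hmB : m ≤ B ^ 2 - 1 / 4) (h0 : q 0 < -(1 / 2) - B) :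
    T < 1 / (-q 0 - 1 / 2 - B) ∧ ∀ t ∈ Ico 0 T, q t < 0 := by
  have hint : interior (Ico 0 T) = Ioo 0 T := interior_Ico
  have h0T : (0 : ℝ) ∈ Ico 0 T := ⟨le_rfl, hT⟩
  set w : ℝ → ℝ := fun t => -(Real.exp (-t) * q t) - 1 / 2 - B with hw
  have hwc : ContinuousOn w (Ico 0 T) :=
    (((by fun_prop : Continuous fun t : ℝ => Real.exp (-t)).continuousOn.mul hq).neg.sub
      continuousOn_const).sub continuousOn_const
  have hw0 : w 0 = -q 0 - 1 / 2 - B := by simp [hw]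
  have hw0pos : 0 < w 0 := by rw [hw0]; linarith
  have hwd : ∀ t ∈ Ioo 0 T, ∃ w', HasDerivAt w w' t ∧ w t ^ 2 + 2 * B * w t ≤ w' := fun t ht => by
    have he : HasDerivAt (fun t : ℝ => Real.exp (-t)) (-Real.exp (-t)) t := by
      simpa using (hasDerivAt_neg t).exp
    refine ⟨_, (((he.mul (hd t ht)).neg.sub_const (1 / 2)).sub_const B), ?_⟩
    set E := Real.exp (-t) with hE
    have hEp : 0 < E := Real.exp_pos _
    have hEinv : Real.exp t * E = 1 := by rw [hE, ← Real.exp_add]; simp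
    have h1 : 1 ≤ Real.exp t := Real.one_le_exp ht.1.le
    have h2 : E * α t ≤ m := by
      calc E * α t ≤ E * (m * Real.exp t) :=
            mul_le_mul_of_nonneg_left (abs_le.1 (hα t ht)).2 hEp.le
        _ = m * (Real.exp t * E) := by ring
        _ = m := by rw [hEinv, mul_one]
    have h3 : (E * q t) ^ 2 ≤ E * q t ^ 2 := by
      have h4 : E ≤ 1 := by
        rw [hE]
        exact Real.exp_le_one_iff.2 (by linarith [ht.1])
      nlinarith [mul_nonneg hEp.le (sq_nonneg (q t))]
    simp only [hw]
    nlinarith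
  have hmono : MonotoneOn (fun t => Real.exp (-(2 * B) * t) * w t) (Ico 0 T) := by
    have he : ∀ t, HasDerivAt (fun t : ℝ => Real.exp (-(2 * B) * t))
        (Real.exp (-(2 * B) * t) * -(2 * B)) t := fun t => by
      simpa using ((hasDerivAt_id t).const_mul (-(2 * B))).exp
    refine monotoneOn_of_deriv_nonneg (convex_Ico 0 T)
      ((by fun_prop : Continuous fun t : ℝ => Real.exp (-(2 * B) * t)).continuousOn.mul hwc)
      (fun t ht => ?_) fun t ht => ?_
    · obtain ⟨w', h1, -⟩ := hwd t (hint ▸ ht)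
      exact ((he t).mul h1).differentiableAt.differentiableWithinAt
    · obtain ⟨w', h1, h2⟩ := hwd t (hint ▸ ht)
      have e : deriv (fun t => Real.exp (-(2 * B) * t) * w t) t = _ := ((he t).mul h1).deriv
      rw [e]
      nlinarith [Real.exp_pos (-(2 * B) * t), sq_nonneg (w t),
        mul_nonneg (Real.exp_pos (-(2 * B) * t)).le (by nlinarith [sq_nonneg (w t)] :
          0 ≤ w' - 2 * B * w t)]
  have hwpos : ∀ t ∈ Ico 0 T, 0 < w t := fun t ht => by
    have := hmono h0T ht ht.1
    simp only [mul_zero, Real.exp_zero, one_mul] at this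
    exact pos_of_mul_pos_right (hw0pos.trans_le this) (Real.exp_pos _).le
  have hanti : StrictAntiOn (fun t => (w t)⁻¹ + t) (Ico 0 T) := by
    refine strictAntiOn_of_deriv_neg (convex_Ico 0 T)
      ((hwc.inv₀ fun t ht => (hwpos t ht).ne').add continuousOn_id) fun t ht => ?_
    rw [hint] at ht
    obtain ⟨w', h1, h2⟩ := hwd t ht
    have hp := hwpos t ⟨ht.1.le, ht.2⟩
    have e : deriv (fun t => (w t)⁻¹ + t) t = _ := ((h1.inv hp.ne').add (hasDerivAt_id t)).deriv
    rw [e]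
    have h3 : 1 < w' / w t ^ 2 := by
      rw [lt_div_iff₀ (by positivity)]
      nlinarith [mul_pos hB hp]
    rw [neg_div]
    linarith
  refine ⟨?_, fun t ht => ?_⟩
  -- The strict decrease of `1/w + t` over the first half of the interval yields the strict
  -- inequality for `T`.
  · have hh : T / 2 ∈ Ico 0 T := ⟨by positivity, by linarith⟩
    have h1 := hanti h0T hh (by positivity)
    simp only [add_zero] at h1
    rw [one_div, ← hw0]
    refine lt_of_le_of_lt ?_ h1
    refine le_of_forall_lt_imp_le_of_dense fun t ht => ?_
    rcases le_total t (T / 2) with h2 | h2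
    · exact h2.trans (le_add_of_nonneg_left (inv_nonneg.2 (hwpos _ hh).le))
    · have hm : t ∈ Ico 0 T := ⟨hh.1.trans h2, ht⟩
      have h3 := hanti.antitoneOn hh hm h2
      have := inv_pos.2 (hwpos t hm)
      linarith
  · have h1 := hwpos t ht
    simp only [hw] at h1
    by_contra! hn
    have := mul_nonneg (Real.exp_pos (-t)).le hn
    linarith

end Riccati

/-! ### Initial slope, bound on the Riccati coefficient and the two critical times. -/

namespace IsClassicalCharacteristic
variable {ubar : ℝ → ℝ} {u : ℝ → ℝ → ℝ} {xbar T : ℝ} {x : ℝ → ℝ} {v : ℝ × ℝ → ℝ}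

lemma eventually_eq_initial (hx : IsClassicalCharacteristic u xbar T x v)
    (hu : IsWeakEntropySolution ubar u) (hC : Continuous ubar) :
    ∀ᶠ a in 𝓝 xbar, v (0, a) = ubar a := by
  obtain ⟨U, hU, hUx, hv, hue⟩ := hx.classical
  have hsl : Continuous fun a : ℝ => ((0 : ℝ), a) := by fun_prop
  have hI : IsOpen ((fun a : ℝ => ((0 : ℝ), a)) ⁻¹' U) := hU.preimage hsl
  have hmem : xbar ∈ (fun a : ℝ => ((0 : ℝ), a)) ⁻¹' U := by
    have := hUx 0 ⟨le_rfl, hx.pos⟩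
    rwa [hx.initial] at this
  have hvc : ContinuousOn (fun a => v (0, a)) ((fun a : ℝ => ((0 : ℝ), a)) ⁻¹' U) :=
    hv.continuousOn.comp hsl.continuousOn fun a ha => ⟨ha, le_refl (0 : ℝ)⟩
  filter_upwards [hI.mem_nhds hmem] with a ha
  have h1 := nonneg_of_ae (f := fun a => -|v (0, a) - ubar a|) hI
    ((hvc.sub hC.continuousOn).abs.neg) (by
      filter_upwards [hu.ae_slice_eq hU hv.continuousOn hue le_rfl, hu.initial] with b hb hb' hbU
      rw [← hb hbU, hb']
      simp) a ha
  exact sub_eq_zero.1 (abs_nonpos_iff.1 (by linarith))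

lemma slope_zero (hx : IsClassicalCharacteristic u xbar T x v)
    (hu : IsWeakEntropySolution ubar u) (hC : Continuous ubar) :
    slope v x 0 = deriv ubar xbar := by
  rw [slope, hx.initial]
  exact Filter.EventuallyEq.deriv_eq (hx.eventually_eq_initial hu hC)

/-- At `t = 0` the version `v` is `C¹` only on the closed half plane, so the derivative within that
set is used. It is unique since the set is convex with interior, and it gives the ordinary
derivative in `x` because horizontal slices are not cut off. -/
lemma continuousOn_slope (hx : IsClassicalCharacteristic u xbar T x v) :
    ContinuousOn (slope v x) (Ico 0 T) := by
  obtain ⟨U, hU, hUx, hv, hue⟩ := hx.classical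
  have hconv : Convex ℝ halfPlane := by
    intro p hp q hq a b ha hb _
    exact add_nonneg (mul_nonneg ha hp) (mul_nonneg hb hq)
  have hint : (interior halfPlane).Nonempty :=
    ⟨(1, 0), mem_interior.2 ⟨{p | 0 < p.1}, fun p hp => show (0 : ℝ) ≤ p.1 from le_of_lt hp,
      isOpen_lt continuous_const continuous_fst, by simp⟩⟩
  have huniq : UniqueDiffOn ℝ (U ∩ halfPlane) := by
    rw [inter_comm]
    exact (uniqueDiffOn_convex hconv hint).inter hU
  have hmem : ∀ t ∈ Ico 0 T, (t, x t) ∈ U ∩ halfPlane := fun t ht => ⟨hUx t ht, ht.1⟩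
  have hc := ((hv.continuousOn_fderivWithin huniq le_rfl).clm_apply
    (continuousOn_const (c := ((0 : ℝ), (1 : ℝ))))).comp
    (continuousOn_id.prodMk hx.continuousOn) hmem
  refine hc.congr fun t ht => ?_
  have hsl : Continuous fun a : ℝ => (t, a) := by fun_prop
  have hd := (hv.differentiableOn one_ne_zero (t, x t) (hmem t ht)).hasFDerivWithinAt
  have hs : (fun a : ℝ => (t, a)) ⁻¹' (U ∩ halfPlane) ∈ 𝓝 (x t) := by
    filter_upwards [(hU.preimage hsl).mem_nhds (hUx t ht)] with a ha using ⟨ha, ht.1⟩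
  exact ((hd.comp_hasDerivWithinAt (x t)
    ((hasDerivAt_const (x t) t).prodMk (hasDerivAt_id (x t))).hasDerivWithinAt
    (mapsTo_preimage _ _)).hasDerivAt hs).deriv

/-- Both the source and the potential are at most `(n/2) e^t` with `n = ‖ubar‖₁`. Integrating the
former bounds the velocity by `|ubar(xbar)| + (n/2)(e^t - 1)`, and the latter adds `(n/2) e^t`. The
coefficient of the norm is `1`, not the `2` in `size`; this slack provides the strict inequality `m
< B²` of `bounded_of_riccati`. -/
lemma abs_riccatiCoeff_le (hx : IsClassicalCharacteristic u xbar T x v)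
    (hu : IsWeakEntropySolution ubar u) (hC : Continuous ubar) {t : ℝ} (ht : t ∈ Ioo 0 T) :
    |riccatiCoeff u x v t| ≤ (|ubar xbar| + ∫ y, |ubar y|) * Real.exp t := by
  set n := ∫ y, |ubar y| with hn
  have hint : interior (Ico 0 T) = Ioo 0 T := interior_Ico
  have h0T : (0 : ℝ) ∈ Ico 0 T := ⟨le_rfl, hx.pos⟩
  have ht' : t ∈ Ico 0 T := ⟨ht.1.le, ht.2⟩
  have hv0 : v (0, x 0) = ubar xbar := by
    rw [hx.initial]
    exact (hx.eventually_eq_initial hu hC).self_of_nhds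
  have hnorm : ∀ t, 0 ≤ t → 1 / 2 * ∫ y, |u t y| ≤ n / 2 * Real.exp t := fun t ht => by
    linarith [hu.norm_le_exp_mul ht]
  have hmono : ∀ σ : ℝ, |σ| = 1 →
      MonotoneOn (fun t => n / 2 * Real.exp t - σ * v (t, x t)) (Ico 0 T) := fun σ hσ => by
    have hd' : ∀ t ∈ Ioo 0 T, HasDerivAt (fun t => n / 2 * Real.exp t - σ * v (t, x t))
        (n / 2 * Real.exp t - σ * source (u t) (x t)) t := fun t ht =>
      ((Real.hasDerivAt_exp t).const_mul _).sub ((hx.hasDerivAt_vel hu ht).const_mul σ)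
    refine monotoneOn_of_deriv_nonneg (convex_Ico 0 T)
      ((by fun_prop : Continuous fun t => n / 2 * Real.exp t).continuousOn.sub
        (hx.continuousOn_vel.const_smul σ))
      (fun t ht => (hd' t (hint ▸ ht)).differentiableAt.differentiableWithinAt) fun t ht => ?_
    rw [hint] at ht
    rw [(hd' t ht).deriv]
    have h1 := (abs_source_le (hu.integrable t ht.1.le) (x t)).trans (hnorm t ht.1.le)
    have h2 : |σ * source (u t) (x t)| ≤ n / 2 * Real.exp t := by rwa [abs_mul, hσ, one_mul]
    linarith [le_abs_self (σ * source (u t) (x t))]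
  have h1 := hmono 1 abs_one h0T ht' ht.1.le
  have h2 := hmono (-1) (by simp) h0T ht' ht.1.le
  simp only [Real.exp_zero, hv0] at h1 h2
  have h3 := abs_le.1 ((abs_potential_le (hu.integrable t ht.1.le) (x t)).trans (hnorm t ht.1.le))
  have h4 : |ubar xbar| ≤ |ubar xbar| * Real.exp t :=
    le_mul_of_one_le_right (abs_nonneg _) (Real.one_le_exp ht.1.le)
  have h5 : 0 ≤ n := integral_nonneg fun _ => abs_nonneg _
  rw [riccatiCoeff, abs_le]
  constructor
  · linarith [neg_abs_le (ubar xbar)]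
  · linarith [le_abs_self (ubar xbar)]

end IsClassicalCharacteristic

namespace IsClassicalCharacteristic
variable {ubar : ℝ → ℝ} {u : ℝ → ℝ → ℝ} {xbar T : ℝ} {x : ℝ → ℝ} {v : ℝ × ℝ → ℝ}

/-- Before the time `T_*` the slope along a classical characteristic is bounded. -/
lemma exists_slope_bound (hx : IsClassicalCharacteristic u xbar T x v)
    (hu : IsWeakEntropySolution ubar u) (hC : Continuous ubar) (hL : Integrable ubar) :
    ∃ C : ℝ, ∀ t ∈ Ico 0 T, (t : EReal) < lowerTime ubar xbar → |slope v x t| ≤ C := by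
  set n := ∫ y, |ubar y| with hn
  have hn0 : 0 ≤ n := integral_nonneg fun _ => abs_nonneg _
  have hzero : n = 0 → ubar = 0 := fun h => by
    have h1 := (integral_eq_zero_iff_of_nonneg (fun _ => abs_nonneg _) hL.abs).1 h
    refine Continuous.ae_eq_iff_eq volume hC continuous_zero |>.1 ?_
    filter_upwards [h1] with y hy using abs_eq_zero.1 hy
  have key : ∀ B τ : ℝ, 0 < B → |ubar xbar| + n < B ^ 2 → 0 < τ → τ ≤ T →
      B * (Real.exp τ - 1) ≤ Real.pi / 2 + Real.arctan (deriv ubar xbar / B) →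
      ∃ C, ∀ t ∈ Ico 0 τ, |slope v x t| ≤ C := fun B τ hB hmB hτ hτT h =>
    bounded_of_riccati hx.continuousOn_slope (fun t ht => hx.hasDerivAt_slope hu ht)
      (fun t ht => hx.abs_riccatiCoeff_le hu hC ht) (add_nonneg (abs_nonneg _) hn0) hB hmB hτ hτT
      (by rwa [hx.slope_zero hu hC])
  have hsize : size ubar xbar = |ubar xbar| + 2 * n := rfl
  by_cases hs : size ubar xbar = 0
  · have h1 : n = 0 := by linarith [abs_nonneg (ubar xbar)]
    have h2 := hzero h1
    have hT := hx.pos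
    -- For the zero datum any small `B` is admissible; with `B = e^{-T}` one has `B (e^T - 1) < 1 <
    -- π/2`.
    obtain ⟨C, hC⟩ := key (Real.exp T)⁻¹ T (by positivity)
      (by rw [h1, h2]; simp only [Pi.zero_apply, abs_zero, add_zero]; positivity) hT le_rfl (by
        rw [h2, deriv_zero, Pi.zero_apply, zero_div, Real.arctan_zero, add_zero, mul_sub,
          inv_mul_cancel₀ (Real.exp_pos T).ne']
        have := inv_pos.2 (Real.exp_pos T)
        linarith [Real.pi_gt_three])
    exact ⟨C, fun t ht _ => hC t ht⟩
  · have hs0 : 0 < size ubar xbar := lt_of_le_of_ne (by rw [hsize]; positivity) (Ne.symm hs)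
    set A := √(size ubar xbar) with hA
    have hA0 : 0 < A := Real.sqrt_pos.2 hs0
    -- Needed for `|ubar(xbar)| + n < A²`. A continuous datum with zero norm vanishes identically,
    -- which is the case already treated.
    have hn1 : 0 < n := lt_of_le_of_ne hn0 fun h => hs (by
      rw [hsize, ← h, hzero h.symm]
      simp)
    set L := Real.log (1 + 1 / A * (Real.pi / 2 + Real.arctan (deriv ubar xbar / A))) with hLdef
    have hlt : lowerTime ubar xbar = (L : EReal) := if_neg hs
    have hpos : 0 < Real.pi / 2 + Real.arctan (deriv ubar xbar / A) := by
      linarith [Real.neg_pi_div_two_lt_arctan (deriv ubar xbar / A)]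
    have hL1 : 0 < L := Real.log_pos (lt_add_of_pos_right _ (by positivity))
    have hexp : A * (Real.exp L - 1) = Real.pi / 2 + Real.arctan (deriv ubar xbar / A) := by
      rw [hLdef, Real.exp_log (by positivity)]
      field_simp
      ring
    obtain ⟨C, hC⟩ := key A (min T L) hA0 (by rw [hA, Real.sq_sqrt hs0.le, hsize]; linarith)
      (lt_min hx.pos hL1) (min_le_left _ _) (by
        rw [← hexp]
        have := Real.exp_le_exp.2 (min_le_right T L)
        exact mul_le_mul_of_nonneg_left (by linarith) hA0.le)
    refine ⟨C, fun t ht htL => hC t ⟨ht.1, lt_min ht.2 ?_⟩⟩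
    rw [hlt] at htL
    exact EReal.coe_lt_coe_iff.1 htL

/-- For steep negative initial slopes the life time is less than `T^*`, and the slope is
negative throughout. -/
lemma lt_upperTime (hx : IsClassicalCharacteristic u xbar T x v)
    (hu : IsWeakEntropySolution ubar u) (hC : Continuous ubar)
    (h : deriv ubar xbar < -(1 / 2) - √(size ubar xbar + 1 / 4)) :
    T < upperTime ubar xbar ∧ ∀ t ∈ Ico 0 T, slope v x t < 0 := by
  have hn0 : 0 ≤ ∫ y, |ubar y| := integral_nonneg fun _ => abs_nonneg _
  have hsize : size ubar xbar = |ubar xbar| + 2 * ∫ y, |ubar y| := rfl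
  have hs0 : 0 ≤ size ubar xbar := by rw [hsize]; positivity
  set B := √(size ubar xbar + 1 / 4) with hB
  have hB0 : 0 < B := Real.sqrt_pos.2 (by positivity)
  have h1 := blowup_of_riccati hx.continuousOn_slope (fun t ht => hx.hasDerivAt_slope hu ht)
    (fun t ht => hx.abs_riccatiCoeff_le hu hC ht) hx.pos hB0
    (by rw [hB, Real.sq_sqrt (by positivity), hsize]; linarith)
    (by rwa [hx.slope_zero hu hC])
  refine ⟨h1.1.trans_eq ?_, h1.2⟩
  rw [hx.slope_zero hu hC, upperTime, abs_of_neg (by linarith)]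
  have h2 : -deriv ubar xbar - 1 / 2 - B ≠ 0 := by linarith
  rw [div_eq_div_iff h2 (by linarith)]
  ring

end IsClassicalCharacteristic

/-! ### The end of a maximal characteristic. -/

namespace IsMaximalCharacteristic
variable {ubar : ℝ → ℝ} {u : ℝ → ℝ → ℝ} {xbar S : ℝ} {x : ℝ → ℝ} {v : ℝ × ℝ → ℝ}

/-- A maximal characteristic ends at a singularity of `u`. -/
lemma not_hasBoundedSlope (hx : IsMaximalCharacteristic u xbar S x v)
    (hu : IsWeakEntropySolution ubar u) : ¬ HasBoundedSlopeAroundBefore u x S := fun hb => by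
  obtain ⟨S', x', v', hS', hx'⟩ := hx.1.exists_extension hu hb
  exact absurd (hx.2 S' x' v' hx').1 (not_le.2 hS')

/-- If `u` is smooth around a maximal characteristic, the slope leaves every bounded set. -/
lemma eventually_lt_abs_slope (hx : IsMaximalCharacteristic u xbar S x v)
    (hu : IsWeakEntropySolution ubar u) (hs : IsSmoothAroundBefore u x S) (C : ℝ) :
    ∀ᶠ t in 𝓝[<] S, C < |slope v x t| := by
  obtain ⟨δ, hδ, h⟩ := hx.1.hasBoundedSlope_of_smooth hu hs C
  filter_upwards [Ioo_mem_nhdsLT (sub_lt_self S hδ)] with t ht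
  by_contra! hle
  exact hx.not_hasBoundedSlope hu (h t ht hle)

end IsMaximalCharacteristic

end BurgersPoisson

end

theorem mainTheorem2 (ubar : ℝ → ℝ) (hC : ContDiff ℝ 1 ubar) (hL : Integrable ubar)
    (u : ℝ → ℝ → ℝ) (hu : BurgersPoisson.IsWeakEntropySolution ubar u)
    (xbar T : ℝ) (x : ℝ → ℝ) (v : ℝ × ℝ → ℝ)
    (hx : BurgersPoisson.IsClassicalCharacteristic u xbar T x v) :
    -- (i) boundedness before `T_*`, and no breakdown of its own up to `T_*`
    ((∃ C : ℝ, ∀ t ∈ Ico 0 T, (t : EReal) < BurgersPoisson.lowerTime ubar xbar →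
        |BurgersPoisson.slope v x t| ≤ C) ∧
      (∀ (S : ℝ) (y : ℝ → ℝ) (w : ℝ × ℝ → ℝ),
        BurgersPoisson.IsMaximalCharacteristic u xbar S y w →
        (S : EReal) ≤ BurgersPoisson.lowerTime ubar xbar →
        ¬ BurgersPoisson.IsSmoothAroundBefore u y S)) ∧
    -- (ii) wave breaking before `T^*`
    (deriv ubar xbar < -(1 / 2) - √(|ubar xbar| + 2 * (∫ z, |ubar z|) + 1 / 4) →
      ∃ (S : ℝ) (y : ℝ → ℝ) (w : ℝ × ℝ → ℝ),
        BurgersPoisson.IsMaximalCharacteristic u xbar S y w ∧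
        S < BurgersPoisson.upperTime ubar xbar ∧
        ¬ BurgersPoisson.HasBoundedSlopeAroundBefore u y S ∧
        (BurgersPoisson.IsSmoothAroundBefore u y S →
          Tendsto (BurgersPoisson.slope w y) (𝓝[<] S) atBot)) := by
  have hc := hC.continuous
  refine ⟨⟨hx.exists_slope_bound hu hc hL, fun S y w hy hS hs => ?_⟩, fun h => ?_⟩
  · obtain ⟨C, hb⟩ := hy.1.exists_slope_bound hu hc hL
    obtain ⟨t, ht, htm⟩ := ((hy.eventually_lt_abs_slope hu hs C).and
      (Ioo_mem_nhdsLT hy.1.pos)).exists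
    exact absurd (hb t ⟨htm.1.le, htm.2⟩ ((EReal.coe_lt_coe_iff.2 htm.2).trans_le hS))
      (not_le.2 ht)
  -- All life times are bounded by `T^*`, so a maximal characteristic exists; the strict estimate
  -- applied to that characteristic itself gives `S < T^*`.
  · obtain ⟨S, y, w, hy⟩ := hu.exists_maximal ⟨T, x, v, hx⟩
      ⟨_, fun T' ⟨x', v', hx'⟩ => (hx'.lt_upperTime hu hc h).1.le⟩
    obtain ⟨hS, hneg⟩ := hy.1.lt_upperTime hu hc h
    refine ⟨S, y, w, hy, hS, hy.not_hasBoundedSlope hu, fun hs => tendsto_atBot.2 fun b => ?_⟩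
    filter_upwards [hy.eventually_lt_abs_slope hu hs (-b), Ioo_mem_nhdsLT hy.1.pos] with t ht htm
    rw [abs_of_neg (hneg t ⟨htm.1.le, htm.2⟩)] at ht
    linarith
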